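/- Let $X$ be a compact Hausdorff space, $U\subseteq X$ an open subset and $\sigma:U\to X$ a local homeomorphism. Let $C_c(U)$ be the set of $f\in C(X)$ whose closed support lies in $U$, put $\alpha(a)=a\circ\sigma$ for $a\in C(X)$, and $L:C_c(U)\to C(X)$, $L(f)(x)=\sum_{y\in U,\ \sigma(y)=x}f(y)$. Let $M$ be the Hilbert $C(X)$-module obtained from $C_c(U)$, with right action $f\cdot a=f\,\alpha(a)$ and inner product $\langle f,g\rangle=L(f^*g)$, by completion in the norm $\|L(f^*f)\|^{1/2}$, and let $\varphi(a)$ be the left multiplication by $a\in C(X)$ on $M$. Let $\mathcal T(X,\alpha,L)$ be the universal $C^*$-algebra generated by $C(X)\cup M$ with the relations of $C(X)$, of $M$, of the bimodule products, and $m^*n=\langle m,n\rangle$ for $m,n\in M$. A redundancy is a pair $(a,k)$ such that $a\in C(X)$, $k$ lies in the closed subalgebra of $\mathcal T(X,\alpha,L)$ generated by $\{mn^*: m,n\in M\}$, and $am=km$ for all $m\in M$. Let $\mathcal O(X,\alpha,L)$ be the quotient of $\mathcal T(X,\alpha,L)$ by the closed two-sided ideal generated by the elements $a-k$, for all redundancies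 $(a,k)$ with $a\in\ker(\varphi)^{\perp}\cap\varphi^{-1}(K(M))$, where $K(M)$ is the algebra of (generalized) compact operators on $M$. A set $V\subseteq X$ is called $\sigma,\sigma^{-1}$-invariant if $\sigma(V\cap U)\subseteq V$ and $\sigma^{-1}(V)\subseteq V$. For such a set $X'$, write $\sigma|_{X'}$ for the restriction $U\cap X'\to X'$ of $\sigma$. The pair $(X',\sigma|_{X'})$ is called topologically free if for all $i\ne j$ in $\mathbb N$ the closure in $X'$ of $V^{i,j}=\{x\in X': x \text{ lies in the domains of } (\sigma|_{X'})^i \text{ and } (\sigma|_{X'})^j, \text{ and } (\sigma|_{X'})^i(x)=(\sigma|_{X'})^j(x)\}$ has empty interior in $X'$. For an open set $V\subseteq X$ let $C_0(V)$ be the set of $f\in C(X)$ which vanish outside $V$, and let $\langle C_0(V)\rangle$ be the closed two-sided ideal of $\mathcal O(X,\alpha,L)$ generated by the image of $C_0(V)$. Theorem 4.8. Suppose that $(X',\sigma|_{X'})$ is topologically free for every closed $\sigma,\sigma^{-1}$-invariant subset $X'\subseteq X$. Then every closed two-sided ideal of $\mathcal O(X,\alpha,L)$ is of the form $\langle C_0(V)\rangle$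 for some open subset $V\subseteq X$. Moreover, the map $V\mapsto\langle C_0(V)\rangle$ is a bijection between the open $\sigma,\sigma^{-1}$-invariant subsets of $X$ and the closed two-sided ideals of $\mathcal O(X,\alpha,L)$. -/

import Mathlib

noncomputable section

namespace PartialEndo

open TopologicalSpace Set UniformSpace

open scoped ComplexOrder ENNReal

universe u

section Construction

variable {X : Type u} [TopologicalSpace X]

/-- `∑_{y ∈ U, σ(y) = x} f(y)`, for `σ : U → X`. -/
def fiberSum {U : Opens X} (σ : U → X) (f : X → ℂ) (x : X) : ℂ :=
  ∑ᶠ y ∈ σ ⁻¹' {x}, f (y : X)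

theorem finite_fiber {U : Opens X} {σ : U → X} (hσ : IsLocalHomeomorph σ) {K : Set X}
    (hK : IsCompact K) (hKU : K ⊆ U) (x : X) :
    {y : U | σ y = x ∧ (y : X) ∈ K}.Finite := by
  have hK' : IsCompact ((Subtype.val : U → X) ⁻¹' K) :=
    U.isOpen.isOpenEmbedding_subtypeVal.isInducing.isCompact_preimage_iff
      (by simpa using hKU) |>.2 hK
  choose e he1 he2 using hσ
  obtain ⟨t, -, ht⟩ := hK'.elim_nhds_subcover (fun y => (e y).source)
    (fun y _ => (e y).open_source.mem_nhds (he1 y))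
  refine Set.Finite.subset (s := ⋃ y ∈ t, {z | z ∈ (e y).source ∧ σ z = x}) ?_ ?_
  · refine t.finite_toSet.biUnion fun y _ => Set.Subsingleton.finite ?_
    rintro a ⟨ha, ha'⟩ b ⟨hb, hb'⟩
    refine (e y).injOn ha hb ?_
    rw [← he2 y, ha', hb']
  · rintro z ⟨hz, hzK⟩
    obtain ⟨y, hy, hzy⟩ := mem_iUnion₂.1 (ht hzK)
    exact mem_iUnion₂.2 ⟨y, hy, hzy, hz⟩

theorem fiberSum_eq_sum {U : Opens X} {σ : U → X} (hσ : IsLocalHomeomorph σ) {K : Set X}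
    (hK : IsCompact K) (hKU : K ⊆ U) {f : X → ℂ} (hf : ∀ z ∉ K, f z = 0) (x : X) :
    fiberSum σ f x = ∑ y ∈ (finite_fiber hσ hK hKU x).toFinset, f (y : X) := by
  refine finsum_mem_eq_sum_of_inter_support_eq _ ?_
  ext y
  by_cases hy : (y : X) ∈ K
  · simp [hy]
  · simp [hy, hf _ hy]

theorem continuous_fiberSum_aux [CompactSpace X] [T2Space X] {U : Opens X} {σ : U → X}
    (e : OpenPartialHomeomorph U X) (he : σ = e) (f : C(X, ℂ))
    (hf : tsupport f ⊆ Subtype.val '' e.source) : Continuous (fiberSum σ f) := by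
  classical
  subst he
  have hKU : tsupport f ⊆ (U : Set X) := hf.trans (by rintro _ ⟨y, -, rfl⟩; exact y.2)
  have hK' : IsCompact ((Subtype.val : U → X) ⁻¹' tsupport f) :=
    U.isOpen.isOpenEmbedding_subtypeVal.isInducing.isCompact_preimage_iff
      (by simpa using hKU) |>.2 (isClosed_tsupport f).isCompact
  have hsub : (Subtype.val : U → X) ⁻¹' tsupport f ⊆ e.source := by
    intro y hy
    obtain ⟨z, hz, hzy⟩ := hf hy
    rwa [← Subtype.ext hzy]
  have hC : IsClosed (e '' ((Subtype.val : U → X) ⁻¹' tsupport f)) :=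
    (hK'.image_of_continuousOn (e.continuousOn.mono hsub)).isClosed
  rw [continuous_iff_continuousAt]
  intro x
  by_cases hx : x ∈ e.target
  · have h1 : ContinuousAt (fun z => f (e.symm z : X)) x :=
      f.continuous.continuousAt.comp
        (continuous_subtype_val.continuousAt.comp (e.continuousAt_symm hx))
    refine h1.congr ?_
    filter_upwards [e.open_target.mem_nhds hx] with z hz
    symm
    unfold fiberSum
    rw [finsum_eq_single _ (e.symm z)]
    · rw [finsum_eq_if, if_pos (show e.symm z ∈ e ⁻¹' {z} from e.right_inv hz)]
    · intro y hy
      rw [finsum_eq_if]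
      refine ite_eq_right_iff.2 fun hyz => ?_
      refine image_eq_zero_of_notMem_tsupport fun hyK => hy ?_
      have hyz' : e y = z := hyz
      rw [← hyz', e.left_inv (hsub hyK)]
  · have hx' : x ∉ e '' ((Subtype.val : U → X) ⁻¹' tsupport f) := by
      rintro ⟨y, hy, rfl⟩
      exact hx (e.map_source (hsub hy))
    refine (continuousAt_const (y := (0 : ℂ))).congr ?_
    filter_upwards [hC.isOpen_compl.mem_nhds hx'] with z hz
    symm
    refine finsum_mem_eq_zero_of_forall_eq_zero fun y hyz => ?_
    exact image_eq_zero_of_notMem_tsupport fun hyK => hz ⟨y, hyK, hyz⟩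

theorem continuous_fiberSum [CompactSpace X] [T2Space X] {U : Opens X} {σ : U → X}
    (hσ : IsLocalHomeomorph σ) (f : C(X, ℂ)) (hf : tsupport f ⊆ U) :
    Continuous (fiberSum σ f) := by
  have hK : IsCompact (tsupport f) := (isClosed_tsupport f).isCompact
  choose e he1 he2 using id hσ
  have hopen : ∀ y, IsOpen ((Subtype.val : U → X) '' (e y).source) := fun y =>
    U.isOpen.isOpenEmbedding_subtypeVal.isOpenMap _ (e y).open_source
  obtain ⟨t, ht⟩ := hK.elim_finite_subcover
    (fun y : U => (Subtype.val : U → X) '' (e y).source) hopen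
    (fun z hz => mem_iUnion.2 ⟨⟨z, hf hz⟩, _, he1 _, rfl⟩)
  obtain ⟨ρ, hρ1, hρ2, -, -⟩ := exists_continuous_sum_one_of_isOpen_isCompact
    (s := fun i : Fin t.card => (Subtype.val : U → X) '' (e (t.equivFin.symm i)).source)
    (fun i => hopen _) hK (by
      intro z hz
      obtain ⟨y, hy, hzy⟩ := mem_iUnion₂.1 (ht hz)
      exact mem_iUnion.2 ⟨t.equivFin ⟨y, hy⟩, by simpa using hzy⟩)
  let g : Fin t.card → C(X, ℂ) := fun i =>
    ⟨fun x => (ρ i x : ℂ) * f x, by fun_prop⟩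
  have hg : ∀ i, Continuous (fiberSum σ (g i)) := fun i =>
    continuous_fiberSum_aux _ (he2 _) (g i) (by
      refine subset_trans (closure_minimal ?_ (isClosed_tsupport (ρ i))) (hρ1 i)
      intro x hx
      refine subset_tsupport _ fun h => hx ?_
      simp [g, h])
  have hsum : fiberSum σ f = fun x => ∑ i, fiberSum σ (g i) x := by
    funext x
    rw [fiberSum_eq_sum hσ hK hf (fun z hz => image_eq_zero_of_notMem_tsupport hz)]
    have : ∀ i, fiberSum σ (g i) x = _ := fun i =>
      fiberSum_eq_sum hσ hK hf (fun z hz => by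
        simp [g, image_eq_zero_of_notMem_tsupport hz]) x
    simp_rw [this]
    rw [Finset.sum_comm]
    refine Finset.sum_congr rfl fun y hy => ?_
    have hy' : (y : X) ∈ tsupport f := by simpa using ((Set.Finite.mem_toFinset _).1 hy).2
    have h1 := hρ2 hy'
    simp only [g, ContinuousMap.coe_mk, ← Finset.sum_mul]
    have h2 : ∑ i, (ρ i (y : X) : ℂ) = 1 := by
      have : ∑ i, ρ i (y : X) = 1 := by simpa using h1
      exact_mod_cast this
    rw [h2, one_mul]
  rw [hsum]
  exact continuous_finsetSum _ fun i _ => hg i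

/-- `C_c(U)`: the continuous functions on `X` whose (closed) support lies in `U`. -/
def Cc (U : Opens X) : Ideal C(X, ℂ) where
  carrier := {f | tsupport f ⊆ U}
  add_mem' {f g} hf hg := (tsupport_add f g).trans (union_subset hf hg)
  zero_mem' := by
    have h : ⇑(0 : C(X, ℂ)) = 0 := rfl
    simp [h, tsupport]
  smul_mem' c f hf :=
    (closure_mono (Function.support_subset_iff'.2 fun x hx => by
      simp [Function.notMem_support.1 hx])).trans hf

open Classical in
/-- The function `f · α(a)`, where `α(a) = a ∘ σ` on `U`; it vanishes outside `U`. -/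
def mulAlphaFun {U : Opens X} (σ : U → X) (f a : C(X, ℂ)) (x : X) : ℂ :=
  if h : x ∈ U then f x * a (σ ⟨x, h⟩) else 0

theorem continuous_mulAlphaFun {U : Opens X} {σ : U → X} (hσ : IsLocalHomeomorph σ)
    (f a : C(X, ℂ)) (hf : tsupport f ⊆ U) : Continuous (mulAlphaFun σ f a) := by
  rw [continuous_iff_continuousAt]
  intro x
  by_cases hx : x ∈ U
  · have h1 : Continuous (fun y : U => f (y : X) * a (σ y)) := by
      have := hσ.continuous
      fun_prop
    have h2 : (fun y : U => f (y : X) * a (σ y)) = mulAlphaFun σ f a ∘ Subtype.val := by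
      funext y
      simp [mulAlphaFun]
    rw [h2] at h1
    exact (U.isOpen.isOpenEmbedding_subtypeVal.continuousAt_iff (x := ⟨x, hx⟩)).1
      h1.continuousAt
  · have hx' : x ∉ tsupport f := fun h => hx (hf h)
    refine (continuousAt_const (y := (0 : ℂ))).congr ?_
    filter_upwards [(isClosed_tsupport f).isOpen_compl.mem_nhds hx'] with z hz
    simp [mulAlphaFun, image_eq_zero_of_notMem_tsupport hz]

theorem tsupport_mulAlphaFun {U : Opens X} {σ : U → X} (f a : C(X, ℂ)) :
    tsupport (mulAlphaFun σ f a) ⊆ tsupport f :=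
  closure_mono fun x hx h => hx (by simp [mulAlphaFun, h])

/-- The space `C_c(U)`, as the semi-inner product module out of which `M` is built. It is a
right module over `C(X)` by `f · a = f α(a)`; as `C(X)` is commutative, this right action is
written `a • f` below. -/
def PreModule {U : Opens X} {σ : U → X} (_hσ : IsLocalHomeomorph σ) : Type u := Cc U

namespace PreModule

variable {U : Opens X} {σ : U → X} {hσ : IsLocalHomeomorph σ}

instance : AddCommGroup (PreModule hσ) := inferInstanceAs (AddCommGroup (Cc U))
instance : Module ℂ (PreModule hσ) := inferInstanceAs (Module ℂ (Cc U))

/-- The underlying function on `X`. -/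
def fn (f : PreModule hσ) : C(X, ℂ) := Subtype.val (p := (· ∈ Cc U)) f

/-- The element of the module given by a function in `C_c(U)`. -/
def of (hσ : IsLocalHomeomorph σ) (f : C(X, ℂ)) (hf : f ∈ Cc U) : PreModule hσ := ⟨f, hf⟩

theorem fn_mem (f : PreModule hσ) : f.fn ∈ Cc U := Subtype.prop (p := (· ∈ Cc U)) f
theorem tsupport_fn (f : PreModule hσ) : tsupport f.fn ⊆ U := f.fn_mem
@[ext] theorem ext {f g : PreModule hσ} (h : f.fn = g.fn) : f = g := Subtype.ext h
@[simp] theorem fn_of (f : C(X, ℂ)) (hf : f ∈ Cc U) : (of hσ f hf).fn = f := rfl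
@[simp] theorem fn_add (f g : PreModule hσ) : (f + g).fn = f.fn + g.fn := rfl
@[simp] theorem fn_zero : (0 : PreModule hσ).fn = 0 := rfl
@[simp] theorem fn_smul (c : ℂ) (f : PreModule hσ) : (c • f).fn = c • f.fn := rfl

theorem fn_apply_eq_zero (f : PreModule hσ) {z : X} (hz : z ∉ U) : f.fn z = 0 :=
  image_eq_zero_of_notMem_tsupport fun h => hz (f.tsupport_fn h)

theorem ext_of_dom {f g : PreModule hσ} (h : ∀ y : U, f.fn y = g.fn y) : f = g := by
  ext x
  by_cases hx : x ∈ U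
  · exact h ⟨x, hx⟩
  · rw [f.fn_apply_eq_zero hx, g.fn_apply_eq_zero hx]

/-- The right action `f · a = f α(a)`. -/
instance : SMul C(X, ℂ) (PreModule hσ) where
  smul a f := of hσ ⟨mulAlphaFun σ f.fn a, continuous_mulAlphaFun hσ f.fn a f.tsupport_fn⟩
    ((tsupport_mulAlphaFun f.fn a).trans f.tsupport_fn)

theorem fn_right_smul (a : C(X, ℂ)) (f : PreModule hσ) (y : U) :
    (a • f).fn y = f.fn y * a (σ y) := by
  change mulAlphaFun σ f.fn a y = _
  simp [mulAlphaFun]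

end PreModule

variable [CompactSpace X] [T2Space X]

/-- The transfer operator `L : C_c(U) → C(X)`, `L(f)(x) = ∑_{σ(y) = x} f(y)`. -/
def transfer {U : Opens X} {σ : U → X} (hσ : IsLocalHomeomorph σ) (f : Cc U) : C(X, ℂ) :=
  ⟨fiberSum σ (f : C(X, ℂ)), continuous_fiberSum hσ f f.2⟩

namespace PreModule

variable {U : Opens X} {σ : U → X} {hσ : IsLocalHomeomorph σ}

/-- The semi-inner product `⟨f, g⟩ = L(f^* g)`. -/
instance : Inner C(X, ℂ) (PreModule hσ) where
  inner f g := transfer hσ ⟨star f.fn * g.fn, (Cc U).mul_mem_left _ g.fn_mem⟩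

/-- The norm `‖f‖ = ‖L(f^* f)‖ ^ (1/2)`. -/
instance : Norm (PreModule hσ) where
  norm f := √‖inner C(X, ℂ) f f‖

theorem inner_apply (f g : PreModule hσ) (x : X) :
    inner C(X, ℂ) f g x = ∑ y ∈ (finite_fiber hσ (isClosed_tsupport g.fn).isCompact
      g.tsupport_fn x).toFinset, star (f.fn y) * g.fn y :=
  fiberSum_eq_sum hσ (isClosed_tsupport g.fn).isCompact g.tsupport_fn
    (f := ⇑(star f.fn * g.fn)) (fun z hz => by
      simp [image_eq_zero_of_notMem_tsupport hz]) x

theorem inner_apply' (f g : PreModule hσ) {K : Set X} (hK : IsCompact K) (hKU : K ⊆ U)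
    (hg : ∀ z ∉ K, f.fn z = 0 ∨ g.fn z = 0) (x : X) :
    inner C(X, ℂ) f g x =
      ∑ y ∈ (finite_fiber hσ hK hKU x).toFinset, star (f.fn y) * g.fn y :=
  fiberSum_eq_sum hσ hK hKU (f := ⇑(star f.fn * g.fn)) (fun z hz => by
      rcases hg z hz with h | h <;> simp [h]) x

theorem inner_self_apply_ne {f : PreModule hσ} {y : U} (hy : f.fn y ≠ 0) :
    inner C(X, ℂ) f f (σ y) ≠ 0 := by
  rw [inner_apply]
  refine ne_of_gt (Finset.sum_pos' (fun z _ => star_mul_self_nonneg _) ⟨y, ?_, ?_⟩)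
  · simpa using subset_tsupport f.fn hy
  · exact star_mul_self_pos (IsRegular.of_ne_zero hy)

instance : CStarModule C(X, ℂ) (PreModule hσ) where
  inner_add_right {f g h} := by
    ext x
    have hK := (isClosed_tsupport g.fn).isCompact.union (isClosed_tsupport h.fn).isCompact
    have hKU := union_subset g.tsupport_fn h.tsupport_fn
    rw [ContinuousMap.add_apply, inner_apply' _ _ hK hKU, inner_apply' _ _ hK hKU,
      inner_apply' _ _ hK hKU, ← Finset.sum_add_distrib]
    · simp [mul_add]
    all_goals
      intro z hz
      rw [mem_union, not_or] at hz
      simp [image_eq_zero_of_notMem_tsupport hz.1, image_eq_zero_of_notMem_tsupport hz.2]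
  inner_self_nonneg {f} := by
    rw [ContinuousMap.le_def]
    intro x
    rw [inner_apply]
    exact Finset.sum_nonneg fun _ _ => star_mul_self_nonneg _
  inner_self {f} := by
    constructor
    · intro h
      ext x
      by_contra hx
      have hxU : x ∈ U := by
        by_contra hxU
        exact hx (by simpa using f.fn_apply_eq_zero hxU)
      exact inner_self_apply_ne (y := ⟨x, hxU⟩) hx (by rw [h]; rfl)
    · rintro rfl
      ext x
      rw [inner_apply]
      simp
  inner_op_smul_right {a f g} := by
    ext x
    have hK := (isClosed_tsupport g.fn).isCompact
    rw [ContinuousMap.mul_apply, inner_apply' _ _ hK g.tsupport_fn,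
      inner_apply' _ _ hK g.tsupport_fn, Finset.mul_sum]
    · refine Finset.sum_congr rfl fun y hy => ?_
      have hy' : σ y = x := ((Set.Finite.mem_toFinset _).1 hy).1
      rw [fn_right_smul, hy']
      ring
    · intro z hz
      exact Or.inr (image_eq_zero_of_notMem_tsupport hz)
    · intro z hz
      refine Or.inr ?_
      by_cases hzU : z ∈ U
      · have := fn_right_smul a g ⟨z, hzU⟩
        rw [this, image_eq_zero_of_notMem_tsupport hz, zero_mul]
      · exact fn_apply_eq_zero _ hzU
  inner_smul_right_complex {c f g} := by
    ext x
    have hK := (isClosed_tsupport g.fn).isCompact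
    rw [ContinuousMap.smul_apply, inner_apply' _ _ hK g.tsupport_fn,
      inner_apply' _ _ hK g.tsupport_fn, Finset.smul_sum]
    · refine Finset.sum_congr rfl fun y hy => ?_
      simp only [fn_smul, ContinuousMap.smul_apply, smul_eq_mul]
      ring
    all_goals
      intro z hz
      simp [image_eq_zero_of_notMem_tsupport hz]
  star_inner f g := by
    ext x
    have hK := (isClosed_tsupport g.fn).isCompact
    rw [ContinuousMap.star_apply, inner_apply' _ _ hK g.tsupport_fn,
      inner_apply' _ _ hK g.tsupport_fn, star_sum]
    · refine Finset.sum_congr rfl fun y hy => ?_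
      simp [mul_comm]
    all_goals
      intro z hz
      simp [image_eq_zero_of_notMem_tsupport hz]
  norm_eq_sqrt_norm_inner_self _ := rfl

instance : NormedAddCommGroup (PreModule hσ) := CStarModule.normedAddCommGroup C(X, ℂ)
instance : NormedSpace ℂ (PreModule hσ) := .ofCore (CStarModule.normedSpaceCore C(X, ℂ))

theorem norm_sq (f : PreModule hσ) : ‖f‖ ^ 2 = ‖inner C(X, ℂ) f f‖ :=
  CStarModule.norm_sq_eq C(X, ℂ)

instance : Module C(X, ℂ) (PreModule hσ) where
  one_smul f := ext_of_dom fun y => by simp [fn_right_smul]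
  mul_smul a b f := ext_of_dom fun y => by simp only [fn_right_smul, ContinuousMap.mul_apply]; ring
  smul_zero a := ext_of_dom fun y => by simp [fn_right_smul]
  smul_add a f g := ext_of_dom fun y => by
    simp only [fn_right_smul, fn_add, ContinuousMap.add_apply]; ring
  add_smul a b f := ext_of_dom fun y => by
    simp only [fn_right_smul, fn_add, ContinuousMap.add_apply]; ring
  zero_smul f := ext_of_dom fun y => by simp [fn_right_smul]

instance : IsScalarTower ℂ C(X, ℂ) (PreModule hσ) where
  smul_assoc c a f := ext_of_dom fun y => by
    simp only [fn_right_smul, fn_smul, ContinuousMap.smul_apply, smul_eq_mul]; ring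

instance : SMulCommClass C(X, ℂ) ℂ (PreModule hσ) where
  smul_comm a c f := ext_of_dom fun y => by
    simp only [fn_right_smul, fn_smul, ContinuousMap.smul_apply, smul_eq_mul]; ring

theorem norm_right_smul_le (a : C(X, ℂ)) (f : PreModule hσ) : ‖a • f‖ ≤ ‖a‖ * ‖f‖ := by
  refine abs_le_of_sq_le_sq' ?_ (by positivity) |>.2
  rw [mul_pow, norm_sq, norm_sq,
    CStarModule.inner_op_smul_right (A := C(X, ℂ)) (E := PreModule hσ),
    CStarModule.inner_op_smul_left (A := C(X, ℂ)) (E := PreModule hσ)]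
  calc ‖a * (inner C(X, ℂ) f f * star a)‖ ≤ ‖a‖ * (‖inner C(X, ℂ) f f‖ * ‖star a‖) :=
        (norm_mul_le _ _).trans (by gcongr; exact norm_mul_le _ _)
    _ = ‖a‖ ^ 2 * ‖inner C(X, ℂ) f f‖ := by rw [norm_star]; ring

instance : UniformContinuousConstSMul C(X, ℂ) (PreModule hσ) where
  uniformContinuous_const_smul a :=
    (AddMonoidHomClass.continuous_of_bound (DistribSMul.toAddMonoidHom (PreModule hσ) a) ‖a‖
      (norm_right_smul_le a) |> uniformContinuous_addMonoidHom_of_continuous)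

theorem norm_left_mul_le (a : C(X, ℂ)) (f : PreModule hσ) :
    ‖of hσ (a * f.fn) ((Cc U).mul_mem_left a f.fn_mem)‖ ≤ ‖a‖ * ‖f‖ := by
  refine abs_le_of_sq_le_sq' ?_ (by positivity) |>.2
  rw [mul_pow, norm_sq, norm_sq]
  refine (ContinuousMap.norm_le _ (by positivity)).2 fun x => ?_
  have h0 : ∀ y : X, 0 ≤ star (f.fn y) * f.fn y := fun y => star_mul_self_nonneg _
  have hK := (isClosed_tsupport f.fn).isCompact
  have h1 : ‖inner C(X, ℂ) f f x‖ ≤ ‖inner C(X, ℂ) f f‖ := ContinuousMap.norm_coe_le_norm _ x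
  refine le_trans ?_ (mul_le_mul_of_nonneg_left h1 (by positivity))
  rw [inner_apply' _ _ hK f.tsupport_fn, inner_apply' _ _ hK f.tsupport_fn]
  · have h2 : ‖∑ y ∈ (finite_fiber hσ hK f.tsupport_fn x).toFinset,
        star (f.fn y) * f.fn y‖ =
        ∑ y ∈ (finite_fiber hσ hK f.tsupport_fn x).toFinset, ‖f.fn y‖ ^ 2 := by
      have : ∑ y ∈ (finite_fiber hσ hK f.tsupport_fn x).toFinset, star (f.fn y) * f.fn y =
          ((∑ y ∈ (finite_fiber hσ hK f.tsupport_fn x).toFinset, ‖f.fn y‖ ^ 2 : ℝ) : ℂ) := by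
        push_cast
        exact Finset.sum_congr rfl fun y _ => by
          rw [Complex.star_def, Complex.conj_mul']
      rw [this, Complex.norm_real, Real.norm_of_nonneg (by positivity)]
    rw [h2, Finset.mul_sum]
    refine (norm_sum_le _ _).trans (Finset.sum_le_sum fun y _ => ?_)
    have h3 : ‖a y‖ ≤ ‖a‖ := ContinuousMap.norm_coe_le_norm a _
    simp only [fn_of, ContinuousMap.mul_apply, norm_mul, norm_star]
    calc ‖a y‖ * ‖f.fn y‖ * (‖a y‖ * ‖f.fn y‖) = ‖a y‖ ^ 2 * ‖f.fn y‖ ^ 2 := by ring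
      _ ≤ _ := by gcongr
  · intro z hz
    simp [image_eq_zero_of_notMem_tsupport hz]
  · intro z hz
    simp [image_eq_zero_of_notMem_tsupport hz]

/-- The left action `f ↦ a f` of `a ∈ C(X)`. -/
def leftMul (hσ : IsLocalHomeomorph σ) (a : C(X, ℂ)) : PreModule hσ →L[ℂ] PreModule hσ :=
  LinearMap.mkContinuous
    { toFun := fun f => of hσ (a * f.fn) ((Cc U).mul_mem_left a f.fn_mem)
      map_add' := fun f g => ext (by simp [mul_add])
      map_smul' := fun c f => ext (by simp) } ‖a‖ (norm_left_mul_le a)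

end PreModule

section Correspondence

variable {U : Opens X} {σ : U → X}

/-- The Hilbert `C(X)`-module `M`: the completion of `C_c(U)` in the norm `‖L(f^* f)‖ ^ (1/2)`.
Its inner product and its right action `m · a` (written `a • m`) are the continuous extensions of
those on `C_c(U)`. -/
abbrev HilbertModule (hσ : IsLocalHomeomorph σ) : Type u :=
  UniformSpace.Completion (PreModule hσ)

variable (hσ : IsLocalHomeomorph σ)

theorem continuous_inner_hilbertModule :
    Continuous fun p : HilbertModule hσ × HilbertModule hσ => inner C(X, ℂ) p.1 p.2 := by
  let φ : PreModule hσ →+ PreModule hσ →+ C(X, ℂ) :=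
    { toFun := fun x => (CStarModule.innerₛₗ (A := C(X, ℂ)) x).toAddMonoidHom
      map_zero' := by ext x; simp
      map_add' := fun x y => by ext z; simp }
  have h : Continuous fun p : PreModule hσ × PreModule hσ => φ p.1 p.2 :=
    CStarModule.continuous_inner
  exact (Completion.isDenseInducing_toCompl (PreModule hσ)).extend_Z_bilin
    (Completion.isDenseInducing_toCompl (PreModule hσ)) h

theorem inner_coe_hilbertModule (f g : PreModule hσ) :
    inner C(X, ℂ) (f : HilbertModule hσ) (g : HilbertModule hσ) = inner C(X, ℂ) f g :=
  (Completion.isDenseInducing_coe.prodMap Completion.isDenseInducing_coe).extend_eq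
    (CStarModule.continuous_inner (A := C(X, ℂ)) (E := PreModule hσ)) (f, g)

theorem continuous_inner_comp {Z : Type*} [TopologicalSpace Z] {f g : Z → HilbertModule hσ}
    (hf : Continuous f) (hg : Continuous g) :
    Continuous fun z => inner C(X, ℂ) (f z) (g z) :=
  (continuous_inner_hilbertModule hσ).comp (hf.prodMk hg)

theorem norm_sq_hilbertModule (m : HilbertModule hσ) : ‖m‖ ^ 2 = ‖inner C(X, ℂ) m m‖ := by
  induction m using Completion.induction_on with
  | hp =>
    exact isClosed_eq (by fun_prop)
      (continuous_inner_comp hσ continuous_id continuous_id).norm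
  | ih f => rw [inner_coe_hilbertModule, Completion.norm_coe, PreModule.norm_sq]

instance : CStarModule C(X, ℂ) (HilbertModule hσ) where
  inner_add_right {x y z} := by
    refine Completion.induction_on₃ x y z (isClosed_eq ?_ ?_) fun f g h => ?_
    · exact continuous_inner_comp hσ (by fun_prop) (by fun_prop)
    · exact (continuous_inner_comp hσ (by fun_prop) (by fun_prop)).add
        (continuous_inner_comp hσ (by fun_prop) (by fun_prop))
    · simp only [← Completion.coe_add, inner_coe_hilbertModule, CStarModule.inner_add_right (A := C(X, ℂ)) (E := PreModule hσ)]
  inner_self_nonneg {x} := by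
    refine Completion.induction_on x ?_ fun f => ?_
    · have h : IsClosed {a : C(X, ℂ) | 0 ≤ a} := by
        have : {a : C(X, ℂ) | 0 ≤ a} = ⋂ x, {a : C(X, ℂ) | 0 ≤ a x} := by
          ext a
          simp [ContinuousMap.le_def]
        rw [this]
        exact isClosed_iInter fun x =>
          isClosed_le continuous_const (continuous_eval_const x)
      exact h.preimage (continuous_inner_comp hσ continuous_id continuous_id)
    · rw [inner_coe_hilbertModule]
      exact CStarModule.inner_self_nonneg (A := C(X, ℂ)) (E := PreModule hσ)
  inner_self {x} := by
    have h := norm_sq_hilbertModule hσ x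
    constructor
    · intro hx
      rw [hx, norm_zero, sq_eq_zero_iff] at h
      exact norm_eq_zero.1 h
    · rintro rfl
      rw [norm_zero, zero_pow two_ne_zero] at h
      exact norm_eq_zero.1 h.symm
  inner_op_smul_right {a x y} := by
    refine Completion.induction_on₂ x y (isClosed_eq ?_ ?_) fun f g => ?_
    · exact continuous_inner_comp hσ continuous_fst (continuous_snd.const_smul a)
    · exact (continuous_const_mul a).comp
        (continuous_inner_comp hσ continuous_fst continuous_snd)
    · rw [← Completion.coe_smul, inner_coe_hilbertModule, inner_coe_hilbertModule,
        CStarModule.inner_op_smul_right (A := C(X, ℂ)) (E := PreModule hσ)]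
  inner_smul_right_complex {c x y} := by
    refine Completion.induction_on₂ x y (isClosed_eq ?_ ?_) fun f g => ?_
    · exact continuous_inner_comp hσ continuous_fst (continuous_snd.const_smul c)
    · exact (continuous_const_smul c).comp
        (continuous_inner_comp hσ continuous_fst continuous_snd)
    · rw [← Completion.coe_smul, inner_coe_hilbertModule, inner_coe_hilbertModule,
        CStarModule.inner_smul_right_complex (A := C(X, ℂ)) (E := PreModule hσ)]
  star_inner x y := by
    refine Completion.induction_on₂ x y (isClosed_eq ?_ ?_) fun f g => ?_
    · exact (continuous_inner_comp hσ (by fun_prop) (by fun_prop)).star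
    · exact continuous_inner_comp hσ (by fun_prop) (by fun_prop)
    · rw [inner_coe_hilbertModule, inner_coe_hilbertModule, CStarModule.star_inner (A := C(X, ℂ)) (E := PreModule hσ)]
  norm_eq_sqrt_norm_inner_self x := by
    rw [← norm_sq_hilbertModule, Real.sqrt_sq (norm_nonneg x)]

theorem norm_right_smul_le (a : C(X, ℂ)) (m : HilbertModule hσ) : ‖a • m‖ ≤ ‖a‖ * ‖m‖ := by
  refine abs_le_of_sq_le_sq' ?_ (by positivity) |>.2
  rw [mul_pow, norm_sq_hilbertModule, norm_sq_hilbertModule,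
    CStarModule.inner_op_smul_right (A := C(X, ℂ)) (E := HilbertModule hσ),
    CStarModule.inner_op_smul_left (A := C(X, ℂ)) (E := HilbertModule hσ)]
  calc ‖a * (inner C(X, ℂ) m m * star a)‖ ≤ ‖a‖ * (‖inner C(X, ℂ) m m‖ * ‖star a‖) :=
        (norm_mul_le _ _).trans (by gcongr; exact norm_mul_le _ _)
    _ = ‖a‖ ^ 2 * ‖inner C(X, ℂ) m m‖ := by rw [norm_star]; ring

/-- `φ(a)`, the left multiplication by `a ∈ C(X)` on `M`. -/
def leftAction (a : C(X, ℂ)) : HilbertModule hσ →L[ℂ] HilbertModule hσ :=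
  (PreModule.leftMul hσ a).completion

/-- The operator `m ⊗ n : ξ ↦ m ⟨n, ξ⟩` on `M`. -/
def rankOne (m n : HilbertModule hσ) : HilbertModule hσ →L[ℂ] HilbertModule hσ :=
  LinearMap.mkContinuous
    { toFun := fun ξ => inner C(X, ℂ) n ξ • m
      map_add' := fun ξ η => by rw [CStarModule.inner_add_right (A := C(X, ℂ)) (E := HilbertModule hσ), add_smul]
      map_smul' := fun c ξ => by
        rw [CStarModule.inner_smul_right_complex (A := C(X, ℂ)) (E := HilbertModule hσ), smul_assoc, RingHom.id_apply] }
    (‖m‖ * ‖n‖) fun ξ => by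
      calc ‖inner C(X, ℂ) n ξ • m‖ ≤ ‖inner C(X, ℂ) n ξ‖ * ‖m‖ := norm_right_smul_le hσ _ _
        _ ≤ (‖n‖ * ‖ξ‖) * ‖m‖ := by
          exact mul_le_mul_of_nonneg_right
            (CStarModule.norm_inner_le (A := C(X, ℂ)) (HilbertModule hσ)) (norm_nonneg m)
        _ = ‖m‖ * ‖n‖ * ‖ξ‖ := by ring

/-- `K(M)`: the closed linear span of the operators `m ⊗ n`. -/
def compactOperators : Submodule ℂ (HilbertModule hσ →L[ℂ] HilbertModule hσ) :=
  (Submodule.span ℂ {T | ∃ m n, T = rankOne hσ m n}).topologicalClosure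

/-- `I₀ = ker(φ)^⊥ ∩ φ⁻¹(K(M))`. -/
def katsuraSet : Set C(X, ℂ) :=
  {a | (∀ b, leftAction hσ b = 0 → a * b = 0) ∧ leftAction hσ a ∈ compactOperators hσ}

end Correspondence

section Toeplitz

variable {U : Opens X} {σ : U → X}

/-- A family of elements of a C⋆-algebra indexed by `C(X) ∪ M` which satisfies the relations of
the Toeplitz algebra: those of `C(X)`, those of `M`, those of the bimodule products, and
`m^* n = ⟨m, n⟩`. -/
structure ToeplitzRep (hσ : IsLocalHomeomorph σ) where
  /-- The C⋆-algebra. -/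
  B : Type u
  [alg : NonUnitalCStarAlgebra B]
  /-- The images of the elements of `C(X)`. -/
  π : C(X, ℂ) →⋆ₙₐ[ℂ] B
  /-- The images of the elements of `M`. -/
  t : HilbertModule hσ →ₗ[ℂ] B
  left_mul : ∀ a m, π a * t m = t (leftAction hσ a m)
  mul_right : ∀ a m, t m * π a = t (a • m)
  star_mul : ∀ m n, star (t m) * t n = π (inner C(X, ℂ) m n)

attribute [instance] ToeplitzRep.alg

variable (hσ : IsLocalHomeomorph σ)

/-- The bounded families indexed by all the representations. As `C(X)` and `M` live in `Type u`,
every C⋆-algebra generated by a representation of them has a copy in `Type u`, and so the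
supremum over these representations is the largest C⋆-seminorm. -/
abbrev RepProduct : Type (u + 1) := lp (fun r : ToeplitzRep hσ => r.B) ∞

/-- `C(X)` in the product of all representations. -/
def repA (a : C(X, ℂ)) : RepProduct hσ :=
  ⟨fun r => r.π a, memℓp_infty ⟨‖a‖, by
    rintro _ ⟨r, rfl⟩
    exact NonUnitalStarAlgHom.norm_apply_le r.π a⟩⟩

/-- `M` in the product of all representations. -/
def repM (m : HilbertModule hσ) : RepProduct hσ :=
  ⟨fun r => r.t m, memℓp_infty ⟨‖m‖, by
    rintro _ ⟨r, rfl⟩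
    refine abs_le_of_sq_le_sq' ?_ (norm_nonneg m) |>.2
    rw [sq, ← CStarRing.norm_star_mul_self, r.star_mul, norm_sq_hilbertModule]
    exact NonUnitalStarAlgHom.norm_apply_le r.π _⟩⟩

/-- The closed star subalgebra generated by `C(X) ∪ M` in the product of all representations. -/
def toeplitzSubalgebra : NonUnitalStarSubalgebra ℂ (RepProduct hσ) :=
  (NonUnitalStarAlgebra.adjoin ℂ (range (repA hσ) ∪ range (repM hσ))).topologicalClosure

instance : IsClosed (toeplitzSubalgebra hσ : Set (RepProduct hσ)) :=
  NonUnitalStarSubalgebra.isClosed_topologicalClosure _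

/-- The Toeplitz algebra `𝒯(X, α, L)`: the universal C⋆-algebra generated by `C(X) ∪ M` with the
relations listed in `ToeplitzRep`. -/
def Toeplitz : Type (u + 1) := toeplitzSubalgebra hσ

instance : NonUnitalCStarAlgebra (Toeplitz hσ) :=
  inferInstanceAs (NonUnitalCStarAlgebra (toeplitzSubalgebra hσ))

/-- The element of the Toeplitz algebra given by `a ∈ C(X)`. -/
def Toeplitz.ofA (a : C(X, ℂ)) : Toeplitz hσ :=
  ⟨repA hσ a, subset_closure (NonUnitalStarAlgebra.subset_adjoin ℂ _ (Or.inl ⟨a, rfl⟩))⟩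

/-- The element of the Toeplitz algebra given by `m ∈ M`. -/
def Toeplitz.ofM (m : HilbertModule hσ) : Toeplitz hσ :=
  ⟨repM hσ m, subset_closure (NonUnitalStarAlgebra.subset_adjoin ℂ _ (Or.inr ⟨m, rfl⟩))⟩

/-- `K̂₁`: the closed subalgebra of the Toeplitz algebra generated by the elements `m n^*`. -/
def kHat : NonUnitalSubalgebra ℂ (Toeplitz hσ) :=
  (NonUnitalAlgebra.adjoin ℂ
    {k | ∃ m n, k = Toeplitz.ofM hσ m * star (Toeplitz.ofM hσ n)}).topologicalClosure

/-- `(a, k)` is a redundancy if `k ∈ K̂₁` and `a m = k m` for all `m ∈ M`. -/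
def IsRedundancy (a : C(X, ℂ)) (k : Toeplitz hσ) : Prop :=
  k ∈ kHat hσ ∧ ∀ m, Toeplitz.ofA hσ a * Toeplitz.ofM hσ m = k * Toeplitz.ofM hσ m

end Toeplitz

section Ideals

/-- The closed two-sided ideals of `B`; for a C⋆-algebra `B`, these are its ideals in the usual
sense of the theory. -/
def ClosedIdeal (B : Type*) [NonUnitalRing B] [TopologicalSpace B] : Type _ :=
  {I : TwoSidedIdeal B // IsClosed (I : Set B)}

/-- The closed two-sided ideal generated by a set. -/
def closedIdealGen {B : Type*} [NonUnitalRing B] [TopologicalSpace B] (S : Set B) :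
    ClosedIdeal B :=
  ⟨sInf {I | IsClosed (I : Set B) ∧ S ⊆ I}, by
    have h : ((sInf {I : TwoSidedIdeal B | IsClosed (I : Set B) ∧ S ⊆ I} : TwoSidedIdeal B) :
        Set B) = ⋂ I ∈ {I : TwoSidedIdeal B | IsClosed (I : Set B) ∧ S ⊆ I}, (I : Set B) := by
      ext x
      simp [TwoSidedIdeal.mem_sInf]
    rw [h]
    exact isClosed_biInter fun I hI => hI.1⟩

end Ideals

section CrossedProduct

variable {U : Opens X} {σ : U → X} (hσ : IsLocalHomeomorph σ)

/-- The ideal of the Toeplitz algebra generated by the elements `a - k`, for all redundancies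
`(a, k)` with `a ∈ I₀`. -/
def redundancyIdeal : ClosedIdeal (Toeplitz hσ) :=
  closedIdealGen {b | ∃ a k, IsRedundancy hσ a k ∧ a ∈ katsuraSet hσ ∧ b = Toeplitz.ofA hσ a - k}

/-- The crossed product `𝒪(X, α, L)`: the quotient of the Toeplitz algebra by the ideal above.
Its topology, the quotient topology, is that of the quotient norm. -/
def CrossedProduct : Type (u + 1) := (redundancyIdeal hσ).1.ringCon.Quotient

instance : NonUnitalRing (CrossedProduct hσ) :=
  inferInstanceAs (NonUnitalRing (redundancyIdeal hσ).1.ringCon.Quotient)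

/-- The quotient map from the Toeplitz algebra onto the crossed product. -/
def CrossedProduct.mk (b : Toeplitz hσ) : CrossedProduct hσ :=
  RingCon.toQuotient (c := (redundancyIdeal hσ).1.ringCon) b

instance : TopologicalSpace (CrossedProduct hσ) :=
  TopologicalSpace.coinduced (CrossedProduct.mk hσ) inferInstance

/-- `⟨C₀(V)⟩`: the ideal of the crossed product generated by the image of `C₀(V)`, the set of
those elements of `C(X)` which vanish outside `V`. -/
def idealOfOpen (V : Opens X) : ClosedIdeal (CrossedProduct hσ) :=
  closedIdealGen ((fun a => CrossedProduct.mk hσ (Toeplitz.ofA hσ a)) ''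
    (ContinuousMap.idealOfSet ℂ (V : Set X) : Set C(X, ℂ)))

end CrossedProduct

end Construction

section Dynamics

variable {Y : Type*}

/-- `V` is `σ, σ⁻¹`-invariant: `σ(V ∩ U) ⊆ V` and `σ⁻¹(V) ⊆ V`. -/
def IsInvariant {W : Set Y} (σ : W → Y) (V : Set Y) : Prop :=
  σ '' (Subtype.val ⁻¹' V) ⊆ V ∧ Subtype.val '' (σ ⁻¹' V) ⊆ V

/-- `IterEq σ n x y` says that `x` lies in the domain of `σⁿ` and that `σⁿ(x) = y`. -/
def IterEq {W : Set Y} (σ : W → Y) : ℕ → Y → Y → Prop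
  | 0, x, y => x = y
  | n + 1, x, y => ∃ z : W, IterEq σ n x z ∧ σ z = y

/-- `V^{i,j}`: the points which lie in the domains of `σⁱ` and of `σʲ` and where the two agree. -/
def coincidenceSet {W : Set Y} (σ : W → Y) (i j : ℕ) : Set Y :=
  {x | ∃ y, IterEq σ i x y ∧ IterEq σ j x y}

/-- Topological freeness of `(Y, σ)`: for `i ≠ j`, the closure of `V^{i,j}` has empty interior. -/
def TopologicallyFree [TopologicalSpace Y] {W : Set Y} (σ : W → Y) : Prop :=
  ∀ i j : ℕ, i ≠ j → interior (closure (coincidenceSet σ i j)) = ∅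

/-- The restriction of `σ : U → X` to an invariant subset `X'`: the map `U ∩ X' → X'`, where
`U ∩ X'` is regarded as a subset of `X'`. -/
def restrict {W : Set Y} (σ : W → Y) {Y' : Set Y} (hY' : IsInvariant σ Y') :
    ((Subtype.val : Y' → Y) ⁻¹' W) → Y' :=
  fun x => ⟨σ ⟨x.1.1, x.2⟩, hY'.1 ⟨⟨x.1.1, x.2⟩, x.1.2, rfl⟩⟩

end Dynamics

end PartialEndo

end

open TopologicalSpace PartialEndo

/-! Closed ideals of the crossed product correspond to closed ideals `J` of the Toeplitz algebra
which contain the redundancy ideal. The set `zeroSet J` of common zeros of the functions in `J` is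
closed and invariant, and the point is that it determines `J`.

The tool is the orbit representation `orbitHom` on ℓ²(Y), for an invariant set `Y`: functions act by
multiplication and `f ∈ C_c(U)` acts by ξ ↦ z f (ξ ∘ σ), with a parameter `z` on the circle. It
kills the redundancy ideal (`orbitHom_eq_zero_of_mem_redundancyIdeal`), and it kills exactly those
functions which vanish on `Y`. Over the complement of an invariant open set `V` it therefore
recovers `V` from ⟨C₀(V)⟩, which gives injectivity.

For surjectivity let `Y` be the set of points of `zeroSet J` at which no two different iterates of σ
agree. It is invariant, and topological freeness with Baire's theorem makes it dense in `zeroSet J`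
(`subset_closure_freePoints`). Two facts are combined.

(1) `J` is killed by the representations over `Y` (`orbitHom_eq_zero_of_mem`). Compressing by a
function peaked at `y ∈ Y` turns a polynomial in the generators into a function modulo redundancies,
since the terms of nonzero degree relate different points and disappear. So the diagonal entry at
`y` of an element of `J` is nearly the value at `y` of a function close to `J`, hence zero; apply
this to b⋆b.

(2) Whatever these representations kill for all `z` lies in every closed ideal `J₀` containing the
redundancies and the functions vanishing on `Y` (`mem_of_forall_orbitHom_eq_zero`). Fourier analysis
for the gauge action reduces this to the core of degree zero, which is treated level by level with
the help of the redundancies.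

Taking for `J₀` the preimage of ⟨C₀(V)⟩, with `V` the complement of `zeroSet J`, gives J ⊆ J₀. The
other inclusion holds because a closed ideal of C(X) consists of all functions vanishing on its
zeros. -/

noncomputable section

namespace PartialEndo

open TopologicalSpace Set UniformSpace

open scoped ComplexOrder ENNReal

universe u

/-! ### Approximate units from functional calculus. -/

section CutOff

/-- A continuous function which vanishes on `[0, r]` and for which `t (1 - cutOff r t)² ≤ r`. -/
def cutOff (r t : ℝ) : ℝ := 1 - r / max t r

theorem continuous_cutOff {r : ℝ} (hr : 0 < r) : Continuous (cutOff r) := by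
  unfold cutOff
  refine continuous_const.sub (continuous_const.div (by fun_prop) fun t => ?_)
  exact (lt_max_of_lt_right hr).ne'

theorem cutOff_of_le {r t : ℝ} (hr : 0 < r) (h : t ≤ r) : cutOff r t = 0 := by
  simp [cutOff, max_eq_right h, hr.ne']

theorem abs_mul_one_sub_cutOff_le {r t : ℝ} (hr : 0 < r) (ht : 0 ≤ t) :
    ‖t * (1 - cutOff r t) * (1 - cutOff r t)‖ ≤ r := by
  have h : t * (1 - cutOff r t) * (1 - cutOff r t) = r * (t / max t r * (r / max t r)) := by
    simp only [cutOff]; ring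
  have hm : 0 < max t r := lt_max_of_lt_right hr
  have h1 : t / max t r ≤ 1 := (div_le_one hm).2 (le_max_left _ _)
  have h2 : r / max t r ≤ 1 := (div_le_one hm).2 (le_max_right _ _)
  have h3 : 0 ≤ t / max t r := by positivity
  have h4 : 0 ≤ r / max t r := by positivity
  rw [h, Real.norm_of_nonneg (by positivity)]
  nlinarith [mul_le_one₀ h1 h4 h2]

variable {E : Type*} [NonUnitalCStarAlgebra E]

theorem quasispectrum_nonneg_of_star_mul_self (b : E) :
    ∀ t ∈ quasispectrum ℝ (star b * b), 0 ≤ t := by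
  let _ := CStarAlgebra.spectralOrder E
  have := CStarAlgebra.spectralOrderedRing E
  intro t ht
  exact quasispectrum_nonneg_of_nonneg _ (star_mul_self_nonneg b) t ht

/-- With g the cut-off of b⋆b, the square (b - bg)⋆(b - bg) is the function t(1 - cutOff)² of b⋆b,
which is bounded by ε². -/
theorem norm_sub_mul_cutOff_le (b : E) {ε : ℝ} (hε : 0 < ε) :
    ‖b - b * cfcₙ (cutOff (ε ^ 2)) (star b * b)‖ ≤ ε := by
  have hr : 0 < ε ^ 2 := by positivity
  set p := star b * b with hp
  have hpsa : IsSelfAdjoint p := IsSelfAdjoint.star_mul_self b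
  set g := cfcₙ (cutOff (ε ^ 2)) p with hg
  have hc : ContinuousOn (cutOff (ε ^ 2)) (quasispectrum ℝ p) :=
    (continuous_cutOff hr).continuousOn
  have h0 : cutOff (ε ^ 2) 0 = 0 := cutOff_of_le hr hr.le
  have hgsa : star g = g := (cfcₙ_predicate (R := ℝ) (p := IsSelfAdjoint) _ p)
  have key : star (b - b * g) * (b - b * g) =
      cfcₙ (fun t => t * (1 - cutOff (ε ^ 2) t) * (1 - cutOff (ε ^ 2) t)) p := by
    -- The algebra may have no unit, so the function is expanded into terms vanishing at 0, to which
    -- the non-unital calculus applies.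
    have e1 : (fun t => t * (1 - cutOff (ε ^ 2) t) * (1 - cutOff (ε ^ 2) t)) =
        fun t => (t - t * cutOff (ε ^ 2) t) - cutOff (ε ^ 2) t * (t - t * cutOff (ε ^ 2) t) := by
      funext t; ring
    have hc1 : ContinuousOn (fun t => t * cutOff (ε ^ 2) t) (quasispectrum ℝ p) :=
      continuousOn_id.mul hc
    have hc2 : ContinuousOn (fun t => t - t * cutOff (ε ^ 2) t) (quasispectrum ℝ p) :=
      continuousOn_id.sub hc1
    have hc3 : ContinuousOn (fun t => cutOff (ε ^ 2) t * (t - t * cutOff (ε ^ 2) t))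
      (quasispectrum ℝ p) := hc.mul hc2
    have hid : ContinuousOn (fun t : ℝ => t) (quasispectrum ℝ p) := continuousOn_id
    rw [e1, cfcₙ_sub (fun t => t - t * cutOff (ε ^ 2) t)
        (fun t => cutOff (ε ^ 2) t * (t - t * cutOff (ε ^ 2) t)) p hc2 (by simp) hc3 (by simp),
      cfcₙ_mul (cutOff (ε ^ 2)) (fun t => t - t * cutOff (ε ^ 2) t) p hc h0 hc2 (by simp),
      cfcₙ_sub (fun t => t) (fun t => t * cutOff (ε ^ 2) t) p hid rfl hc1 (by simp),
      cfcₙ_mul (fun t => t) (cutOff (ε ^ 2)) p hid rfl hc h0, cfcₙ_id' ℝ p, ← hg, star_sub,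
      star_mul, hgsa, hp]
    noncomm_ring
  have h1 : ‖b - b * g‖ * ‖b - b * g‖ ≤ ε ^ 2 := by
    rw [← CStarRing.norm_star_mul_self, key]
    exact norm_cfcₙ_le fun t ht => abs_mul_one_sub_cutOff_le hr
      (quasispectrum_nonneg_of_star_mul_self b t ht)
  nlinarith [norm_nonneg (b - b * g)]

end CutOff

/-! ### Closed two-sided ideals of C⋆-algebras. -/

section ClosedIdeals

variable {E : Type*} [NonUnitalCStarAlgebra E] {J : TwoSidedIdeal E}

theorem mem_of_forall_exists_norm_sub_le {V : Type*} [SeminormedAddCommGroup V] {S : Set V}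
    (hS : IsClosed S) {b : V}
    (h : ∀ ε > 0, ∃ j ∈ S, ‖b - j‖ ≤ ε) : b ∈ S := by
  rw [← hS.closure_eq, Metric.mem_closure_iff]
  intro ε hε
  obtain ⟨j, hj, hj'⟩ := h (ε / 2) (by positivity)
  exact ⟨j, hj, by rw [dist_eq_norm]; linarith⟩

theorem norm_sub_cutOff_mul_le (b : E) {ε : ℝ} (hε : 0 < ε) :
    ‖b - cfcₙ (cutOff (ε ^ 2)) (b * star b) * b‖ ≤ ε := by
  have h := norm_sub_mul_cutOff_le (star b) hε
  have hgsa : star (cfcₙ (cutOff (ε ^ 2)) (b * star b)) = cfcₙ (cutOff (ε ^ 2)) (b * star b) :=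
    (cfcₙ_predicate (R := ℝ) (p := IsSelfAdjoint) _ _)
  rw [star_star] at h
  rw [← norm_star, star_sub, star_mul, hgsa]
  exact h

/-- The ideals are only ring ideals, so the scalar is absorbed into a left factor: c b is the limit
of (c g) b with g a cut-off of b b⋆. -/
theorem TwoSidedIdeal.smul_mem_of_isClosed (hJ : IsClosed (J : Set E)) (c : ℂ) {b : E}
    (hb : b ∈ J) : c • b ∈ J := by
  refine mem_of_forall_exists_norm_sub_le hJ fun ε hε => ?_
  refine ⟨(c • cfcₙ (cutOff ((ε / (‖c‖ + 1)) ^ 2)) (b * star b)) * b, J.mul_mem_left _ _ hb, ?_⟩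
  rw [smul_mul_assoc, ← smul_sub, norm_smul]
  calc _ ≤ ‖c‖ * (ε / (‖c‖ + 1)) := by
        gcongr; exact norm_sub_cutOff_mul_le b (by positivity)
    _ ≤ (‖c‖ + 1) * (ε / (‖c‖ + 1)) := by gcongr; linarith
    _ = ε := by field_simp

/-- A closed two-sided ideal as a complex subspace. -/
def TwoSidedIdeal.toClosedSubmodule (J : TwoSidedIdeal E) (hJ : IsClosed (J : Set E)) :
    Submodule ℂ E where
  carrier := J
  add_mem' := J.add_mem
  zero_mem' := J.zero_mem
  smul_mem' c _ := TwoSidedIdeal.smul_mem_of_isClosed hJ c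

theorem TwoSidedIdeal.cfcₙ_mem_of_isClosed (hJ : IsClosed (J : Set E)) {p : E}
    (hp : IsSelfAdjoint p) (hpJ : p ∈ J) (f : ℝ → ℝ) : cfcₙ f p ∈ J := by
  have h := cfcₙ_mem_elemental (𝕜 := ℝ) f p
  -- Closure of `J` under star is not yet available, so it is carried along in the induction.
  have h1 : ∀ x ∈ NonUnitalStarAlgebra.adjoin ℝ {p}, x ∈ J ∧ star x ∈ J := by
    intro x hx
    induction hx using NonUnitalStarAlgebra.adjoin_induction with
    | mem x hx =>
      obtain rfl : x = p := hx
      exact ⟨hpJ, by rwa [hp.star_eq]⟩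
    | zero => simp [J.zero_mem]
    | add x y _ _ hx hy => exact ⟨J.add_mem hx.1 hy.1, by
        rw [star_add]; exact J.add_mem hx.2 hy.2⟩
    | mul x y _ _ hx hy => exact ⟨J.mul_mem_left _ _ hy.1, by
        rw [star_mul]; exact J.mul_mem_left _ _ hx.2⟩
    | smul r x _ hx =>
      have : ∀ z : E, r • z = (r : ℂ) • z := fun z => (Complex.coe_smul r z).symm
      refine ⟨?_, ?_⟩
      · rw [this]; exact smul_mem_of_isClosed hJ _ hx.1
      · rw [star_smul, star_trivial, this]; exact smul_mem_of_isClosed hJ _ hx.2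
    | star x _ hx => exact ⟨hx.2, by rw [star_star]; exact hx.1⟩
  exact closure_minimal (s := (NonUnitalStarAlgebra.adjoin ℝ {p} : Set E))
    (fun x hx => (h1 x hx).1) hJ h

/-- The element b is the limit of b g, where g is a cut-off of b⋆b and so belongs to `J`. -/
theorem TwoSidedIdeal.mem_of_star_mul_self_mem (hJ : IsClosed (J : Set E)) {b : E}
    (hb : star b * b ∈ J) : b ∈ J :=
  mem_of_forall_exists_norm_sub_le hJ fun _ hε =>
    ⟨_, J.mul_mem_left _ _ (cfcₙ_mem_of_isClosed hJ (.star_mul_self b) hb _),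
      norm_sub_mul_cutOff_le b hε⟩

theorem TwoSidedIdeal.star_mem_of_isClosed (hJ : IsClosed (J : Set E)) {b : E}
    (hb : b ∈ J) : star b ∈ J := by
  refine mem_of_star_mul_self_mem hJ ?_
  rw [star_star]
  exact J.mul_mem_right _ _ hb

theorem quasispectrum_star_mul_self_le {b : E} {r : ℝ} (hb : ‖b‖ ≤ r) :
    ∀ t ∈ quasispectrum ℝ (star b * b), t ≤ r ^ 2 := by
  intro t ht
  have h1 := NonUnitalIsometricContinuousFunctionalCalculus.norm_quasispectrum_le
    (𝕜 := ℝ) (star b * b) ht (.star_mul_self b)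
  rw [CStarRing.norm_star_mul_self] at h1
  have h2 := Real.le_norm_self t
  nlinarith [norm_nonneg b]

theorem continuous_starHom {B : Type*} [NonUnitalCStarAlgebra B] (ρ : E →⋆ₙₐ[ℂ] B) :
    Continuous ρ :=
  AddMonoidHomClass.continuous_of_bound ρ 1 fun x => by
    simpa using NonUnitalStarAlgHom.norm_apply_le ρ x

/-- If the elements of a C⋆-subalgebra `S` which are killed by all the homomorphisms `ρ i` belong
to the closed ideal `J`, then the norm of `s ∈ S` modulo `J` is at most `sup_i ‖ρ i s‖`. -/
theorem exists_mem_norm_sub_le_of_forall_norm_le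
    (S : NonUnitalStarSubalgebra ℂ E) (hS : IsClosed (S : Set E)) {ι : Type*} {B : ι → Type*}
    [∀ i, NonUnitalCStarAlgebra (B i)] (ρ : ∀ i, E →⋆ₙₐ[ℂ] B i)
    (hSJ : ∀ s ∈ S, (∀ i, ρ i s = 0) → s ∈ J) {s : E} (hs : s ∈ S) {ε : ℝ} (hε : 0 < ε)
    (h : ∀ i, ‖ρ i s‖ ≤ ε) : ∃ j ∈ J, ‖s - j‖ ≤ ε := by
  have hr : 0 < ε ^ 2 := by positivity
  refine ⟨_, J.mul_mem_left _ _ (hSJ (cfcₙ (cutOff (ε ^ 2)) (star s * s)) ?_ fun i => ?_),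
    norm_sub_mul_cutOff_le s hε⟩
  · have : IsClosed (S : Set E) := hS
    refine cfcₙ_mem (𝕜' := ℂ) _ (mul_mem (star_mem hs) hs)
  -- The spectrum of the image of s⋆s under `ρ i` lies below ε², where the cut-off vanishes. So the
  -- cut-off of s⋆s is killed by every `ρ i`.
  · rw [NonUnitalStarAlgHom.map_cfcₙ (S := ℂ) (ρ i) _ _ (continuous_cutOff hr).continuousOn
      (cutOff_of_le hr hr.le) (continuous_starHom _) (.star_mul_self s)
      ((IsSelfAdjoint.star_mul_self s).map (ρ i))]
    rw [map_mul, map_star, ← cfcₙ_const_zero ℝ]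
    refine cfcₙ_congr fun t ht => cutOff_of_le hr (quasispectrum_star_mul_self_le (h i) t ht)

end ClosedIdeals

/-! ### The universal property of the Toeplitz algebra and the gauge action. -/

section ToeplitzAlgebra

variable {X : Type u} [TopologicalSpace X] [CompactSpace X] [T2Space X]
  {U : Opens X} {σ : U → X} (hσ : IsLocalHomeomorph σ)

/-- The homomorphism of the Toeplitz algebra given by a representation of its relations. -/
def Toeplitz.eval (r : ToeplitzRep hσ) : Toeplitz hσ →⋆ₙₐ[ℂ] r.B where
  toFun b := (b.1 : ∀ r : ToeplitzRep hσ, r.B) r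
  map_smul' _ _ := rfl
  map_zero' := rfl
  map_add' _ _ := rfl
  map_mul' _ _ := rfl
  map_star' _ := rfl

variable {hσ}

theorem Toeplitz.eval_ofA (r : ToeplitzRep hσ) (a : C(X, ℂ)) :
    Toeplitz.eval hσ r (Toeplitz.ofA hσ a) = r.π a := rfl

theorem Toeplitz.eval_ofM (r : ToeplitzRep hσ) (m : HilbertModule hσ) :
    Toeplitz.eval hσ r (Toeplitz.ofM hσ m) = r.t m := rfl

theorem Toeplitz.ext_eval {b c : Toeplitz hσ}
    (h : ∀ r, Toeplitz.eval hσ r b = Toeplitz.eval hσ r c) : b = c :=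
  Subtype.ext (lp.ext (funext h))

variable (hσ) in
/-- The homomorphism from `C(X)` to the Toeplitz algebra. -/
def Toeplitz.ofAHom : C(X, ℂ) →⋆ₙₐ[ℂ] Toeplitz hσ where
  toFun := Toeplitz.ofA hσ
  map_smul' c a := Toeplitz.ext_eval fun r => by
    rw [MonoidHom.id_apply, map_smul, eval_ofA, eval_ofA, map_smul]
  map_zero' := Toeplitz.ext_eval fun r => by rw [eval_ofA, map_zero, map_zero]
  map_add' a b := Toeplitz.ext_eval fun r => by rw [map_add, eval_ofA, map_add]; rfl
  map_mul' a b := Toeplitz.ext_eval fun r => by rw [map_mul, eval_ofA, map_mul]; rfl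
  map_star' a := Toeplitz.ext_eval fun r => by rw [map_star, eval_ofA, map_star]; rfl

variable (hσ) in
/-- The linear map from `M` to the Toeplitz algebra. -/
def Toeplitz.ofMLin : HilbertModule hσ →ₗ[ℂ] Toeplitz hσ where
  toFun := Toeplitz.ofM hσ
  map_smul' c a := Toeplitz.ext_eval fun r => by
    rw [RingHom.id_apply, map_smul, eval_ofM, eval_ofM, map_smul]
  map_add' a b := Toeplitz.ext_eval fun r => by rw [map_add, eval_ofM, map_add]; rfl

namespace Toeplitz

theorem ofA_add (a b : C(X, ℂ)) : ofA hσ (a + b) = ofA hσ a + ofA hσ b := map_add (ofAHom hσ) a b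
theorem ofA_sub (a b : C(X, ℂ)) : ofA hσ (a - b) = ofA hσ a - ofA hσ b := map_sub (ofAHom hσ) a b
theorem ofA_zero : ofA hσ 0 = 0 := map_zero (ofAHom hσ)
theorem ofA_mul (a b : C(X, ℂ)) : ofA hσ (a * b) = ofA hσ a * ofA hσ b := map_mul (ofAHom hσ) a b
theorem ofA_star (a : C(X, ℂ)) : ofA hσ (star a) = star (ofA hσ a) := map_star (ofAHom hσ) a
theorem ofA_smul (c : ℂ) (a : C(X, ℂ)) : ofA hσ (c • a) = c • ofA hσ a := map_smul (ofAHom hσ) c a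
theorem norm_ofA_le (a : C(X, ℂ)) : ‖ofA hσ a‖ ≤ ‖a‖ :=
  NonUnitalStarAlgHom.norm_apply_le (ofAHom hσ) a
theorem continuous_ofA : Continuous (ofA hσ) := continuous_starHom (ofAHom hσ)

theorem ofA_mul_ofM (a : C(X, ℂ)) (m : HilbertModule hσ) :
    ofA hσ a * ofM hσ m = ofM hσ (leftAction hσ a m) :=
  ext_eval fun r => by rw [map_mul]; exact r.left_mul a m

theorem ofM_mul_ofA (a : C(X, ℂ)) (m : HilbertModule hσ) :
    ofM hσ m * ofA hσ a = ofM hσ (a • m) :=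
  ext_eval fun r => by rw [map_mul]; exact r.mul_right a m

theorem star_ofM_mul_ofM (m n : HilbertModule hσ) :
    star (ofM hσ m) * ofM hσ n = ofA hσ (inner C(X, ℂ) m n) :=
  ext_eval fun r => by rw [map_mul, map_star]; exact r.star_mul m n

theorem norm_ofM_le (m : HilbertModule hσ) : ‖ofM hσ m‖ ≤ ‖m‖ := by
  refine abs_le_of_sq_le_sq' ?_ (norm_nonneg m) |>.2
  rw [sq, ← CStarRing.norm_star_mul_self, star_ofM_mul_ofM, norm_sq_hilbertModule]
  exact norm_ofA_le _

theorem continuous_ofM : Continuous (ofM hσ) :=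
  AddMonoidHomClass.continuous_of_bound (ofMLin hσ) 1 fun m => by
    rw [one_mul]; exact norm_ofM_le m

/-- A closed star subalgebra of the Toeplitz algebra containing the generators is everything. -/
theorem mem_of_generators_mem (S : NonUnitalStarSubalgebra ℂ (Toeplitz hσ))
    (hS : IsClosed (S : Set (Toeplitz hσ))) (hA : ∀ a, ofA hσ a ∈ S) (hM : ∀ m, ofM hσ m ∈ S)
    (b : Toeplitz hσ) : b ∈ S := by
  let ι : Toeplitz hσ →⋆ₙₐ[ℂ] RepProduct hσ :=
    NonUnitalStarSubalgebraClass.subtype (toeplitzSubalgebra hσ)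
  have hT : IsClosed (toeplitzSubalgebra hσ : Set (RepProduct hσ)) := inferInstance
  have hι : Topology.IsClosedEmbedding ι := hT.isClosedEmbedding_subtypeVal
  have h1 : NonUnitalStarAlgebra.adjoin ℂ (range (repA hσ) ∪ range (repM hσ)) ≤ S.map ι := by
    rw [NonUnitalStarAlgebra.adjoin_le_iff]
    rintro _ (⟨a, rfl⟩ | ⟨m, rfl⟩)
    · exact ⟨ofA hσ a, hA a, rfl⟩
    · exact ⟨ofM hσ m, hM m, rfl⟩
  have h2 : toeplitzSubalgebra hσ ≤ S.map ι :=
    NonUnitalStarSubalgebra.topologicalClosure_minimal _ h1 (by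
      rw [NonUnitalStarSubalgebra.coe_map]; exact hι.isClosedMap _ hS)
  obtain ⟨c, hc, hcb⟩ := h2 b.2
  have : c = b := Subtype.ext hcb
  exact this ▸ hc

theorem hom_ext {B : Type*} [NonUnitalCStarAlgebra B] {ρ τ : Toeplitz hσ →⋆ₙₐ[ℂ] B}
    (hA : ∀ a, ρ (ofA hσ a) = τ (ofA hσ a)) (hM : ∀ m, ρ (ofM hσ m) = τ (ofM hσ m)) : ρ = τ :=
  NonUnitalStarAlgHom.ext <| mem_of_generators_mem (NonUnitalStarAlgHom.equalizer ρ τ)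
    (isClosed_eq (continuous_starHom ρ) (continuous_starHom τ)) hA hM

end Toeplitz

/-- The representation `(π, z t)`, for `z` in the unit circle. -/
def ToeplitzRep.twist (r : ToeplitzRep hσ) (z : Circle) : ToeplitzRep hσ where
  B := r.B
  π := r.π
  t := (z : ℂ) • r.t
  left_mul a m := by
    rw [LinearMap.smul_apply, LinearMap.smul_apply, mul_smul_comm, r.left_mul]
  mul_right a m := by
    rw [LinearMap.smul_apply, LinearMap.smul_apply, smul_mul_assoc, r.mul_right]
  star_mul m n := by
    rw [LinearMap.smul_apply, LinearMap.smul_apply, star_smul, smul_mul_smul_comm, r.star_mul,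
      Complex.star_def, ← Circle.coe_inv_eq_conj, ← Circle.coe_mul, inv_mul_cancel,
      Circle.coe_one, one_smul]

variable (hσ) in
/-- The reindexing of the product of all representations along `r ↦ r.twist z`. -/
def twistHom (z : Circle) : RepProduct hσ →⋆ₙₐ[ℂ] RepProduct hσ where
  toFun b := ⟨fun r => (b : ∀ r : ToeplitzRep hσ, r.B) (r.twist z), memℓp_infty ⟨‖b‖, by
    rintro _ ⟨r, rfl⟩
    exact lp.norm_apply_le_norm ENNReal.top_ne_zero b (r.twist z)⟩⟩
  map_smul' _ _ := rfl
  map_zero' := rfl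
  map_add' _ _ := rfl
  map_mul' _ _ := rfl
  map_star' _ := rfl

/-- The reindexing fixes the generators from C(X) and multiplies those from `M` by `z`, so it
preserves the closed algebra generated by them. -/
theorem twistHom_mem (z : Circle) {b : RepProduct hσ} (hb : b ∈ toeplitzSubalgebra hσ) :
    twistHom hσ z b ∈ toeplitzSubalgebra hσ := by
  have h : toeplitzSubalgebra hσ ≤ (toeplitzSubalgebra hσ).comap (twistHom hσ z) := by
    have hT : IsClosed (toeplitzSubalgebra hσ : Set (RepProduct hσ)) := inferInstance
    refine NonUnitalStarSubalgebra.topologicalClosure_minimal _ ?_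
      (hT.preimage (continuous_starHom (twistHom hσ z)))
    rw [NonUnitalStarAlgebra.adjoin_le_iff]
    rintro _ (⟨a, rfl⟩ | ⟨m, rfl⟩)
    · exact (Toeplitz.ofA hσ a).2
    · have h1 := ((z : ℂ) • Toeplitz.ofM hσ m).2
      exact h1
  exact h hb

variable (hσ) in
/-- The gauge action on the Toeplitz algebra. -/
def gauge (z : Circle) : Toeplitz hσ →⋆ₙₐ[ℂ] Toeplitz hσ where
  toFun b := ⟨twistHom hσ z b.1, twistHom_mem z b.2⟩
  map_smul' _ _ := rfl
  map_zero' := rfl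
  map_add' _ _ := rfl
  map_mul' _ _ := rfl
  map_star' _ := rfl

theorem gauge_ofA (z : Circle) (a : C(X, ℂ)) :
    gauge hσ z (Toeplitz.ofA hσ a) = Toeplitz.ofA hσ a := rfl

theorem gauge_ofM (z : Circle) (m : HilbertModule hσ) :
    gauge hσ z (Toeplitz.ofM hσ m) = (z : ℂ) • Toeplitz.ofM hσ m := rfl

theorem gauge_one (b : Toeplitz hσ) : gauge hσ 1 b = b := by
  have h : gauge hσ 1 = NonUnitalStarAlgHom.id ℂ (Toeplitz hσ) :=
    Toeplitz.hom_ext (fun a => rfl) fun m => by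
      rw [gauge_ofM, Circle.coe_one, one_smul]; rfl
  rw [h]; rfl

theorem norm_gauge_le (z : Circle) (b : Toeplitz hσ) : ‖gauge hσ z b‖ ≤ ‖b‖ :=
  NonUnitalStarAlgHom.norm_apply_le _ b

theorem continuous_gauge (b : Toeplitz hσ) : Continuous fun z => gauge hσ z b := by
  let S : NonUnitalStarSubalgebra ℂ (Toeplitz hσ) :=
    { carrier := {b | Continuous fun z => gauge hσ z b}
      add_mem' := fun {a b} ha hb => by
        simp only [mem_ofPred_eq, map_add]; exact Continuous.add ha hb
      zero_mem' := by simp only [mem_ofPred_eq, map_zero]; exact continuous_const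
      mul_mem' := fun {a b} ha hb => by
        simp only [mem_ofPred_eq, map_mul]; exact Continuous.mul ha hb
      smul_mem' := fun c b hb => by
        simp only [mem_ofPred_eq, map_smul]; exact Continuous.const_smul hb c
      star_mem' := fun {b} hb => by
        simp only [mem_ofPred_eq, map_star]; exact Continuous.star hb }
  refine Toeplitz.mem_of_generators_mem S ?_ ?_ ?_ b
  -- Each `gauge hσ z` is contractive, so approximation in norm is uniform in `z` and preserves
  -- continuity.
  · refine isClosed_of_closure_subset fun b hb => ?_
    refine continuous_of_uniform_approx_of_continuous fun u hu => ?_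
    obtain ⟨ε, hε, hu⟩ := Metric.mem_uniformity_dist.1 hu
    obtain ⟨c, hc, hbc⟩ := Metric.mem_closure_iff.1 hb ε hε
    refine ⟨_, hc, fun z => hu ?_⟩
    rw [dist_eq_norm, ← map_sub]
    exact (norm_gauge_le z _).trans_lt (by rwa [← dist_eq_norm])
  · intro a
    change Continuous fun z : Circle => Toeplitz.ofA hσ a
    exact continuous_const
  · intro m
    change Continuous fun z : Circle => (z : ℂ) • Toeplitz.ofM hσ m
    exact continuous_subtype_val.smul continuous_const

end ToeplitzAlgebra

/-- The linear span of a set closed under multiplication and the star operation. -/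
def spanStarSubalgebra {E : Type*} [NonUnitalCStarAlgebra E] (s : Set E)
    (hmul : ∀ x ∈ s, ∀ y ∈ s, x * y ∈ s) (hstar : ∀ x ∈ s, star x ∈ s) :
    NonUnitalStarSubalgebra ℂ E where
  carrier := Submodule.span ℂ s
  add_mem' := add_mem
  zero_mem' := zero_mem _
  smul_mem' c _ hx := Submodule.smul_mem _ c hx
  mul_mem' {x y} hx hy := by
    simp only [SetLike.mem_coe] at hx hy ⊢
    induction hx using Submodule.span_induction with
    | mem x hx =>
      induction hy using Submodule.span_induction with
      | mem y hy => exact Submodule.subset_span (hmul x hx y hy)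
      | zero => rw [mul_zero]; exact zero_mem _
      | add y z _ _ hy hz => rw [mul_add]; exact add_mem hy hz
      | smul c y _ hy => rw [mul_smul_comm]; exact Submodule.smul_mem _ _ hy
    | zero => rw [zero_mul]; exact zero_mem _
    | add y z _ _ hy hz => rw [add_mul]; exact add_mem hy hz
    | smul c y _ hy => rw [smul_mul_assoc]; exact Submodule.smul_mem _ _ hy
  star_mem' {x} hx := by
    simp only [SetLike.mem_coe] at hx ⊢
    induction hx using Submodule.span_induction with
    | mem x hx => exact Submodule.subset_span (hstar x hx)
    | zero => rw [star_zero]; exact zero_mem _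
    | add y z _ _ hy hz => rw [star_add]; exact add_mem hy hz
    | smul c y _ hy => rw [star_smul]; exact Submodule.smul_mem _ _ hy

/-! ### Words, monomials and the filtration of the degree zero part. -/

section Words

variable {X : Type u} [TopologicalSpace X] [CompactSpace X] [T2Space X]
  {U : Opens X} {σ : U → X} {hσ : IsLocalHomeomorph σ}

open Toeplitz

variable (hσ) in
/-- The element of the Toeplitz algebra given by a function in `C_c(U)`. -/
def Toeplitz.ofF (f : PreModule hσ) : Toeplitz hσ := ofM hσ (f : HilbertModule hσ)

theorem Toeplitz.ofA_mul_ofF (a : C(X, ℂ)) (f : PreModule hσ) :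
    ofA hσ a * ofF hσ f = ofF hσ (PreModule.leftMul hσ a f) := by
  rw [ofF, ofA_mul_ofM]
  congr 1
  exact Completion.map_coe (PreModule.leftMul hσ a).uniformContinuous f

theorem Toeplitz.ofF_mul_ofA (a : C(X, ℂ)) (f : PreModule hσ) :
    ofF hσ f * ofA hσ a = ofF hσ (a • f) := by
  rw [ofF, ofM_mul_ofA, ← Completion.coe_smul]; rfl

theorem Toeplitz.star_ofF_mul_ofF (f g : PreModule hσ) :
    star (ofF hσ f) * ofF hσ g = ofA hσ (inner C(X, ℂ) f g) := by
  rw [ofF, ofF, star_ofM_mul_ofM, inner_coe_hilbertModule]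

theorem Toeplitz.gauge_ofF (z : Circle) (f : PreModule hσ) :
    gauge hσ z (ofF hσ f) = (z : ℂ) • ofF hσ f := rfl

theorem Toeplitz.ofF_mem_of_forall (S : Set (Toeplitz hσ)) (hS : IsClosed S)
    (h : ∀ f, ofF hσ f ∈ S) (m : HilbertModule hσ) : ofM hσ m ∈ S :=
  (isClosed_property Completion.denseRange_coe (hS.preimage continuous_ofM) h) m

variable (hσ) in
/-- The products `t(f₁) ⋯ t(fₙ) a` with `f₁, …, fₙ ∈ C_c(U)` and `a ∈ C(X)`. -/
def words : ℕ → Set (Toeplitz hσ)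
  | 0 => range (ofA hσ)
  | n + 1 => {b | ∃ f : PreModule hσ, ∃ w ∈ words n, b = ofF hσ f * w}

theorem ofA_mem_words (a : C(X, ℂ)) : ofA hσ a ∈ words hσ 0 := ⟨a, rfl⟩

theorem ofF_mul_mem_words {n : ℕ} (f : PreModule hσ) {w : Toeplitz hσ} (hw : w ∈ words hσ n) :
    ofF hσ f * w ∈ words hσ (n + 1) := ⟨f, w, hw, rfl⟩

theorem ofA_mul_mem_words {n : ℕ} (a : C(X, ℂ)) {w : Toeplitz hσ} (hw : w ∈ words hσ n) :
    ofA hσ a * w ∈ words hσ n := by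
  cases n with
  | zero => obtain ⟨b, rfl⟩ := hw; exact ⟨a * b, ofA_mul a b⟩
  | succ n =>
    obtain ⟨f, w, hw, rfl⟩ := hw
    rw [← mul_assoc, ofA_mul_ofF]
    exact ofF_mul_mem_words _ hw

theorem mul_mem_words {n m : ℕ} {v w : Toeplitz hσ} (hv : v ∈ words hσ n) (hw : w ∈ words hσ m) :
    v * w ∈ words hσ (n + m) := by
  induction n generalizing v with
  | zero => obtain ⟨b, rfl⟩ := hv; rw [zero_add]; exact ofA_mul_mem_words b hw
  | succ n ih =>
    obtain ⟨f, v, hv, rfl⟩ := hv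
    rw [mul_assoc, Nat.succ_add]
    exact ofF_mul_mem_words f (ih hv)

/-- Adjacent letters collapse, t(f)⋆t(g) = ⟨f, g⟩, and the resulting function is absorbed by the
rest of the word. -/
theorem star_mul_mem_words {k j : ℕ} {v w : Toeplitz hσ} (hv : v ∈ words hσ k)
    (hw : w ∈ words hσ (k + j)) : star v * w ∈ words hσ j := by
  induction k generalizing v w with
  | zero =>
    obtain ⟨b, rfl⟩ := hv
    rw [zero_add] at hw
    rw [← ofA_star]
    exact ofA_mul_mem_words _ hw
  | succ k ih =>
    obtain ⟨f, v, hv, rfl⟩ := hv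
    rw [Nat.succ_add] at hw
    obtain ⟨g, w, hw, rfl⟩ := hw
    rw [star_mul, mul_assoc, ← mul_assoc _ (ofF hσ g), star_ofF_mul_ofF]
    exact ih hv (ofA_mul_mem_words _ hw)

theorem gauge_of_mem_words (z : Circle) {n : ℕ} {w : Toeplitz hσ} (hw : w ∈ words hσ n) :
    gauge hσ z w = (z : ℂ) ^ n • w := by
  induction n generalizing w with
  | zero => obtain ⟨b, rfl⟩ := hw; rw [pow_zero, one_smul, gauge_ofA]
  | succ k ih =>
    obtain ⟨f, v, hv, rfl⟩ := hw
    rw [map_mul, ih hv, gauge_ofF, smul_mul_smul_comm, pow_succ']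

/-- Both sides are treated together, because taking adjoints exchanges them. -/
theorem ofA_one_mul (b : Toeplitz hσ) : ofA hσ 1 * b = b ∧ b * ofA hσ 1 = b := by
  have h1 : star (ofA hσ 1) = ofA hσ 1 := by rw [← ofA_star, star_one]
  let S : NonUnitalStarSubalgebra ℂ (Toeplitz hσ) :=
    { carrier := {b | ofA hσ 1 * b = b ∧ b * ofA hσ 1 = b}
      add_mem' := fun {a b} ha hb => by
        simp only [mem_ofPred_eq, mul_add, add_mul, ha.1, ha.2, hb.1, hb.2, and_self]
      zero_mem' := by simp
      mul_mem' := fun {a b} ha hb => by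
        refine ⟨by rw [← mul_assoc, ha.1], by rw [mul_assoc, hb.2]⟩
      smul_mem' := fun c b hb => by
        refine ⟨by rw [mul_smul_comm, hb.1], by rw [smul_mul_assoc, hb.2]⟩
      star_mem' := fun {b} hb => by
        refine ⟨star_injective ?_, star_injective ?_⟩
        · rw [star_mul, star_star, h1]; exact hb.2
        · rw [star_mul, star_star, h1]; exact hb.1 }
  have hS : IsClosed (S : Set (Toeplitz hσ)) :=
    (isClosed_eq (by fun_prop) continuous_id).inter (isClosed_eq (by fun_prop) continuous_id)
  refine mem_of_generators_mem S hS (fun a => ?_) (fun m => ?_) b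
  · exact ⟨by rw [← ofA_mul, one_mul], by rw [← ofA_mul, mul_one]⟩
  · refine ofF_mem_of_forall _ hS (fun f => ⟨?_, ?_⟩) m
    · rw [ofA_mul_ofF]; congr 1; exact PreModule.ext (one_mul _)
    · rw [ofF_mul_ofA, one_smul]

variable (hσ) in
/-- The elements `v w^*`, for words `v` of length `n` and `w` of length `k`. -/
def monomials (n k : ℕ) : Set (Toeplitz hσ) :=
  {b | ∃ v ∈ words hσ n, ∃ w ∈ words hσ k, b = v * star w}

theorem star_mem_monomials {n k : ℕ} {b : Toeplitz hσ} (hb : b ∈ monomials hσ n k) :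
    star b ∈ monomials hσ k n := by
  obtain ⟨v, hv, w, hw, rfl⟩ := hb
  exact ⟨w, hw, v, hv, by rw [star_mul, star_star]⟩

theorem ofA_mul_mem_monomials {n k : ℕ} (a : C(X, ℂ)) {b : Toeplitz hσ}
    (hb : b ∈ monomials hσ n k) : ofA hσ a * b ∈ monomials hσ n k := by
  obtain ⟨v, hv, w, hw, rfl⟩ := hb
  exact ⟨_, ofA_mul_mem_words a hv, w, hw, (mul_assoc _ _ _).symm⟩

/-- In v₁v₂⋆w₁w₂⋆ the shorter of the two middle words is cancelled. Of the two truncated differences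
one is zero, and the other is the surplus length passed to the outer word on its side. -/
theorem mul_mem_monomials {n k m l : ℕ} {b c : Toeplitz hσ} (hb : b ∈ monomials hσ n k)
    (hc : c ∈ monomials hσ m l) : b * c ∈ monomials hσ (n + (m - k)) (l + (k - m)) := by
  obtain ⟨v₁, hv₁, v₂, hv₂, rfl⟩ := hb
  obtain ⟨w₁, hw₁, w₂, hw₂, rfl⟩ := hc
  rcases le_total k m with h | h
  · obtain ⟨j, rfl⟩ := Nat.exists_eq_add_of_le h
    rw [Nat.sub_eq_zero_of_le h, Nat.add_sub_cancel_left]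
    refine ⟨v₁ * (star v₂ * w₁), mul_mem_words hv₁ (star_mul_mem_words hv₂ hw₁), w₂, hw₂, ?_⟩
    simp only [mul_assoc]
  · obtain ⟨j, rfl⟩ := Nat.exists_eq_add_of_le h
    rw [Nat.sub_eq_zero_of_le h, Nat.add_sub_cancel_left]
    refine ⟨v₁, hv₁, w₂ * (star w₁ * v₂), mul_mem_words hw₂ (star_mul_mem_words hw₁ hv₂), ?_⟩
    simp only [star_mul, star_star, mul_assoc]

theorem gauge_of_mem_monomials (z : Circle) {n k : ℕ} {b : Toeplitz hσ}
    (hb : b ∈ monomials hσ n k) :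
    gauge hσ z b = ((z ^ ((n : ℤ) - k) : Circle) : ℂ) • b := by
  obtain ⟨v, hv, w, hw, rfl⟩ := hb
  rw [map_mul, map_star, gauge_of_mem_words z hv, gauge_of_mem_words z hw, star_smul,
    smul_mul_smul_comm]
  congr 1
  rw [zpow_sub, zpow_natCast, zpow_natCast, Circle.coe_mul, Circle.coe_inv_eq_conj,
    Circle.coe_pow, Circle.coe_pow]
  rfl

variable (hσ) in
/-- The star subalgebra spanned by all the monomials. -/
def polynomials : NonUnitalStarSubalgebra ℂ (Toeplitz hσ) :=
  spanStarSubalgebra {b | ∃ n k, b ∈ monomials hσ n k}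
    (fun _ ⟨_, _, hx⟩ _ ⟨_, _, hy⟩ => ⟨_, _, mul_mem_monomials hx hy⟩)
    (fun _ ⟨_, _, hx⟩ => ⟨_, _, star_mem_monomials hx⟩)

variable (hσ) in
/-- The star subalgebra spanned by the monomials of degree zero and length at most `N`. -/
def coreLevel (N : ℕ) : NonUnitalStarSubalgebra ℂ (Toeplitz hσ) :=
  spanStarSubalgebra {b | ∃ n ≤ N, b ∈ monomials hσ n n}
    (fun _ ⟨n, hn, hx⟩ _ ⟨k, hk, hy⟩ => ⟨max n k, max_le hn hk, by
      have h := mul_mem_monomials hx hy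
      rwa [show n + (k - n) = max n k by omega, show k + (n - k) = max n k by omega] at h⟩)
    (fun _ ⟨_, hn, hx⟩ => ⟨_, hn, star_mem_monomials hx⟩)

theorem monomials_subset_polynomials (n k : ℕ) :
    monomials hσ n k ⊆ polynomials hσ := fun _ hb => Submodule.subset_span ⟨n, k, hb⟩

theorem monomials_subset_coreLevel {n N : ℕ} (h : n ≤ N) :
    monomials hσ n n ⊆ coreLevel hσ N := fun _ hb => Submodule.subset_span ⟨n, h, hb⟩

theorem coreLevel_mono {N M : ℕ} (h : N ≤ M) :
    (coreLevel hσ N : Set (Toeplitz hσ)) ⊆ coreLevel hσ M :=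
  Submodule.span_mono fun _ ⟨n, hn, hb⟩ => ⟨n, hn.trans h, hb⟩

theorem ofA_mem_monomials (a : C(X, ℂ)) : ofA hσ a ∈ monomials hσ 0 0 :=
  ⟨_, ofA_mem_words a, _, ofA_mem_words 1, by rw [← ofA_star, star_one, (ofA_one_mul _).2]⟩

theorem ofA_mem_coreLevel (a : C(X, ℂ)) (N : ℕ) : ofA hσ a ∈ coreLevel hσ N :=
  monomials_subset_coreLevel N.zero_le (ofA_mem_monomials a)

theorem ofF_mem_monomials (f : PreModule hσ) : ofF hσ f ∈ monomials hσ 1 0 :=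
  ⟨_, ofF_mul_mem_words f (ofA_mem_words 1), _, ofA_mem_words 1, by
    rw [← ofA_star, star_one, (ofA_one_mul _).2, (ofA_one_mul _).2]⟩

theorem mem_closure_polynomials (b : Toeplitz hσ) :
    b ∈ closure (polynomials hσ : Set (Toeplitz hσ)) := by
  refine mem_of_generators_mem (polynomials hσ).topologicalClosure
    (NonUnitalStarSubalgebra.isClosed_topologicalClosure _) (fun a => ?_) (fun m => ?_) b
  · exact subset_closure (monomials_subset_polynomials _ _ (ofA_mem_monomials a))
  · exact ofF_mem_of_forall _ (NonUnitalStarSubalgebra.isClosed_topologicalClosure _) (fun f =>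
      subset_closure (monomials_subset_polynomials _ _ (ofF_mem_monomials f))) m

end Words

/-! ### Weighted composition operators on ℓ²(Y). -/

section WeightedComposition

variable {Y : Type*}

/-- The Hilbert space `ℓ²(Y)`. -/
abbrev Ell2 (Y : Type*) : Type _ := lp (fun _ : Y => ℂ) 2

/-- The weight `k` is square summable, with norm at most `C`, along the fibres of `τ`. -/
def FiberBounded (k : Y → ℂ) (τ : Y → Y) (C : ℝ) : Prop :=
  ∀ (x : Y) (F : Finset Y), (∀ y ∈ F, τ y = x) → ∑ y ∈ F, ‖k y‖ ^ 2 ≤ C ^ 2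

theorem sum_sq_le_norm_sq (ξ : Ell2 Y) (F : Finset Y) : ∑ y ∈ F, ‖ξ y‖ ^ 2 ≤ ‖ξ‖ ^ 2 := by
  have h := lp.sum_rpow_le_norm_rpow (p := 2) (by norm_num) ξ F
  norm_num at h
  exact h

/-- Group the sum by the fibres of τ: on the fibre over x the factor ξ(x) is constant and the
weights contribute at most C². -/
theorem FiberBounded.sum_le {k : Y → ℂ} {τ : Y → Y} {C : ℝ} (h : FiberBounded k τ C)
    (ξ : Ell2 Y) (F : Finset Y) : ∑ y ∈ F, ‖k y * ξ (τ y)‖ ^ 2 ≤ (C * ‖ξ‖) ^ 2 := by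
  classical
  calc ∑ y ∈ F, ‖k y * ξ (τ y)‖ ^ 2
      = ∑ x ∈ F.image τ, ∑ y ∈ F with τ y = x, ‖k y * ξ (τ y)‖ ^ 2 :=
        (Finset.sum_fiberwise_of_maps_to (fun y hy => Finset.mem_image_of_mem τ hy) _).symm
    _ ≤ ∑ x ∈ F.image τ, C ^ 2 * ‖ξ x‖ ^ 2 := by
        refine Finset.sum_le_sum fun x _ => ?_
        rw [Finset.sum_congr rfl (g := fun y => ‖k y‖ ^ 2 * ‖ξ x‖ ^ 2) (fun y hy => by
          rw [(Finset.mem_filter.1 hy).2, norm_mul, mul_pow]), ← Finset.sum_mul]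
        exact mul_le_mul_of_nonneg_right (h x _ fun y hy => (Finset.mem_filter.1 hy).2)
          (by positivity)
    _ ≤ (C * ‖ξ‖) ^ 2 := by
        rw [← Finset.mul_sum, mul_pow]
        gcongr
        exact sum_sq_le_norm_sq ξ _

/-- The operator `(T ξ)(y) = k(y) ξ(τ(y))` on `ℓ²(Y)`. -/
def weightedComp (k : Y → ℂ) (τ : Y → Y) (C : ℝ) (hC : 0 ≤ C) (h : FiberBounded k τ C) :
    Ell2 Y →L[ℂ] Ell2 Y :=
  LinearMap.mkContinuous
    { toFun := fun ξ => ⟨fun y => k y * ξ (τ y), memℓp_gen' (C := (C * ‖ξ‖) ^ 2) fun F => by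
        simpa using h.sum_le ξ F⟩
      map_add' := fun ξ η => lp.ext (funext fun y => by
        change k y * (ξ (τ y) + η (τ y)) = k y * ξ (τ y) + k y * η (τ y)
        ring)
      map_smul' := fun c ξ => lp.ext (funext fun y => by
        change k y * (c * ξ (τ y)) = c * (k y * ξ (τ y))
        ring) } C fun ξ =>
    lp.norm_le_of_forall_sum_le (by norm_num) (by positivity) fun F => by
      simpa using h.sum_le ξ F

theorem weightedComp_apply {k : Y → ℂ} {τ : Y → Y} {C : ℝ} (hC : 0 ≤ C)
    (h : FiberBounded k τ C) (ξ : Ell2 Y) (y : Y) :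
    weightedComp k τ C hC h ξ y = k y * ξ (τ y) := rfl

theorem norm_weightedComp_le {k : Y → ℂ} {τ : Y → Y} {C : ℝ} (hC : 0 ≤ C)
    (h : FiberBounded k τ C) : ‖weightedComp k τ C hC h‖ ≤ C :=
  LinearMap.mkContinuous_norm_le _ hC _

/-- The basis vector `δ_x` of `ℓ²(Y)`. -/
def basisVec (x : Y) : Ell2 Y := by
  classical exact lp.single 2 x (1 : ℂ)

theorem basisVec_self (x : Y) : basisVec x x = 1 := by
  classical
  simp [basisVec]

theorem basisVec_of_ne {x y : Y} (h : y ≠ x) : basisVec x y = 0 := by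
  classical
  simp [basisVec, h]

theorem norm_basisVec (x : Y) : ‖basisVec x‖ = 1 := by
  classical
  simp [basisVec, lp.norm_single]

theorem inner_basisVec (x : Y) (ξ : Ell2 Y) : inner ℂ (basisVec x) ξ = ξ x := by
  classical
  simp [basisVec, lp.inner_single_left]

theorem ext_basisVec {S T : Ell2 Y →L[ℂ] Ell2 Y} (h : ∀ y, S (basisVec y) = T (basisVec y)) :
    S = T := by
  classical
  ext1 ξ
  have hξ := lp.hasSum_single (p := 2) (by norm_num) ξ
  refine (hξ.mapL S).unique ?_
  convert hξ.mapL T using 2 with y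
  have : lp.single 2 y (ξ y) = ξ y • basisVec y := by
    rw [basisVec, ← lp.single_smul, smul_eq_mul, mul_one]
  simp only [this, map_smul, h]

end WeightedComposition

/-! ### The orbit representations on ℓ²(Y). -/

section Representation

variable {X : Type u} [TopologicalSpace X] [CompactSpace X] [T2Space X]
  {U : Opens X} {σ : U → X} (hσ : IsLocalHomeomorph σ) {Y : Set X}

omit [T2Space X] in
theorem fiberBounded_id (a : C(X, ℂ)) : FiberBounded (fun y : Y => a y) id ‖a‖ := by
  intro x F hF
  have hF' : F ⊆ {x} := fun y hy => Finset.mem_singleton.2 (hF y hy)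
  calc _ ≤ ∑ y ∈ {x}, ‖a (y : X)‖ ^ 2 :=
        Finset.sum_le_sum_of_subset_of_nonneg hF' fun _ _ _ => by positivity
    _ ≤ _ := by
      rw [Finset.sum_singleton]
      gcongr
      exact a.norm_coe_le_norm _

/-- The multiplication operators on `ℓ²(Y)`. -/
def multOp (Y : Set X) : C(X, ℂ) →⋆ₙₐ[ℂ] (Ell2 Y →L[ℂ] Ell2 Y) where
  toFun a := weightedComp (fun y : Y => a y) id ‖a‖ (norm_nonneg a) (fiberBounded_id a)
  map_smul' c a := by
    ext ξ y
    change c * a y * ξ y = c * (a y * ξ y)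
    ring
  map_zero' := by
    ext ξ y
    change 0 * ξ y = 0
    ring
  map_add' a b := by
    ext ξ y
    change (a y + b y) * ξ y = a y * ξ y + b y * ξ y
    ring
  map_mul' a b := by
    ext ξ y
    change (a y * b y) * ξ y = a y * (b y * ξ y)
    ring
  map_star' a := by
    rw [ContinuousLinearMap.star_eq_adjoint, ContinuousLinearMap.eq_adjoint_iff]
    intro ξ η
    rw [lp.inner_eq_tsum, lp.inner_eq_tsum]
    congr 1
    funext y
    rw [weightedComp_apply, weightedComp_apply]
    simp
    ring

omit [T2Space X] in
theorem multOp_apply (a : C(X, ℂ)) (ξ : Ell2 Y) (y : Y) : multOp Y a ξ y = a y * ξ y := rfl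

variable (hY : IsInvariant σ Y)

open Classical in
/-- The map `σ` on an invariant set, extended by the identity outside its domain. -/
def sigmaExt (y : Y) : Y :=
  if h : (y : X) ∈ U then ⟨σ ⟨y, h⟩, hY.1 ⟨⟨y, h⟩, y.2, rfl⟩⟩ else y

omit [CompactSpace X] [T2Space X] in
theorem sigmaExt_of_mem {y : Y} (h : (y : X) ∈ U) : (sigmaExt hY y : X) = σ ⟨y, h⟩ := by
  simp [sigmaExt, h]

variable {hσ}

/-- The sum over a fibre inside `Y` is part of the sum defining ⟨f, f⟩(x). The points outside `U`,
where `sigmaExt` is a dummy, carry weight zero. -/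
theorem fiberBounded_sigmaExt (f : PreModule hσ) :
    FiberBounded (fun y : Y => f.fn y) (sigmaExt hY) ‖f‖ := by
  classical
  intro x F hF
  rw [PreModule.norm_sq]
  refine le_trans ?_ ((inner C(X, ℂ) f f).norm_coe_le_norm (x : X))
  rw [PreModule.inner_apply]
  have h2 : ∀ s : Finset U, ∑ y ∈ s, star (f.fn y) * f.fn y =
      ((∑ y ∈ s, ‖f.fn y‖ ^ 2 : ℝ) : ℂ) := fun s => by
    push_cast
    exact Finset.sum_congr rfl fun y _ => by rw [Complex.star_def, Complex.conj_mul']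
  rw [h2, Complex.norm_real, Real.norm_of_nonneg (by positivity)]
  have h3 : ∑ y ∈ F.filter (fun y : Y => f.fn y ≠ 0), ‖f.fn (y : Y)‖ ^ 2 =
      ∑ y ∈ F, ‖f.fn (y : Y)‖ ^ 2 := by
    refine Finset.sum_filter_of_ne fun y _ hy h => hy ?_
    rw [h, norm_zero, zero_pow two_ne_zero]
  have hY' := Finset.sum_map (F.filter (fun y : Y => f.fn y ≠ 0))
    (Function.Embedding.subtype (· ∈ Y)) (fun y => ‖f.fn y‖ ^ 2)
  have hU' := fun F : Finset U => Finset.sum_map F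
    (Function.Embedding.subtype (· ∈ U)) (fun y => ‖f.fn y‖ ^ 2)
  refine (h3.symm.trans hY'.symm).trans_le (le_trans ?_ (hU' _).le)
  refine Finset.sum_le_sum_of_subset_of_nonneg (fun p hp => ?_) fun _ _ _ => by positivity
  obtain ⟨y, hy, rfl⟩ := Finset.mem_map.1 hp
  obtain ⟨hyF, hy0⟩ := Finset.mem_filter.1 hy
  have hyU : (y : X) ∈ U := by
    by_contra h
    exact hy0 (f.fn_apply_eq_zero h)
  refine Finset.mem_map.2 ⟨⟨y, hyU⟩, ?_, rfl⟩
  rw [Set.Finite.mem_toFinset]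
  exact ⟨by rw [← sigmaExt_of_mem hY hyU, hF y hyF], subset_tsupport _ hy0⟩

/-- The operator `(t(f) ξ)(y) = f(y) ξ(σ(y))` on `ℓ²(Y)`, for `f ∈ C_c(U)`. -/
def shiftOp : PreModule hσ →L[ℂ] (Ell2 Y →L[ℂ] Ell2 Y) :=
  LinearMap.mkContinuous
    { toFun := fun f => weightedComp (fun y : Y => f.fn y) (sigmaExt hY) ‖f‖ (norm_nonneg f)
        (fiberBounded_sigmaExt hY f)
      map_add' := fun f g => by
        ext ξ y
        change (f.fn y + g.fn y) * ξ (sigmaExt hY y) =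
          f.fn y * ξ (sigmaExt hY y) + g.fn y * ξ (sigmaExt hY y)
        ring
      map_smul' := fun c f => by
        ext ξ y
        change c * f.fn y * ξ (sigmaExt hY y) = c * (f.fn y * ξ (sigmaExt hY y))
        ring } 1 fun f => by
    rw [one_mul]
    exact norm_weightedComp_le (norm_nonneg f) (fiberBounded_sigmaExt hY f)

theorem shiftOp_apply (f : PreModule hσ) (ξ : Ell2 Y) (y : Y) :
    shiftOp hY f ξ y = f.fn y * ξ (sigmaExt hY y) := rfl

/-- The coordinate at x is η(x) times a sum of conj(f) g over the points of `Y` in the fibre of x.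
As σ⁻¹(Y) ⊆ Y, no point of the fibre is missing and the sum is ⟨f, g⟩(x). -/
theorem star_shiftOp_mul_shiftOp (f g : PreModule hσ) :
    star (shiftOp hY f) * shiftOp hY g = multOp Y (inner C(X, ℂ) f g) := by
  classical
  ext η x
  rw [← inner_basisVec, mul_apply_eq_comp, ContinuousLinearMap.star_eq_adjoint,
    ContinuousLinearMap.adjoint_inner_right, lp.inner_eq_tsum, multOp_apply,
    PreModule.inner_apply]
  set F := (finite_fiber hσ (isClosed_tsupport g.fn).isCompact g.tsupport_fn x).toFinset with hF
  have hFY : ∀ p ∈ F.map (Function.Embedding.subtype (· ∈ U)), p ∈ Y := by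
    intro p hp
    obtain ⟨y, hy, rfl⟩ := Finset.mem_map.1 hp
    have hy' : σ y = x := ((Set.Finite.mem_toFinset _).1 hy).1
    exact hY.2 ⟨y, by rw [mem_preimage, hy']; exact x.2, rfl⟩
  rw [tsum_eq_sum (s := (F.map (Function.Embedding.subtype (· ∈ U))).subtype (· ∈ Y))]
  · have h1 : ∀ y ∈ (F.map (Function.Embedding.subtype (· ∈ U))).subtype (· ∈ Y),
        inner ℂ (shiftOp hY f (basisVec x) y) (shiftOp hY g η y) =
          (fun p : X => star (f.fn p) * g.fn p * η x) y := by
      intro y hy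
      obtain ⟨u, hu, huy⟩ := Finset.mem_map.1 (Finset.mem_subtype.1 hy)
      have hu' : σ u = x := ((Set.Finite.mem_toFinset _).1 hu).1
      have hyU : (y : X) ∈ U := by rw [← huy]; exact u.2
      have hyx : sigmaExt hY y = x := Subtype.ext <| by
        rw [sigmaExt_of_mem hY hyU, ← hu']
        congr 1
        exact Subtype.ext huy.symm
      rw [shiftOp_apply, shiftOp_apply, hyx, basisVec_self]
      simp
      ring
    refine (Finset.sum_congr rfl h1).trans ((Finset.sum_subtype_of_mem
      (fun p : X => star (f.fn p) * g.fn p * η x) hFY).trans ?_)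
    rw [Finset.sum_map, Finset.sum_mul]
    rfl
  · intro y hy
    rw [shiftOp_apply, shiftOp_apply]
    by_cases hg : g.fn y = 0
    · simp [hg]
    · have hyU : (y : X) ∈ U := by
        by_contra h
        exact hg (g.fn_apply_eq_zero h)
      have hyx : sigmaExt hY y ≠ x := by
        intro h
        refine hy (Finset.mem_subtype.2 (Finset.mem_map.2 ⟨⟨y, hyU⟩, ?_, rfl⟩))
        rw [hF, Set.Finite.mem_toFinset]
        exact ⟨by rw [← sigmaExt_of_mem hY hyU, h], subset_tsupport _ hg⟩
      rw [basisVec_of_ne hyx]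
      simp

/-- The extension of `shiftOp` to the Hilbert module. -/
def shiftExt : HilbertModule hσ →L[ℂ] (Ell2 Y →L[ℂ] Ell2 Y) :=
  (shiftOp hY).extend (Completion.toComplL : PreModule hσ →L[ℂ] HilbertModule hσ)

theorem shiftExt_coe (f : PreModule hσ) : shiftExt hY (f : HilbertModule hσ) = shiftOp hY f :=
  ContinuousLinearMap.extend_eq _ Completion.denseRange_coe
    (Completion.isUniformInducing_coe _) f

variable (hσ) in
/-- The representation of the relations on `ℓ²(Y)`, for an invariant set `Y`. -/
def orbitRep : ToeplitzRep hσ where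
  B := Ell2 Y →L[ℂ] Ell2 Y
  π := multOp Y
  t := (shiftExt hY : HilbertModule hσ →L[ℂ] (Ell2 Y →L[ℂ] Ell2 Y))
  left_mul a m := by
    simp only [ContinuousLinearMap.coe_coe]
    induction m using Completion.induction_on with
    | hp => exact isClosed_eq (by fun_prop) (by fun_prop)
    | ih f =>
      have h : leftAction hσ a f = (PreModule.leftMul hσ a f : PreModule hσ) :=
        Completion.map_coe (PreModule.leftMul hσ a).uniformContinuous f
      rw [h, shiftExt_coe, shiftExt_coe]
      ext ξ y
      change a y * (f.fn y * ξ (sigmaExt hY y)) = a y * f.fn y * ξ (sigmaExt hY y)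
      ring
  mul_right a m := by
    simp only [ContinuousLinearMap.coe_coe]
    induction m using Completion.induction_on with
    | hp =>
      exact isClosed_eq (by fun_prop) ((shiftExt hY).continuous.comp (continuous_const_smul a))
    | ih f =>
      rw [← Completion.coe_smul, shiftExt_coe, shiftExt_coe]
      ext ξ y
      change f.fn y * (a (sigmaExt hY y) * ξ (sigmaExt hY y)) = (a • f).fn y * ξ (sigmaExt hY y)
      by_cases hyU : (y : X) ∈ U
      · rw [PreModule.fn_right_smul a f ⟨y, hyU⟩, sigmaExt_of_mem hY hyU]
        ring
      · rw [f.fn_apply_eq_zero hyU, (a • f).fn_apply_eq_zero hyU]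
        ring
  star_mul m n := by
    simp only [ContinuousLinearMap.coe_coe]
    refine Completion.induction_on₂ m n (isClosed_eq (by fun_prop) ?_) fun f g => ?_
    · exact (continuous_starHom (multOp Y)).comp
        (continuous_inner_comp hσ continuous_fst continuous_snd)
    · rw [shiftExt_coe, shiftExt_coe, inner_coe_hilbertModule, star_shiftOp_mul_shiftOp]

variable (hσ) in
/-- The representation of the Toeplitz algebra on `ℓ²(Y)` given by `(π, z t)`. -/
def orbitHom (z : Circle) : Toeplitz hσ →⋆ₙₐ[ℂ] (Ell2 Y →L[ℂ] Ell2 Y) :=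
  Toeplitz.eval hσ ((orbitRep hσ hY).twist z)

theorem orbitHom_ofA (z : Circle) (a : C(X, ℂ)) (ξ : Ell2 Y) (y : Y) :
    orbitHom hσ hY z (Toeplitz.ofA hσ a) ξ y = a y * ξ y := rfl

theorem orbitHom_ofF (z : Circle) (f : PreModule hσ) (ξ : Ell2 Y) (y : Y) :
    orbitHom hσ hY z (Toeplitz.ofF hσ f) ξ y = z * (f.fn y * ξ (sigmaExt hY y)) := by
  have h : orbitHom hσ hY z (Toeplitz.ofF hσ f) = (z : ℂ) • shiftOp hY f := by
    rw [← shiftExt_coe]; rfl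
  rw [h]; rfl

theorem orbitHom_gauge (z w : Circle) (b : Toeplitz hσ) :
    orbitHom hσ hY z (gauge hσ w b) = orbitHom hσ hY (z * w) b := by
  have h : (orbitHom hσ hY z).comp (gauge hσ w) = orbitHom hσ hY (z * w) := by
    refine Toeplitz.hom_ext (fun a => rfl) fun m => ?_
    rw [NonUnitalStarAlgHom.comp_apply, gauge_ofM, map_smul]
    change (w : ℂ) • ((z : ℂ) • shiftExt hY m) = ((z * w : Circle) : ℂ) • shiftExt hY m
    rw [smul_smul, Circle.coe_mul, mul_comm]
  exact DFunLike.congr_fun h b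

theorem orbitHom_ofA_basisVec (z : Circle) (a : C(X, ℂ)) (y : Y) :
    orbitHom hσ hY z (Toeplitz.ofA hσ a) (basisVec y) = a y • basisVec y := by
  refine lp.ext (funext fun x => ?_)
  rw [orbitHom_ofA]
  by_cases h : x = y
  · subst h; rfl
  · change _ = a y * basisVec y x
    rw [basisVec_of_ne h, mul_zero, mul_zero]

theorem orbitHom_ofA_eq_zero_iff (z : Circle) (a : C(X, ℂ)) :
    orbitHom hσ hY z (Toeplitz.ofA hσ a) = 0 ↔ ∀ y ∈ Y, a y = 0 := by
  constructor
  · intro h y hy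
    have := orbitHom_ofA (hσ := hσ) hY z a (basisVec ⟨y, hy⟩) ⟨y, hy⟩
    rw [h, basisVec_self, mul_one] at this
    exact this.symm
  · intro h
    ext ξ y
    rw [orbitHom_ofA, h y y.2, zero_mul]
    rfl

end Representation

/-! ### Bump functions on sets where σ is injective. -/

section Bumps

variable {X : Type u} [TopologicalSpace X] [CompactSpace X] [T2Space X]

/-- The function `χ` takes its values in the interval `[0, 1]`. -/
def UnitValued (χ : C(X, ℂ)) : Prop := ∀ x, ∃ r ∈ Icc (0 : ℝ) 1, χ x = r

omit [CompactSpace X] [T2Space X] in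
theorem UnitValued.norm_apply_le {χ : C(X, ℂ)} (h : UnitValued χ) (x : X) : ‖χ x‖ ≤ 1 := by
  obtain ⟨r, hr, hx⟩ := h x
  rw [hx, Complex.norm_real, Real.norm_of_nonneg hr.1]
  exact hr.2

theorem exists_unitValued {K N : Set X} (hK : IsClosed K) (hN : IsOpen N) (hKN : K ⊆ N) :
    ∃ χ : C(X, ℂ), tsupport χ ⊆ N ∧ (∀ x ∈ K, χ x = 1) ∧ UnitValued χ := by
  obtain ⟨g, hg1, hg2, hg3⟩ := exists_tsupport_one_of_isOpen_isClosed hN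
    isClosed_closure.isCompact hK hKN
  refine ⟨⟨fun x => g x, by fun_prop⟩, ?_, ?_, fun x => ⟨g x, hg3 x, rfl⟩⟩
  · refine (closure_mono fun x hx => ?_).trans hg1
    intro h
    exact hx (by simp [h])
  · intro x hx
    have : g x = 1 := hg2 hx
    simp [this]

omit [CompactSpace X] [T2Space X] in
theorem eq_zero_of_notMem_of_tsupport_subset {f : X → ℂ} {N : Set X} (h : tsupport f ⊆ N) {x : X}
    (hx : x ∉ N) : f x = 0 := image_eq_zero_of_notMem_tsupport fun h' => hx (h h')

variable {U : Opens X} {σ : U → X} {hσ : IsLocalHomeomorph σ}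

namespace PreModule

theorem inner_apply_of_unique {f g : PreModule hσ} {y : U}
    (h : ∀ z : U, σ z = σ y → z ≠ y → f.fn z = 0 ∨ g.fn z = 0) :
    inner C(X, ℂ) f g (σ y) = star (f.fn y) * g.fn y := by
  rw [inner_apply]
  refine Finset.sum_eq_single y (fun z hz hzy => ?_) fun hy => ?_
  · have hz' : σ z = σ y := ((Set.Finite.mem_toFinset _).1 hz).1
    rcases h z hz' hzy with h | h <;> simp [h]
  · have hy' : (y : X) ∉ tsupport g.fn := fun hy' => hy <| by
      rw [Set.Finite.mem_toFinset]
      exact ⟨rfl, hy'⟩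
    rw [image_eq_zero_of_notMem_tsupport hy', mul_zero]

variable (σ) in
/-- The functions `f` and `g` are supported on sets such that `σ` identifies no point of the first
with a different point of the second. -/
def JointlyInjective (f g : X → ℂ) : Prop :=
  ∀ y z : U, σ y = σ z → f y ≠ 0 → g z ≠ 0 → y = z

/-- Each fibre of σ meets the set where f is nonzero in at most one point, so ⟨f, f⟩ takes only
values |f(y)|² and 0. -/
theorem norm_le_one_of_jointlyInjective {f : PreModule hσ} (h : JointlyInjective σ f.fn f.fn)
    (h1 : ∀ x, ‖f.fn x‖ ≤ 1) : ‖f‖ ≤ 1 := by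
  refine abs_le_of_sq_le_sq' ?_ zero_le_one |>.2
  rw [norm_sq, one_pow, ContinuousMap.norm_le _ zero_le_one]
  intro x
  by_cases hx : ∃ y : U, σ y = x ∧ f.fn y ≠ 0
  · obtain ⟨y, rfl, hy⟩ := hx
    rw [inner_apply_of_unique, norm_mul, norm_star]
    · exact mul_le_one₀ (h1 _) (norm_nonneg _) (h1 _)
    · intro z hz hzy
      left
      by_contra hz0
      exact hzy (h z y hz hz0 hy)
  · push Not at hx
    rw [inner_apply, Finset.sum_eq_zero, norm_zero]
    · exact zero_le_one
    · intro y hy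
      rw [hx y ((Set.Finite.mem_toFinset _).1 hy).1, mul_zero]

end PreModule

open PreModule

omit [CompactSpace X] [T2Space X] in
theorem exists_isOpen_injOn (hσ : IsLocalHomeomorph σ) (y : U) : ∃ O : Set X, IsOpen O ∧ (y : X) ∈ O ∧ O ⊆ U ∧
    ∀ z w : U, (z : X) ∈ O → (w : X) ∈ O → σ z = σ w → z = w := by
  obtain ⟨e, hy, rfl⟩ := hσ y
  refine ⟨Subtype.val '' e.source, U.isOpen.isOpenEmbedding_subtypeVal.isOpenMap _ e.open_source,
    ⟨y, hy, rfl⟩, ?_, ?_⟩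
  · rintro _ ⟨z, -, rfl⟩
    exact z.2
  · rintro z w ⟨z', hz, hzz⟩ ⟨w', hw, hww⟩ h
    obtain rfl := Subtype.ext hzz
    obtain rfl := Subtype.ext hww
    exact e.injOn hz hw h

variable (hσ) in
theorem exists_bump (y : U) {N : Set X} (hN : N ∈ nhds (y : X)) : ∃ f : PreModule hσ,
    tsupport f.fn ⊆ N ∧ f.fn y = 1 ∧ UnitValued f.fn ∧ JointlyInjective σ f.fn f.fn := by
  obtain ⟨O, hO, hyO, hOU, hinj⟩ := exists_isOpen_injOn hσ y
  obtain ⟨χ, h1, h2, h3⟩ := exists_unitValued (K := {(y : X)}) (N := O ∩ interior N)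
    isClosed_singleton (hO.inter isOpen_interior)
    (singleton_subset_iff.2 ⟨hyO, mem_interior_iff_mem_nhds.2 hN⟩)
  refine ⟨of hσ χ (h1.trans (inter_subset_left.trans hOU)),
    h1.trans (inter_subset_right.trans interior_subset), h2 _ rfl, h3, fun z w h hz hw => ?_⟩
  have hO' : ∀ x, χ x ≠ 0 → x ∈ O := fun x hx => (h1 (subset_tsupport _ hx)).1
  exact hinj z w (hO' _ hz) (hO' _ hw) h

end Bumps

/-! ### The redundancy ideal: elements of it, and its vanishing in the orbit representations. -/

section Redundancies

variable {X : Type u} [TopologicalSpace X] [CompactSpace X] [T2Space X]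
  {U : Opens X} {σ : U → X} {hσ : IsLocalHomeomorph σ}

open PreModule Toeplitz

theorem subset_closedIdealGen {B : Type*} [NonUnitalRing B] [TopologicalSpace B] (S : Set B) :
    S ⊆ (closedIdealGen S).1 := fun _ hx => (TwoSidedIdeal.mem_sInf _).2 fun _ hI => hI.2 hx

theorem closedIdealGen_le {B : Type*} [NonUnitalRing B] [TopologicalSpace B] {S : Set B}
    {J : TwoSidedIdeal B} (hJ : IsClosed (J : Set B)) (hS : S ⊆ J) : (closedIdealGen S).1 ≤ J :=
  fun _ hx => (TwoSidedIdeal.mem_sInf _).1 hx J ⟨hJ, hS⟩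

theorem leftAction_coe (a : C(X, ℂ)) (f : PreModule hσ) :
    leftAction hσ a f = (leftMul hσ a f : PreModule hσ) :=
  Completion.map_coe (leftMul hσ a).uniformContinuous f

theorem fn_leftMul (a : C(X, ℂ)) (f : PreModule hσ) : (leftMul hσ a f).fn = a * f.fn := rfl

theorem leftAction_eq_zero_of_forall {a : C(X, ℂ)} (h : ∀ x ∈ U, a x = 0) :
    leftAction hσ a = 0 := by
  ext m
  induction m using Completion.induction_on with
  | hp => exact isClosed_eq (by fun_prop) (by fun_prop)
  | ih f =>
    have : leftMul hσ a f = 0 := ext_of_dom fun y => by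
      rw [fn_leftMul, ContinuousMap.mul_apply, h y y.2, zero_mul, fn_zero]; rfl
    rw [leftAction_coe, this]; rfl

theorem mul_eq_zero_of_leftAction_eq_zero {b : C(X, ℂ)} (hb : leftAction hσ b = 0)
    (f : PreModule hσ) : b * f.fn = 0 := by
  have h := leftAction_coe b f
  rw [hb] at h
  have h' : leftMul hσ b f = 0 := (Completion.coe_injective _ h).symm
  rw [← fn_leftMul, h', fn_zero]

/-- A vector concentrated near `y`, in the sense that it determines the value at `y`. -/
structure IsBumpAt (f : PreModule hσ) (y : U) : Prop where
  apply_eq : f.fn y = 1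
  norm_le : ‖f‖ ≤ 1
  eq_zero : ∀ z : U, σ z = σ y → z ≠ y → f.fn z = 0

variable (hσ) in
theorem exists_isBumpAt (y : U) : ∃ f : PreModule hσ, IsBumpAt f y := by
  obtain ⟨f, -, h1, h2, h3⟩ := exists_bump hσ y Filter.univ_mem
  refine ⟨f, h1, norm_le_one_of_jointlyInjective h3 h2.norm_apply_le, fun z hz hzy => ?_⟩
  by_contra h
  exact hzy (h3 z y hz h (by rw [h1]; exact one_ne_zero))

theorem IsBumpAt.inner_eq {f : PreModule hσ} {y : U} (hf : IsBumpAt f y) (g : PreModule hσ) :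
    inner C(X, ℂ) f g (σ y) = g.fn y := by
  rw [inner_apply_of_unique fun z hz hzy => Or.inl (hf.eq_zero z hz hzy), hf.apply_eq, star_one,
    one_mul]

theorem norm_inner_apply_le (m n : HilbertModule hσ) (x : X) :
    ‖inner C(X, ℂ) m n x‖ ≤ ‖m‖ * ‖n‖ :=
  ((inner C(X, ℂ) m n).norm_coe_le_norm x).trans
    (CStarModule.norm_inner_le (A := C(X, ℂ)) (HilbertModule hσ))

/-- The matrix coefficients of `T` at vectors concentrated near `y` vanish as `y` leaves the
compact subsets of `U`. -/
def DecaysOffCompacts (T : HilbertModule hσ →L[ℂ] HilbertModule hσ) : Prop :=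
  ∀ ε > 0, ∃ K ⊆ (U : Set X), IsCompact K ∧ ∀ (y : U) (f : PreModule hσ), (y : X) ∉ K →
    IsBumpAt f y → ‖inner C(X, ℂ) (f : HilbertModule hσ) (T f) (σ y)‖ ≤ ε

theorem IsBumpAt.norm_coe_le {f : PreModule hσ} {y : U} (hf : IsBumpAt f y) :
    ‖(f : HilbertModule hσ)‖ ≤ 1 := by
  rw [Completion.norm_coe]; exact hf.norm_le

/-- The coefficient is ⟨n, f⟩⟨f, m⟩ at σ(y). Approximating m by g ∈ C_c(U), the second factor is
close to ⟨f, g⟩(σ(y)) = g(y), which vanishes off the support of g. -/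
theorem decaysOffCompacts_rankOne (m n : HilbertModule hσ) :
    DecaysOffCompacts (rankOne hσ m n) := by
  intro ε hε
  obtain ⟨g, hg⟩ := Metric.mem_closure_range_iff.1
    (Completion.denseRange_coe (α := PreModule hσ) m) (ε / (‖n‖ + 1)) (by positivity)
  refine ⟨tsupport g.fn, g.tsupport_fn, (isClosed_tsupport _).isCompact, fun y f hy hf => ?_⟩
  have h1 : inner C(X, ℂ) (f : HilbertModule hσ) (rankOne hσ m n f) (σ y) =
      inner C(X, ℂ) n (f : HilbertModule hσ) (σ y) *
        inner C(X, ℂ) (f : HilbertModule hσ) m (σ y) := by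
    change inner C(X, ℂ) (f : HilbertModule hσ) (inner C(X, ℂ) n (f : HilbertModule hσ) • m) _ = _
    rw [CStarModule.inner_op_smul_right (A := C(X, ℂ)) (E := HilbertModule hσ)]
    rfl
  have h2 : inner C(X, ℂ) (f : HilbertModule hσ) m (σ y) =
      inner C(X, ℂ) (f : HilbertModule hσ) (m - g) (σ y) := by
    rw [CStarModule.inner_sub_right (A := C(X, ℂ)) (E := HilbertModule hσ),
      ContinuousMap.sub_apply, inner_coe_hilbertModule, hf.inner_eq,
      image_eq_zero_of_notMem_tsupport hy, sub_zero]
  rw [h1, h2, norm_mul]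
  rw [dist_eq_norm] at hg
  have h3 := norm_inner_apply_le n (f : HilbertModule hσ) (σ y)
  have h4 := norm_inner_apply_le (f : HilbertModule hσ) (m - g) (σ y)
  have h5 := hf.norm_coe_le
  calc _ ≤ (‖n‖ * 1) * (1 * (ε / (‖n‖ + 1))) := by
        refine mul_le_mul (h3.trans (by gcongr)) (h4.trans (by gcongr)) (norm_nonneg _)
          (by positivity)
    _ ≤ (‖n‖ + 1) * (ε / (‖n‖ + 1)) := by rw [mul_one, one_mul]; gcongr; linarith
    _ = ε := by field_simp

theorem decaysOffCompacts_of_mem_compactOperators {T : HilbertModule hσ →L[ℂ] HilbertModule hσ}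
    (hT : T ∈ compactOperators hσ) : DecaysOffCompacts T := by
  have hspan : ∀ T ∈ Submodule.span ℂ {T | ∃ m n, T = rankOne hσ m n}, DecaysOffCompacts T := by
    intro T hT
    induction hT using Submodule.span_induction with
    | mem T h => obtain ⟨m, n, rfl⟩ := h; exact decaysOffCompacts_rankOne m n
    | zero =>
      intro ε hε
      refine ⟨∅, empty_subset _, isCompact_empty, fun y f _ _ => ?_⟩
      rw [_root_.zero_apply,
        CStarModule.inner_zero_right (A := C(X, ℂ)) (E := HilbertModule hσ)]
      simpa using hε.le
    | add S T _ _ hS hT =>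
      intro ε hε
      obtain ⟨K, hK1, hK2, hK3⟩ := hS (ε / 2) (by positivity)
      obtain ⟨L, hL1, hL2, hL3⟩ := hT (ε / 2) (by positivity)
      refine ⟨K ∪ L, union_subset hK1 hL1, hK2.union hL2, fun y f hy hf => ?_⟩
      rw [_root_.add_apply,
        CStarModule.inner_add_right (A := C(X, ℂ)) (E := HilbertModule hσ)]
      rw [mem_union, not_or] at hy
      calc _ ≤ _ + _ := norm_add_le _ _
        _ ≤ ε / 2 + ε / 2 := add_le_add (hK3 y f hy.1 hf) (hL3 y f hy.2 hf)
        _ = ε := by ring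
    | smul c T _ hT =>
      intro ε hε
      obtain ⟨K, hK1, hK2, hK3⟩ := hT (ε / (‖c‖ + 1)) (by positivity)
      refine ⟨K, hK1, hK2, fun y f hy hf => ?_⟩
      rw [_root_.smul_apply,
        CStarModule.inner_smul_right_complex (A := C(X, ℂ)) (E := HilbertModule hσ),
        ContinuousMap.smul_apply, norm_smul]
      calc _ ≤ (‖c‖ + 1) * (ε / (‖c‖ + 1)) :=
            mul_le_mul (by linarith) (hK3 y f hy hf) (norm_nonneg _) (by positivity)
        _ = ε := by field_simp
  intro ε hε
  obtain ⟨S, hS, hTS⟩ := Metric.mem_closure_iff.1 hT (ε / 2) (by positivity)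
  obtain ⟨K, hK1, hK2, hK3⟩ := hspan S hS (ε / 2) (by positivity)
  refine ⟨K, hK1, hK2, fun y f hy hf => ?_⟩
  have h1 : inner C(X, ℂ) (f : HilbertModule hσ) (T f) =
      inner C(X, ℂ) (f : HilbertModule hσ) ((T - S) f) +
        inner C(X, ℂ) (f : HilbertModule hσ) (S f) := by
    rw [← CStarModule.inner_add_right (A := C(X, ℂ)) (E := HilbertModule hσ),
      _root_.sub_apply, sub_add_cancel]
  rw [dist_eq_norm] at hTS
  have h5 := hf.norm_coe_le
  rw [h1, ContinuousMap.add_apply]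
  calc _ ≤ _ + _ := norm_add_le _ _
    _ ≤ 1 * (ε / 2 * 1) + ε / 2 := by
      refine add_le_add ((norm_inner_apply_le _ _ _).trans ?_) (hK3 y f hy hf)
      gcongr
      refine ((T - S).le_opNorm _).trans ?_
      gcongr
    _ = ε := by ring

/-- At a boundary point of `U`, compactness of φ(a) forces a to be small: its coefficient at a bump
near y is a(y). Outside the closure of `U`, a must annihilate the functions supported there, since
these lie in the kernel of φ. -/
theorem apply_eq_zero_of_mem_katsuraSet {a : C(X, ℂ)} (ha : a ∈ katsuraSet hσ) {x : X}
    (hx : x ∉ U) : a x = 0 := by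
  by_cases hxU : x ∈ closure (U : Set X)
  · refine norm_le_zero_iff.1 (le_of_forall_pos_le_add fun ε hε => ?_)
    rw [zero_add]
    obtain ⟨K, hK1, hK2, hK3⟩ := decaysOffCompacts_of_mem_compactOperators ha.2 ε hε
    have h1 : x ∈ closure (Kᶜ ∩ U) :=
      hK2.isClosed.isOpen_compl.inter_closure ⟨fun h => hx (hK1 h), hxU⟩
    have h2 : IsClosed {y : X | ‖a y‖ ≤ ε} := isClosed_le (by fun_prop) continuous_const
    refine closure_minimal (fun y hy => ?_) h2 h1
    obtain ⟨f, hf⟩ := exists_isBumpAt hσ ⟨y, hy.2⟩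
    have h3 := hK3 ⟨y, hy.2⟩ f hy.1 hf
    rwa [leftAction_coe, inner_coe_hilbertModule, hf.inner_eq, fn_leftMul,
      ContinuousMap.mul_apply, hf.apply_eq, mul_one] at h3
  · obtain ⟨b, hb1, hb2, -⟩ := exists_unitValued (K := {x}) isClosed_singleton
      isClosed_closure.isOpen_compl (singleton_subset_iff.2 hxU)
    have h1 := ha.1 b (leftAction_eq_zero_of_forall fun y hy =>
      eq_zero_of_notMem_of_tsupport_subset hb1 fun h => h (subset_closure hy))
    have h2 := DFunLike.congr_fun h1 x
    rwa [ContinuousMap.mul_apply, hb2 x rfl, mul_one] at h2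

/-- Joint injectivity leaves only one term in ⟨g, e⟩ at the points where f is nonzero, so that φ(f
g⋆) is the rank one operator of f and g. This is the source of all the redundancies used below. -/
theorem ofA_sub_mem_redundancyIdeal {f g : PreModule hσ} (h : JointlyInjective σ f.fn g.fn) :
    ofA hσ (f.fn * star g.fn) - ofF hσ f * star (ofF hσ g) ∈ (redundancyIdeal hσ).1 := by
  have key : ∀ m, leftAction hσ (f.fn * star g.fn) m = rankOne hσ f g m := by
    intro m
    induction m using Completion.induction_on with
    | hp => exact isClosed_eq (by fun_prop) (by fun_prop)
    | ih e =>
      change _ = inner C(X, ℂ) (g : HilbertModule hσ) (e : HilbertModule hσ) • (f : HilbertModule hσ)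
      rw [leftAction_coe, inner_coe_hilbertModule, ← Completion.coe_smul]
      congr 1
      refine ext_of_dom fun y => ?_
      rw [fn_leftMul, fn_right_smul]
      by_cases hy : f.fn y = 0
      · simp [hy]
      · rw [inner_apply_of_unique fun z hz hzy => Or.inl ?_]
        · simp [mul_assoc]
        · by_contra hz0
          exact hzy (h y z hz.symm hy hz0).symm
  refine subset_closedIdealGen _ ⟨_, _, ⟨?_, fun m => ?_⟩, ⟨fun b hb => ?_, ?_⟩, rfl⟩
  · exact subset_closure (NonUnitalAlgebra.subset_adjoin ℂ ⟨_, _, rfl⟩)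
  · rw [ofA_mul_ofM, key, mul_assoc, ofF, ofF, star_ofM_mul_ofM, ofM_mul_ofA]
    rfl
  · rw [mul_right_comm, mul_comm f.fn b, mul_eq_zero_of_leftAction_eq_zero hb, zero_mul]
  · rw [show leftAction hσ (f.fn * star g.fn) = rankOne hσ f g from ContinuousLinearMap.ext key]
    exact subset_closure (Submodule.subset_span ⟨_, _, rfl⟩)

variable {Y : Set X} (hY : IsInvariant σ Y)

/-- The vectors in the range of t(f) vanish at y, because f does. -/
theorem star_orbitHom_ofM_basisVec (z : Circle) (m : HilbertModule hσ) {y : Y}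
    (hy : (y : X) ∉ U) : star (orbitHom hσ hY z (ofM hσ m)) (basisVec y) = 0 := by
  refine ofF_mem_of_forall {b | star (orbitHom hσ hY z b) (basisVec y) = 0} ?_ (fun f => ?_) m
  · have h : Continuous fun b => star (orbitHom hσ hY z b) := (continuous_starHom _).star
    exact isClosed_eq (by fun_prop) continuous_const
  · refine ext_inner_left ℂ fun ξ => ?_
    rw [ContinuousLinearMap.star_eq_adjoint, ContinuousLinearMap.adjoint_inner_right,
      inner_zero_right, ← inner_conj_symm, inner_basisVec, orbitHom_ofF, f.fn_apply_eq_zero hy]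
    simp

/-- For a bump f at y, the operator t(f) sends δ at σ(y) to z δ at y, since f kills the other points
of the fibre. -/
theorem exists_orbitHom_ofF_basisVec (z : Circle) {y : Y} (hy : (y : X) ∈ U) :
    ∃ (f : PreModule hσ) (ξ : Ell2 Y), orbitHom hσ hY z (ofF hσ f) ξ = basisVec y := by
  obtain ⟨f, hf⟩ := exists_isBumpAt hσ ⟨y, hy⟩
  refine ⟨f, ((z : ℂ)⁻¹) • basisVec (sigmaExt hY y), lp.ext (funext fun x => ?_)⟩
  rw [map_smul]
  change (z : ℂ)⁻¹ * _ = _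
  rw [orbitHom_ofF, inv_mul_cancel_left₀ z.coe_ne_zero]
  by_cases hx : x = y
  · subst hx
    rw [basisVec_self, basisVec_self, hf.apply_eq, mul_one]
  · rw [basisVec_of_ne hx]
    by_cases hxU : (x : X) ∈ U
    · by_cases hs : σ ⟨x, hxU⟩ = σ ⟨y, hy⟩
      · rw [hf.eq_zero ⟨x, hxU⟩ hs fun h => hx (Subtype.ext (congrArg (fun u : U => (u : X)) h)),
          zero_mul]
      · rw [basisVec_of_ne, mul_zero]
        intro h
        apply hs
        rw [← sigmaExt_of_mem hY hxU, h, sigmaExt_of_mem hY hy]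
    · rw [f.fn_apply_eq_zero hxU, zero_mul]

/-- Test a - k on basis vectors. If y ∈ U, then δ_y lies in the range of some t(f), and (a - k) t(f)
= 0. If y ∉ U, then a(y) = 0, and k kills δ_y because every n⋆ does. -/
theorem orbitHom_eq_zero_of_mem_redundancyIdeal (z : Circle) {b : Toeplitz hσ}
    (hb : b ∈ (redundancyIdeal hσ).1) : orbitHom hσ hY z b = 0 := by
  have hcl : IsClosed (TwoSidedIdeal.ker (orbitHom hσ hY z) : Set (Toeplitz hσ)) := by
    have : (TwoSidedIdeal.ker (orbitHom hσ hY z) : Set (Toeplitz hσ)) =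
        orbitHom hσ hY z ⁻¹' {0} := by
      ext b; exact TwoSidedIdeal.mem_ker _
    rw [this]
    exact isClosed_singleton.preimage (continuous_starHom _)
  refine (TwoSidedIdeal.mem_ker _).1 (closedIdealGen_le hcl ?_ hb)
  rintro _ ⟨a, k, ⟨hk, hak⟩, ha, rfl⟩
  refine (TwoSidedIdeal.mem_ker _).2 (ext_basisVec fun y => ?_)
  rw [_root_.zero_apply]
  by_cases hy : (y : X) ∈ U
  · obtain ⟨f, ξ, hfξ⟩ := exists_orbitHom_ofF_basisVec (hσ := hσ) hY z hy
    have h0 : (ofA hσ a - k) * ofF hσ f = 0 := by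
      rw [sub_mul, ofF, hak, sub_self]
    rw [← hfξ, ← mul_apply_eq_comp, ← map_mul, h0, map_zero]
    rfl
  · rw [map_sub, _root_.sub_apply, orbitHom_ofA_basisVec,
      apply_eq_zero_of_mem_katsuraSet ha hy, zero_smul, zero_sub, neg_eq_zero]
    have hcl2 : IsClosed {k | orbitHom hσ hY z k (basisVec y) = 0} := by
      have h : Continuous (orbitHom hσ hY z) := continuous_starHom _
      exact isClosed_eq (by fun_prop) continuous_const
    refine closure_minimal (fun k hk => ?_) hcl2 hk
    induction hk using NonUnitalAlgebra.adjoin_induction with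
    | mem x hx =>
      obtain ⟨m, n, rfl⟩ := hx
      change _ = _
      rw [map_mul, map_star, mul_apply_eq_comp, star_orbitHom_ofM_basisVec hY z n hy, map_zero]
    | add x y _ _ hx hy =>
      change _ = _
      rw [map_add, _root_.add_apply, hx, hy, add_zero]
    | zero => change _ = _; rw [map_zero]; rfl
    | mul x y _ _ hx hy =>
      change _ = _
      rw [map_mul, mul_apply_eq_comp, hy, map_zero]
    | smul c x _ hx =>
      change _ = _
      rw [map_smul, _root_.smul_apply, hx, smul_zero]

end Redundancies

/-! ### Functions with values in [0, 1] and peaks. -/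

section UnitValued

variable {X : Type u} [TopologicalSpace X]

theorem UnitValued.one : UnitValued (1 : C(X, ℂ)) := fun _ => ⟨1, by simp, by simp⟩

theorem UnitValued.mul {g h : C(X, ℂ)} (hg : UnitValued g) (hh : UnitValued h) :
    UnitValued (g * h) := by
  intro x
  obtain ⟨r, hr, hx⟩ := hg x
  obtain ⟨s, hs, hx'⟩ := hh x
  exact ⟨r * s, ⟨mul_nonneg hr.1 hs.1, mul_le_one₀ hr.2 hs.1 hs.2⟩, by simp [hx, hx']⟩

theorem UnitValued.one_sub {g : C(X, ℂ)} (hg : UnitValued g) : UnitValued (1 - g) := by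
  intro x
  obtain ⟨r, hr, hx⟩ := hg x
  exact ⟨1 - r, ⟨by linarith [hr.2], by linarith [hr.1]⟩, by simp [hx]⟩

theorem UnitValued.star_eq {g : C(X, ℂ)} (hg : UnitValued g) : star g = g := by
  ext x
  obtain ⟨r, -, hx⟩ := hg x
  simp [hx]

theorem UnitValued.norm_le [CompactSpace X] {g : C(X, ℂ)} (hg : UnitValued g) : ‖g‖ ≤ 1 :=
  (ContinuousMap.norm_le _ zero_le_one).2 fun x => by
    obtain ⟨r, hr, hx⟩ := hg x
    rw [hx, Complex.norm_real, Real.norm_of_nonneg hr.1]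
    exact hr.2

variable [CompactSpace X] [T2Space X] {U : Opens X} {σ : U → X} {hσ : IsLocalHomeomorph σ}

omit [CompactSpace X] [T2Space X] in
theorem UnitValued.smul {g : C(X, ℂ)} (hg : UnitValued g) {f : PreModule hσ}
    (hf : UnitValued f.fn) : UnitValued (g • f).fn := by
  intro x
  by_cases hx : x ∈ U
  · obtain ⟨r, hr, hr'⟩ := hf x
    obtain ⟨s, hs, hs'⟩ := hg (σ ⟨x, hx⟩)
    refine ⟨r * s, ⟨mul_nonneg hr.1 hs.1, mul_le_one₀ hr.2 hs.1 hs.2⟩, ?_⟩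
    rw [PreModule.fn_right_smul g f ⟨x, hx⟩, hs', hr', Complex.ofReal_mul]
  · exact ⟨0, by simp, by rw [PreModule.fn_apply_eq_zero _ hx]; simp⟩

/-- A function with values in `[0, 1]` and the value `1` at `x`. -/
structure PeaksAt (h : C(X, ℂ)) (x : X) : Prop where
  unitValued : UnitValued h
  apply_eq : h x = 1

omit [CompactSpace X] [T2Space X] in
theorem PeaksAt.mul {g h : C(X, ℂ)} {x : X} (hg : PeaksAt g x) (hh : PeaksAt h x) :
    PeaksAt (g * h) x :=
  ⟨hg.1.mul hh.1, by rw [ContinuousMap.mul_apply, hg.2, hh.2, one_mul]⟩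

theorem exists_peaksAt {N : Set X} (hN : IsOpen N) {x : X} (hx : x ∈ N) :
    ∃ h : C(X, ℂ), PeaksAt h x ∧ tsupport h ⊆ N := by
  obtain ⟨h, h1, h2, h3⟩ := exists_unitValued isClosed_singleton hN (singleton_subset_iff.2 hx)
  exact ⟨h, ⟨h3, h2 x rfl⟩, h1⟩

theorem exists_peaksAt_mul_eq_zero {x y : X} (hxy : x ≠ y) :
    ∃ g h : C(X, ℂ), PeaksAt g x ∧ PeaksAt h y ∧ g * h = 0 := by
  obtain ⟨g, hg, hg'⟩ := exists_peaksAt (isOpen_compl_singleton (x := y)) (x := x) hxy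
  obtain ⟨h, hh, hh'⟩ := exists_peaksAt (isClosed_tsupport g).isOpen_compl (x := y)
    fun hy => hg' hy rfl
  refine ⟨g, h, hg, hh, ?_⟩
  ext z
  by_cases hz : z ∈ tsupport g
  · rw [ContinuousMap.mul_apply,
      eq_zero_of_notMem_of_tsupport_subset hh' (fun h => h hz), mul_zero]; rfl
  · rw [ContinuousMap.mul_apply, image_eq_zero_of_notMem_tsupport hz, zero_mul]; rfl

end UnitValued

/-! ### Iterates of the partial map. -/

section Iterates

variable {Y : Type*} {W : Set Y} {σ : W → Y}

/-- The definition splits off the last application of σ; splitting off the first one matches the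
recursion of `words`. -/
theorem iterEq_succ' {n : ℕ} {x y : Y} :
    IterEq σ (n + 1) x y ↔ ∃ z : W, (z : Y) = x ∧ IterEq σ n (σ z) y := by
  induction n generalizing y with
  | zero =>
    constructor
    · rintro ⟨z, hz, rfl⟩
      exact ⟨z, hz.symm, rfl⟩
    · rintro ⟨z, hz, rfl⟩
      exact ⟨z, hz.symm, rfl⟩
  | succ n ih =>
    constructor
    · rintro ⟨w, hw, rfl⟩
      obtain ⟨z, hz, hzw⟩ := ih.1 hw
      exact ⟨z, hz, w, hzw, rfl⟩
    · rintro ⟨z, hz, w, hw, rfl⟩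
      exact ⟨w, ih.2 ⟨z, hz, hw⟩, rfl⟩

end Iterates

/-! ### Compression to C(X) near a point without coincidences. -/

section Localization

variable {X : Type u} [TopologicalSpace X] [CompactSpace X] [T2Space X]
  {U : Opens X} {σ : U → X} {hσ : IsLocalHomeomorph σ}

open PreModule Toeplitz

/-- Both sides are t of the function e f (g ∘ σ). This pulls a localizing function back along σ,
from the right of a letter to its left. -/
theorem ofA_smul_fn_mul_ofF (g : C(X, ℂ)) (e f : PreModule hσ) :
    ofA hσ (g • e).fn * ofF hσ f = ofF hσ (leftMul hσ e.fn f) * ofA hσ g := by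
  rw [ofA_mul_ofF, ofF_mul_ofA]
  congr 1
  refine ext_of_dom fun y => ?_
  rw [fn_leftMul, fn_right_smul, fn_leftMul, ContinuousMap.mul_apply, ContinuousMap.mul_apply,
    fn_right_smul]
  ring

theorem exists_peaksAt_ofA_mul_ofF_eq_zero (f : PreModule hσ) {x : X} (hx : x ∉ U) :
    ∃ h : C(X, ℂ), PeaksAt h x ∧ ofA hσ h * ofF hσ f = 0 := by
  obtain ⟨h, hh, hh'⟩ := exists_peaksAt (isClosed_tsupport f.fn).isOpen_compl (x := x)
    fun h => hx (f.tsupport_fn h)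
  refine ⟨h, hh, ?_⟩
  have h0 : leftMul hσ h f = 0 := ext_of_dom fun y => by
    rw [fn_leftMul, ContinuousMap.mul_apply]
    by_cases hy : (y : X) ∈ tsupport f.fn
    · rw [eq_zero_of_notMem_of_tsupport_subset hh' (fun h => h hy), zero_mul]; rfl
    · rw [image_eq_zero_of_notMem_tsupport hy, mul_zero]; rfl
  rw [ofA_mul_ofF, h0]
  exact map_zero (ofMLin hσ)

variable (hσ) in
theorem exists_peaksAt_smul (y : U) {g : C(X, ℂ)} (hg : PeaksAt g (σ y)) :
    ∃ e : PreModule hσ, PeaksAt (g • e).fn y ∧ JointlyInjective σ e.fn e.fn := by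
  obtain ⟨e, -, h1, h2, h3⟩ := exists_bump hσ y Filter.univ_mem
  exact ⟨e, ⟨hg.1.smul h2, by rw [fn_right_smul, h1, hg.2, one_mul]⟩, h3⟩

/-- The orbit of x leaves `U` before the word is exhausted. A function peaked at the exit point and
vanishing on the support of the corresponding letter kills that letter; pull it back to x. -/
theorem exists_peaksAt_ofA_mul_eq_zero {n : ℕ} {w : Toeplitz hσ} (hw : w ∈ words hσ n) {x : X}
    (hx : ¬ ∃ z, IterEq σ n x z) : ∃ h : C(X, ℂ), PeaksAt h x ∧ ofA hσ h * w = 0 := by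
  induction n generalizing w x with
  | zero => exact absurd ⟨x, rfl⟩ hx
  | succ n ih =>
    obtain ⟨f, w, hw, rfl⟩ := hw
    by_cases hxU : x ∈ U
    · obtain ⟨g, hg, hgw⟩ := ih hw (x := σ ⟨x, hxU⟩) fun ⟨z, hz⟩ =>
        hx ⟨z, iterEq_succ'.2 ⟨⟨x, hxU⟩, rfl, hz⟩⟩
      obtain ⟨e, he, -⟩ := exists_peaksAt_smul hσ ⟨x, hxU⟩ hg
      exact ⟨_, he, by rw [← mul_assoc, ofA_smul_fn_mul_ofF, mul_assoc, hgw, mul_zero]⟩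
    · obtain ⟨h, hh, hf⟩ := exists_peaksAt_ofA_mul_ofF_eq_zero f hxU
      exact ⟨h, hh, by rw [← mul_assoc, hf, zero_mul]⟩

theorem exists_peaksAt_ofA_mul_eq_mul {n : ℕ} {w : Toeplitz hσ} (hw : w ∈ words hσ n) {x z : X}
    (hx : IterEq σ n x z) {g : C(X, ℂ)} (hg : PeaksAt g z) :
    ∃ h : C(X, ℂ), PeaksAt h x ∧ ∃ v, ofA hσ h * w = v * ofA hσ g := by
  induction n generalizing w x with
  | zero =>
    obtain ⟨a, rfl⟩ := hw
    obtain rfl : x = z := hx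
    exact ⟨g, hg, ofA hσ a, by rw [← ofA_mul, ← ofA_mul, mul_comm]⟩
  | succ n ih =>
    obtain ⟨f, w, hw, rfl⟩ := hw
    obtain ⟨y, rfl, hy⟩ := iterEq_succ'.1 hx
    obtain ⟨h, hh, v, hv⟩ := ih hw hy
    obtain ⟨e, he, -⟩ := exists_peaksAt_smul hσ y hh
    exact ⟨_, he, ofF hσ (leftMul hσ e.fn f) * v, by
      rw [← mul_assoc, ofA_smul_fn_mul_ofF, mul_assoc, hv, mul_assoc]⟩

/-- The compression `h b h` agrees with an element of `C(X)` modulo the redundancies. -/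
def Localizes (h : C(X, ℂ)) (b : Toeplitz hσ) : Prop :=
  ∃ a, ofA hσ h * b * ofA hσ h - ofA hσ a ∈ (redundancyIdeal hσ).1

theorem Localizes.mul {h : C(X, ℂ)} {b : Toeplitz hσ} (H : Localizes h b) (g : C(X, ℂ)) :
    Localizes (g * h) b := by
  obtain ⟨a, ha⟩ := H
  refine ⟨g * a * g, ?_⟩
  have h1 : ofA hσ (g * h) * b * ofA hσ (g * h) - ofA hσ (g * a * g) =
      ofA hσ g * (ofA hσ h * b * ofA hσ h - ofA hσ a) * ofA hσ g := by
    nth_rw 2 [mul_comm g h]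
    simp only [ofA_mul, mul_sub, sub_mul, mul_assoc]
  rw [h1]
  exact TwoSidedIdeal.mul_mem_right _ _ _ (TwoSidedIdeal.mul_mem_left _ _ _ ha)

theorem localizes_of_eq_zero {h : C(X, ℂ)} {b : Toeplitz hσ}
    (H : ofA hσ h * b * ofA hσ h = 0) : Localizes h b :=
  ⟨0, by rw [H, ofA_zero, sub_zero]; exact TwoSidedIdeal.zero_mem _⟩

theorem star_mul_ofA {h : C(X, ℂ)} (hh : UnitValued h) (b : Toeplitz hσ) :
    star b * ofA hσ h = star (ofA hσ h * b) := by
  rw [star_mul, ← ofA_star, hh.star_eq]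

/-- Compress the inner part v w⋆ at σ(x) to a function a, modulo redundancies. Cutting by e, on
whose support σ is injective, makes the outer letters d, d' jointly injective, so t(d) a t(d')⋆ is a
function modulo redundancies too. -/
theorem exists_localizes_mul_star {n : ℕ} {v w : Toeplitz hσ} (hv : v ∈ words hσ n)
    (hw : w ∈ words hσ n) (x : X) : ∃ h : C(X, ℂ), PeaksAt h x ∧ Localizes h (v * star w) := by
  induction n generalizing v w x with
  | zero =>
    obtain ⟨a, rfl⟩ := hv
    obtain ⟨b, rfl⟩ := hw
    refine ⟨1, ⟨.one, rfl⟩, 1 * (a * star b) * 1, ?_⟩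
    simp only [ofA_mul, ofA_star, sub_self]
    exact TwoSidedIdeal.zero_mem _
  | succ n ih =>
    obtain ⟨f, v, hv, rfl⟩ := hv
    obtain ⟨f', w, hw, rfl⟩ := hw
    by_cases hxU : x ∈ U
    · obtain ⟨g, hg, a, ha⟩ := ih hv hw (σ ⟨x, hxU⟩)
      obtain ⟨e, he, hinj⟩ := exists_peaksAt_smul hσ ⟨x, hxU⟩ hg
      set d := leftMul hσ e.fn f
      set d' := leftMul hσ e.fn f'
      refine ⟨_, he, (a • d).fn * star d'.fn, ?_⟩
      have h1 : ofA hσ (g • e).fn * (ofF hσ f * v * star (ofF hσ f' * w)) * ofA hσ (g • e).fn =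
          ofF hσ d * (ofA hσ g * (v * star w) * ofA hσ g) * star (ofF hσ d') := by
        rw [mul_assoc, mul_assoc _ (star _), star_mul_ofA he.1, ← mul_assoc, ← mul_assoc,
          ofA_smul_fn_mul_ofF, ← mul_assoc, ofA_smul_fn_mul_ofF, star_mul, star_mul,
          ← ofA_star, hg.1.star_eq]
        simp only [mul_assoc]
        rfl
      have h2 : JointlyInjective σ (a • d).fn d'.fn := by
        intro y z hyz hy hz
        rw [fn_right_smul, fn_leftMul, ContinuousMap.mul_apply] at hy
        rw [fn_leftMul, ContinuousMap.mul_apply] at hz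
        exact hinj y z hyz (left_ne_zero_of_mul (left_ne_zero_of_mul hy))
          (left_ne_zero_of_mul hz)
      have h3 := ofA_sub_mem_redundancyIdeal h2
      have h4 := TwoSidedIdeal.mul_mem_right _ _ (star (ofF hσ d'))
        (TwoSidedIdeal.mul_mem_left _ (ofF hσ d) _ ha)
      rw [h1]
      have h5 := TwoSidedIdeal.sub_mem _ h4 h3
      rw [mul_sub, sub_mul, ofF_mul_ofA, sub_sub_sub_cancel_right] at h5
      exact h5
    · obtain ⟨h, hh, hf⟩ := exists_peaksAt_ofA_mul_ofF_eq_zero f hxU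
      exact ⟨h, hh, localizes_of_eq_zero (by
        simp only [← mul_assoc, hf, zero_mul])⟩

theorem exists_localizes_of_mem_monomials {n k : ℕ} {b : Toeplitz hσ} (hb : b ∈ monomials hσ n k)
    {x : X} (hx : n ≠ k → ¬ ∃ z, IterEq σ n x z ∧ IterEq σ k x z) :
    ∃ h : C(X, ℂ), PeaksAt h x ∧ Localizes h b := by
  obtain ⟨v, hv, w, hw, rfl⟩ := hb
  by_cases hnk : n = k
  · subst hnk
    exact exists_localizes_mul_star hv hw x
  · by_cases h1 : ∃ z, IterEq σ n x z
    · by_cases h2 : ∃ z, IterEq σ k x z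
      · obtain ⟨z, hz⟩ := h1
        obtain ⟨y, hy⟩ := h2
        have hzy : z ≠ y := by
          rintro rfl
          exact hx hnk ⟨z, hz, hy⟩
        -- The two words carry x to different points. Functions with product zero peaked at these
        -- points are moved out through the words, so that the compressed monomial contains g g' =
        -- 0.
        obtain ⟨g, g', hg, hg', hgg⟩ := exists_peaksAt_mul_eq_zero hzy
        obtain ⟨h, hh, v', hv'⟩ := exists_peaksAt_ofA_mul_eq_mul hv hz hg
        obtain ⟨h', hh', w', hw'⟩ := exists_peaksAt_ofA_mul_eq_mul hw hy hg'
        refine ⟨h' * h, hh'.mul hh, localizes_of_eq_zero ?_⟩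
        have h3 : ofA hσ h * (v * star w) * ofA hσ h' = 0 := by
          rw [mul_assoc, mul_assoc, star_mul_ofA hh'.1, hw', ← mul_assoc, hv', star_mul,
            ← ofA_star, hg'.1.star_eq, mul_assoc, ← mul_assoc _ _ (star w'), ← ofA_mul, hgg,
            ofA_zero, zero_mul, mul_zero]
        have h4 : ofA hσ (h' * h) * (v * star w) * ofA hσ (h' * h) =
            ofA hσ h' * (ofA hσ h * (v * star w) * ofA hσ h') * ofA hσ h := by
          simp only [ofA_mul, mul_assoc]
        rw [h4, h3, mul_zero, zero_mul]
      · obtain ⟨h, hh, hw'⟩ := exists_peaksAt_ofA_mul_eq_zero hw h2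
        refine ⟨h, hh, localizes_of_eq_zero ?_⟩
        rw [mul_assoc, mul_assoc, star_mul_ofA hh.1, hw', star_zero, mul_zero, mul_zero]
    · obtain ⟨h, hh, hv'⟩ := exists_peaksAt_ofA_mul_eq_zero hv h1
      exact ⟨h, hh, localizes_of_eq_zero (by simp only [← mul_assoc, hv', zero_mul])⟩

/-- Near a point without coincidences between its iterates, an algebraic element of the Toeplitz
algebra can be compressed into `C(X)`. -/
theorem exists_localizes_of_mem_polynomials {b : Toeplitz hσ} (hb : b ∈ polynomials hσ)
    {x : X} (hx : ∀ n k : ℕ, n ≠ k → ¬ ∃ z, IterEq σ n x z ∧ IterEq σ k x z) :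
    ∃ h : C(X, ℂ), PeaksAt h x ∧ Localizes h b := by
  change b ∈ Submodule.span ℂ _ at hb
  induction hb using Submodule.span_induction with
  | mem b hb =>
    obtain ⟨n, k, hb⟩ := hb
    exact exists_localizes_of_mem_monomials hb (hx n k)
  | zero => exact ⟨1, ⟨.one, rfl⟩, localizes_of_eq_zero (by rw [mul_zero, zero_mul])⟩
  | add b c _ _ hb hc =>
    obtain ⟨g, hg, hgb⟩ := hb
    obtain ⟨h, hh, hhc⟩ := hc
    -- Localization survives multiplication of the peak by a function, so the product of the two
    -- peaks serves both summands.
    refine ⟨h * g, hh.mul hg, ?_⟩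
    obtain ⟨a, ha⟩ := hgb.mul h
    obtain ⟨a', ha'⟩ := hhc.mul g
    rw [mul_comm g h] at ha'
    refine ⟨a + a', ?_⟩
    rw [ofA_add, mul_add, add_mul, add_sub_add_comm]
    exact TwoSidedIdeal.add_mem _ ha ha'
  | smul c b _ hb =>
    obtain ⟨h, hh, a, ha⟩ := hb
    refine ⟨h, hh, c • a, ?_⟩
    rw [ofA_smul, mul_smul_comm, smul_mul_assoc, ← smul_sub]
    exact TwoSidedIdeal.smul_mem_of_isClosed (redundancyIdeal hσ).2 c ha

end Localization

/-! ### Functions which are units for words, modulo redundancies. -/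

section LocalUnits

variable {X : Type u} [TopologicalSpace X] [CompactSpace X] [T2Space X]
  {U : Opens X} {σ : U → X} {hσ : IsLocalHomeomorph σ}

open PreModule Toeplitz

variable (hσ) in
/-- The functions which agree, modulo the redundancies, with a linear combination of elements
`v w^*`, for words `v` and `w` of length `N`. -/
def spannedByWords (N : ℕ) : Set C(X, ℂ) :=
  {h | ∃ k ∈ Submodule.span ℂ (monomials hσ N N), ofA hσ h - k ∈ (redundancyIdeal hσ).1}

theorem add_mem_spannedByWords {N : ℕ} {g h : C(X, ℂ)} (hg : g ∈ spannedByWords hσ N)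
    (hh : h ∈ spannedByWords hσ N) : g + h ∈ spannedByWords hσ N := by
  obtain ⟨k, hk, hgk⟩ := hg
  obtain ⟨l, hl, hhl⟩ := hh
  refine ⟨k + l, add_mem hk hl, ?_⟩
  rw [ofA_add, add_sub_add_comm]
  exact TwoSidedIdeal.add_mem _ hgk hhl

theorem zero_mem_spannedByWords (N : ℕ) : 0 ∈ spannedByWords hσ N :=
  ⟨0, zero_mem _, by rw [ofA_zero, sub_zero]; exact TwoSidedIdeal.zero_mem _⟩

theorem mul_mem_spannedByWords {N : ℕ} (a : C(X, ℂ)) {h : C(X, ℂ)}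
    (hh : h ∈ spannedByWords hσ N) : a * h ∈ spannedByWords hσ N := by
  obtain ⟨k, hk, hhk⟩ := hh
  refine ⟨ofA hσ a * k, ?_, ?_⟩
  · clear hhk
    induction hk using Submodule.span_induction with
    | mem b hb => exact Submodule.subset_span (ofA_mul_mem_monomials a hb)
    | zero => rw [mul_zero]; exact zero_mem _
    | add b c _ _ hb hc => rw [mul_add]; exact add_mem hb hc
    | smul c b _ hb => rw [mul_smul_comm]; exact Submodule.smul_mem _ _ hb
  · rw [ofA_mul, ← mul_sub]
    exact TwoSidedIdeal.mul_mem_left _ _ _ hhk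

/-- Choose χ equal to 1 on the support of e and supported where σ is injective. Then e (h ∘ σ)
agrees with t(e) h t(χ)⋆ modulo redundancies, and replacing h by a combination of monomials
lengthens both of their words by one. -/
theorem smul_fn_mem_spannedByWords_of_subset {N : ℕ} {h : C(X, ℂ)}
    (hh : h ∈ spannedByWords hσ N) {O : Set X} (hO : IsOpen O) (hOU : O ⊆ U)
    (hinj : ∀ z w : U, (z : X) ∈ O → (w : X) ∈ O → σ z = σ w → z = w) {e : PreModule hσ}
    (he : tsupport e.fn ⊆ O) : (h • e).fn ∈ spannedByWords hσ (N + 1) := by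
  obtain ⟨χ, h1, h2, h3⟩ := exists_unitValued (isClosed_tsupport e.fn) hO he
  let m : PreModule hσ := of hσ χ (h1.trans hOU)
  have h4 : (h • e).fn = (h • e).fn * star m.fn := by
    ext x
    rw [ContinuousMap.mul_apply, show m.fn = χ from rfl, h3.star_eq]
    by_cases hx : x ∈ tsupport e.fn
    · rw [h2 x hx, mul_one]
    · have : (h • e).fn x = 0 := by
        by_cases hxU : x ∈ U
        · rw [fn_right_smul h e ⟨x, hxU⟩, image_eq_zero_of_notMem_tsupport hx, zero_mul]
        · exact fn_apply_eq_zero _ hxU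
      rw [this, zero_mul]
  have h5 : JointlyInjective σ (h • e).fn m.fn := by
    intro y z hyz hy hz
    rw [fn_right_smul] at hy
    exact hinj y z (he (subset_tsupport _ (left_ne_zero_of_mul hy)))
      (h1 (subset_tsupport _ hz)) hyz
  have h6 := ofA_sub_mem_redundancyIdeal h5
  rw [← h4, ← ofF_mul_ofA] at h6
  obtain ⟨k, hk, hhk⟩ := hh
  refine ⟨ofF hσ e * k * star (ofF hσ m), ?_, ?_⟩
  · clear hhk
    induction hk using Submodule.span_induction with
    | mem b hb =>
      obtain ⟨v, hv, w, hw, rfl⟩ := hb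
      refine Submodule.subset_span ⟨_, ofF_mul_mem_words e hv, _, ofF_mul_mem_words m hw, ?_⟩
      simp only [star_mul, mul_assoc]
    | zero => rw [mul_zero, zero_mul]; exact zero_mem _
    | add b c _ _ hb hc => rw [mul_add, add_mul]; exact add_mem hb hc
    | smul c b _ hb => rw [mul_smul_comm, smul_mul_assoc]; exact Submodule.smul_mem _ _ hb
  · have h7 := TwoSidedIdeal.mul_mem_right _ _ (star (ofF hσ m))
      (TwoSidedIdeal.mul_mem_left _ (ofF hσ e) _ hhk)
    have h8 := TwoSidedIdeal.add_mem _ h6 h7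
    rwa [mul_sub, sub_mul, sub_add_sub_cancel] at h8

/-- A partition of unity on the support of e splits it into pieces supported where σ is injective.
-/
theorem smul_fn_mem_spannedByWords {N : ℕ} {h : C(X, ℂ)} (hh : h ∈ spannedByWords hσ N)
    (e : PreModule hσ) : (h • e).fn ∈ spannedByWords hσ (N + 1) := by
  have hK : IsCompact (tsupport e.fn) := (isClosed_tsupport e.fn).isCompact
  choose O hO hyO hOU hinj using exists_isOpen_injOn hσ
  obtain ⟨t, ht⟩ := hK.elim_finite_subcover O hO
    (fun z hz => mem_iUnion.2 ⟨⟨z, e.tsupport_fn hz⟩, hyO _⟩)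
  obtain ⟨ρ, hρ1, hρ2, -, -⟩ := exists_continuous_sum_one_of_isOpen_isCompact
    (s := fun i : Fin t.card => O (t.equivFin.symm i)) (fun i => hO _) hK (by
      intro z hz
      obtain ⟨y, hy, hzy⟩ := mem_iUnion₂.1 (ht hz)
      exact mem_iUnion.2 ⟨t.equivFin ⟨y, hy⟩, by simpa using hzy⟩)
  let r : Fin t.card → C(X, ℂ) := fun i => ⟨fun x => (ρ i x : ℂ), by fun_prop⟩
  have hsum : (h • e).fn = ∑ i, (h • leftMul hσ (r i) e).fn := by
    ext x
    rw [ContinuousMap.sum_apply]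
    by_cases hxU : x ∈ U
    · have h1 : ∀ i, (h • leftMul hσ (r i) e).fn x = r i x * (h • e).fn x := fun i => by
        rw [fn_right_smul h _ ⟨x, hxU⟩, fn_right_smul h _ ⟨x, hxU⟩, fn_leftMul,
          ContinuousMap.mul_apply, mul_assoc]
      rw [Finset.sum_congr rfl fun i _ => h1 i, ← Finset.sum_mul]
      by_cases hx : x ∈ tsupport e.fn
      · have h2 : ∑ i, r i x = 1 := by
          have : ∑ i, ρ i x = 1 := by simpa using hρ2 hx
          change ∑ i, (ρ i x : ℂ) = 1
          exact_mod_cast this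
        rw [h2, one_mul]
      · rw [fn_right_smul h _ ⟨x, hxU⟩, image_eq_zero_of_notMem_tsupport hx, zero_mul, mul_zero]
    · rw [fn_apply_eq_zero _ hxU, Finset.sum_eq_zero fun i _ => fn_apply_eq_zero _ hxU]
  rw [hsum]
  refine Finset.sum_induction _ (· ∈ spannedByWords hσ (N + 1))
    (fun _ _ => add_mem_spannedByWords) (zero_mem_spannedByWords _) fun i _ => ?_
  refine smul_fn_mem_spannedByWords_of_subset hh (hO _) (hOU _) (hinj _)
    ((closure_minimal ?_ (isClosed_tsupport (ρ i))).trans (hρ1 i))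
  intro x hx
  refine subset_tsupport _ fun h0 => hx ?_
  rw [fn_leftMul, ContinuousMap.mul_apply]
  simp [r, h0]

/-- If h is a unit for the tail of the word and χ is 1 on the support of the first letter, then χ (h
∘ σ) is a unit for the whole word. -/
theorem exists_unit_of_mem_words {N : ℕ} {w : Toeplitz hσ} (hw : w ∈ words hσ N) :
    ∃ h ∈ spannedByWords hσ N, UnitValued h ∧ ofA hσ h * w = w := by
  induction N generalizing w with
  | zero =>
    refine ⟨1, ⟨_, Submodule.subset_span (ofA_mem_monomials 1), ?_⟩, .one, (ofA_one_mul w).1⟩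
    rw [sub_self]
    exact TwoSidedIdeal.zero_mem _
  | succ N ih =>
    obtain ⟨f, w, hw, rfl⟩ := hw
    obtain ⟨h, hh, hu, hhw⟩ := ih hw
    obtain ⟨χ, h1, h2, h3⟩ := exists_unitValued (isClosed_tsupport f.fn) U.isOpen f.tsupport_fn
    refine ⟨_, smul_fn_mem_spannedByWords hh (of hσ χ h1), hu.smul h3, ?_⟩
    have h4 : leftMul hσ (of hσ χ h1).fn f = f := ext_of_dom fun y => by
      rw [fn_leftMul, ContinuousMap.mul_apply]
      change χ y * _ = _
      by_cases hy : (y : X) ∈ tsupport f.fn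
      · rw [h2 y hy, one_mul]
      · rw [image_eq_zero_of_notMem_tsupport hy, mul_zero]
    rw [← mul_assoc, ofA_smul_fn_mul_ofF, h4, mul_assoc, hhw]

theorem exists_unit_of_mem_span {N : ℕ} {k : Toeplitz hσ}
    (hk : k ∈ Submodule.span ℂ (monomials hσ N N)) :
    ∃ h ∈ spannedByWords hσ N, UnitValued h ∧ ofA hσ (1 - h) * k = 0 := by
  induction hk using Submodule.span_induction with
  | mem b hb =>
    obtain ⟨v, hv, w, hw, rfl⟩ := hb
    obtain ⟨h, hh, hu, hhv⟩ := exists_unit_of_mem_words hv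
    refine ⟨h, hh, hu, ?_⟩
    rw [ofA_sub, sub_mul, (ofA_one_mul _).1, ← mul_assoc, hhv, sub_self]
  | zero =>
    exact ⟨0, zero_mem_spannedByWords N, fun x => ⟨0, by simp, by simp⟩, mul_zero _⟩
  | add b c _ _ hb hc =>
    obtain ⟨g, hg, hgu, hgb⟩ := hb
    obtain ⟨h, hh, hhu, hhc⟩ := hc
    -- This is 1 - (1 - g)(1 - h): its complement contains both annihilating factors and still takes
    -- values in [0, 1].
    refine ⟨g + (1 - g) * h, add_mem_spannedByWords hg (mul_mem_spannedByWords _ hh), ?_, ?_⟩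
    · have : g + (1 - g) * h = 1 - (1 - g) * (1 - h) := by ring
      rw [this]
      exact (hgu.one_sub.mul hhu.one_sub).one_sub
    · have : 1 - (g + (1 - g) * h) = (1 - h) * (1 - g) := by ring
      rw [this, mul_add, ofA_mul, mul_assoc, hgb, mul_zero, zero_add, ← ofA_mul,
        mul_comm (1 - h), ofA_mul, mul_assoc, hhc, mul_zero]
  | smul c b _ hb =>
    obtain ⟨h, hh, hu, hhb⟩ := hb
    exact ⟨h, hh, hu, by rw [mul_smul_comm, hhb, smul_zero]⟩

end LocalUnits

/-! ### Points at which different iterates never agree. -/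

section FreePoints

variable {X : Type u}

/-- The points of `X'` at which no two different iterates of `σ` agree. -/
def freePoints {W : Set X} (σ : W → X) (X' : Set X) : Set X :=
  {x | x ∈ X' ∧ ∀ n k : ℕ, n ≠ k → ¬ ∃ z, IterEq σ n x z ∧ IterEq σ k x z}

theorem isInvariant_freePoints {W : Set X} {σ : W → X} {X' : Set X} (hX' : IsInvariant σ X') :
    IsInvariant σ (freePoints σ X') := by
  constructor
  · rintro _ ⟨x, ⟨hx, hfree⟩, rfl⟩
    refine ⟨hX'.1 ⟨x, hx, rfl⟩, fun n k hnk ⟨z, hn, hk⟩ => ?_⟩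
    exact hfree (n + 1) (k + 1) (by omega)
      ⟨z, iterEq_succ'.2 ⟨x, rfl, hn⟩, iterEq_succ'.2 ⟨x, rfl, hk⟩⟩
  · rintro _ ⟨x, ⟨hx, hfree⟩, rfl⟩
    -- The one coincidence at x which does not lower to smaller exponents at σ(x) has one exponent
    -- equal to zero. Then x is periodic, and so is σ(x).
    have h0 : ∀ n : ℕ, ¬ IterEq σ (n + 1) x x := fun n h => by
      obtain ⟨y, hy, hn⟩ := iterEq_succ'.1 h
      obtain rfl := Subtype.ext hy
      exact hfree (n + 1) 0 (by omega) ⟨σ y, ⟨y, hn, rfl⟩, rfl⟩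
    refine ⟨hX'.2 ⟨x, hx, rfl⟩, fun n k hnk ⟨z, hn, hk⟩ => ?_⟩
    cases n with
    | zero =>
      cases k with
      | zero => exact hnk rfl
      | succ k =>
        obtain rfl : (x : X) = z := hn
        exact h0 k hk
    | succ n =>
      cases k with
      | zero =>
        obtain rfl : (x : X) = z := hk
        exact h0 n hn
      | succ k =>
        obtain ⟨y, hy, hn'⟩ := iterEq_succ'.1 hn
        obtain ⟨y', hy', hk'⟩ := iterEq_succ'.1 hk
        obtain rfl := Subtype.ext hy
        obtain rfl := Subtype.ext hy'
        exact hfree n k (by omega) ⟨z, hn', hk'⟩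

theorem IterEq.restrict {W : Set X} {σ : W → X} {X' : Set X} (hX' : IsInvariant σ X') {n : ℕ}
    {x : X'} {z : X} (h : IterEq σ n x z) :
    ∃ hz : z ∈ X', IterEq (restrict σ hX') n x ⟨z, hz⟩ := by
  induction n generalizing z with
  | zero =>
    obtain rfl : (x : X) = z := h
    exact ⟨x.2, rfl⟩
  | succ n ih =>
    obtain ⟨w, hw, rfl⟩ := h
    obtain ⟨hwX, hw'⟩ := ih hw
    exact ⟨hX'.1 ⟨w, hwX, rfl⟩, ⟨⟨w, hwX⟩, w.2⟩, hw', rfl⟩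

/-- Baire's theorem in the compact space X': the free points contain the intersection of the
countably many dense open complements of the closed coincidence sets. -/
theorem subset_closure_freePoints [TopologicalSpace X] [CompactSpace X] [T2Space X] {W : Set X}
    {σ : W → X} {X' : Set X} (hX' : IsInvariant σ X') (hcl : IsClosed X')
    (hfree : TopologicallyFree (restrict σ hX')) : X' ⊆ closure (freePoints σ X') := by
  have : CompactSpace X' := isCompact_iff_compactSpace.1 hcl.isCompact
  let F : {p : ℕ × ℕ // p.1 ≠ p.2} → Set X' := fun p =>
    (closure (coincidenceSet (restrict σ hX') p.1.1 p.1.2))ᶜ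
  have hd : Dense (⋂ p, F p) := dense_iInter_of_isOpen (fun p => isClosed_closure.isOpen_compl)
    fun p => interior_eq_empty_iff_dense_compl.1 (hfree _ _ p.2)
  intro x hx
  have h1 := hd ⟨x, hx⟩
  have h2 := image_closure_subset_closure_image (f := (Subtype.val : X' → X))
    continuous_subtype_val ⟨_, h1, rfl⟩
  refine closure_mono ?_ h2
  rintro _ ⟨y, hy, rfl⟩
  refine ⟨y.2, fun n k hnk ⟨z, hn, hk⟩ => ?_⟩
  obtain ⟨hz, hn'⟩ := hn.restrict hX'
  obtain ⟨_, hk'⟩ := hk.restrict hX'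
  exact mem_iInter.1 hy ⟨(n, k), hnk⟩ (subset_closure ⟨_, hn', hk'⟩)

end FreePoints

/-! ### Free points: the ideal is killed by the orbit representations. -/

section Evaluation

variable {X : Type u} [TopologicalSpace X] [CompactSpace X] [T2Space X]
  {U : Opens X} {σ : U → X} {hσ : IsLocalHomeomorph σ}

open PreModule Toeplitz

/-- The norm of `c ∈ C(X)` modulo a closed ideal is at least `|c(x)|`, if the elements of `C(X)`
in the ideal vanish at `x`. -/
theorem norm_apply_le_of_norm_ofA_sub_le {J : TwoSidedIdeal (Toeplitz hσ)}
    (hJ : IsClosed (J : Set (Toeplitz hσ))) {c : C(X, ℂ)} {j : Toeplitz hσ} (hj : j ∈ J) {δ : ℝ}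
    (hδ : ‖ofA hσ c - j‖ ≤ δ) {x : X} (hx : ∀ a, ofA hσ a ∈ J → a x = 0) : ‖c x‖ ≤ δ := by
  by_contra! hlt
  obtain ⟨r, hr1, hr2⟩ := exists_between hlt
  have hδ0 : 0 ≤ δ := (norm_nonneg _).trans hδ
  have hr0 : 0 < r := hδ0.trans_lt hr1
  -- Take h = (|c| - r)₊, and for v an inverse of c on the set |c| ≥ r, of norm at most 1/r. Then h
  -- = (c v)ⁿ h is congruent modulo `J` to ((c - j) v)ⁿ h, whose norm tends to zero. Hence h ∈ J,
  -- which contradicts h(x) > 0.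
  let h : C(X, ℂ) := ⟨fun y => ((max 0 (‖c y‖ - r) : ℝ) : ℂ), by fun_prop⟩
  have hm : ∀ y, 0 < max ‖c y‖ r := fun y => lt_max_of_lt_right hr0
  let v : C(X, ℂ) := ⟨fun y => star (c y) / ((max ‖c y‖ r ^ 2 : ℝ) : ℂ), by
    refine Continuous.div (by fun_prop) (by fun_prop) fun y => ?_
    exact_mod_cast (pow_pos (hm y) 2).ne'⟩
  have hv : ‖v‖ ≤ 1 / r := by
    refine (ContinuousMap.norm_le _ (by positivity)).2 fun y => ?_
    change ‖star (c y) / ((max ‖c y‖ r ^ 2 : ℝ) : ℂ)‖ ≤ _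
    rw [norm_div, norm_star, Complex.norm_real, Real.norm_of_nonneg (by positivity),
      div_le_div_iff₀ (pow_pos (hm y) 2) hr0, one_mul, sq]
    exact mul_le_mul (le_max_left _ _) (le_max_right _ _) hr0.le (hm y).le
  have hcv : c * v * h = h := by
    ext y
    change c y * (star (c y) / ((max ‖c y‖ r ^ 2 : ℝ) : ℂ)) * ((max 0 (‖c y‖ - r) : ℝ) : ℂ) =
      ((max 0 (‖c y‖ - r) : ℝ) : ℂ)
    rcases le_total ‖c y‖ r with hy | hy
    · rw [max_eq_left (show ‖c y‖ - r ≤ 0 by linarith)]; simp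
    · have hy0 : (‖c y‖ : ℂ) ^ 2 ≠ 0 := by
        have : ‖c y‖ ≠ 0 := by linarith
        exact_mod_cast pow_ne_zero 2 this
      rw [max_eq_left hy, ← mul_div_assoc, Complex.star_def, Complex.mul_conj']
      push_cast
      rw [div_self hy0, one_mul]
  have key : ∀ n : ℕ, ∃ b, ‖b‖ ≤ (δ / r) ^ n * ‖h‖ ∧ ofA hσ h - b ∈ J := by
    intro n
    induction n with
    | zero => exact ⟨ofA hσ h, by simpa using norm_ofA_le h, by rw [sub_self]; exact J.zero_mem⟩
    | succ n ih =>
      obtain ⟨b, hb, hbJ⟩ := ih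
      refine ⟨(ofA hσ c - j) * (ofA hσ v * b), ?_, ?_⟩
      · calc _ ≤ δ * (1 / r * ((δ / r) ^ n * ‖h‖)) := by
              refine (norm_mul_le _ _).trans (mul_le_mul hδ ((norm_mul_le _ _).trans ?_)
                (norm_nonneg _) hδ0)
              exact mul_le_mul ((norm_ofA_le v).trans hv) hb (norm_nonneg _) (by positivity)
          _ = _ := by ring
      · have h1 : ofA hσ h - (ofA hσ c - j) * (ofA hσ v * b) =
            ofA hσ c * ofA hσ v * (ofA hσ h - b) + j * (ofA hσ v * b) := by
          nth_rw 1 [← hcv]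
          rw [ofA_mul, ofA_mul, mul_sub, sub_mul, mul_assoc (ofA hσ c) (ofA hσ v) b]
          abel
        rw [h1]
        exact J.add_mem (J.mul_mem_left _ _ hbJ) (J.mul_mem_right _ _ hj)
  have hhJ : ofA hσ h ∈ J := by
    refine mem_of_forall_exists_norm_sub_le hJ fun ε hε => ?_
    have hlim : Filter.Tendsto (fun n : ℕ => (δ / r) ^ n * ‖h‖) Filter.atTop (nhds (0 * ‖h‖)) :=
      (tendsto_pow_atTop_nhds_zero_of_lt_one (by positivity)
        ((div_lt_one hr0).2 hr1)).mul_const _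
    rw [zero_mul] at hlim
    obtain ⟨n, hn⟩ := (hlim.eventually_le_const hε).exists
    obtain ⟨b, hb, hbJ⟩ := key n
    exact ⟨_, hbJ, by rw [sub_sub_cancel]; exact hb.trans hn⟩
  have h1 := hx h hhJ
  change ((max 0 (‖c x‖ - r) : ℝ) : ℂ) = 0 at h1
  have h2 : max 0 (‖c x‖ - r) = 0 := by exact_mod_cast h1
  have := le_max_right 0 (‖c x‖ - r)
  linarith

variable {J : TwoSidedIdeal (Toeplitz hσ)} (hJ : IsClosed (J : Set (Toeplitz hσ)))
  (hRJ : (redundancyIdeal hσ).1 ≤ J)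

include hJ hRJ in
-- Approximate c by a polynomial p, and let h p h be congruent to a function a modulo redundancies.
-- Compressing by h does not change the diagonal entry at y, so that of p is a(y). As a is within
-- ε/2 of `J`, this value is small.
theorem orbitHom_basisVec_apply_eq_zero {Y : Set X} (hY : IsInvariant σ Y)
    (hYJ : ∀ a, ofA hσ a ∈ J → ∀ y ∈ Y, a y = 0)
    (hfree : ∀ y ∈ Y, ∀ n k : ℕ, n ≠ k → ¬ ∃ z, IterEq σ n y z ∧ IterEq σ k y z)
    (z : Circle) {c : Toeplitz hσ} (hc : c ∈ J) (y : Y) :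
    orbitHom hσ hY z c (basisVec y) y = 0 := by
  refine norm_le_zero_iff.1 (le_of_forall_pos_le_add fun ε hε => ?_)
  obtain ⟨p, hp, hcp⟩ := Metric.mem_closure_iff.1 (mem_closure_polynomials c) (ε / 2)
    (by positivity)
  rw [dist_eq_norm] at hcp
  obtain ⟨h, hh, a, ha⟩ := exists_localizes_of_mem_polynomials hp (hfree y y.2)
  have hcomp : ∀ b : Toeplitz hσ, ‖ofA hσ h * b * ofA hσ h‖ ≤ ‖b‖ := fun b => by
    have h1 : ‖ofA hσ h‖ ≤ 1 := (norm_ofA_le h).trans hh.1.norm_le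
    calc _ ≤ ‖ofA hσ h‖ * ‖b‖ * ‖ofA hσ h‖ :=
          (norm_mul_le _ _).trans (by gcongr; exact norm_mul_le _ _)
      _ ≤ 1 * ‖b‖ * 1 := by gcongr
      _ = ‖b‖ := by ring
  have hev : ∀ b : Toeplitz hσ, orbitHom hσ hY z (ofA hσ h * b * ofA hσ h) (basisVec y) y =
      orbitHom hσ hY z b (basisVec y) y := fun b => by
    rw [map_mul, map_mul, mul_apply_eq_comp, mul_apply_eq_comp, orbitHom_ofA_basisVec, hh.2,
      one_smul, orbitHom_ofA, hh.2, one_mul]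
  have hle : ∀ b : Toeplitz hσ, ‖orbitHom hσ hY z b (basisVec y) y‖ ≤ ‖b‖ := fun b => by
    refine (lp.norm_apply_le_norm (by norm_num) _ y).trans
      ((ContinuousLinearMap.le_opNorm _ _).trans ?_)
    rw [norm_basisVec, mul_one]
    exact NonUnitalStarAlgHom.norm_apply_le _ b
  have ha0 : ‖a y‖ ≤ ε / 2 := by
    refine norm_apply_le_of_norm_ofA_sub_le hJ (J.sub_mem (J.mul_mem_left (ofA hσ h) _
      (J.mul_mem_right _ (ofA hσ h) hc)) (hRJ ha)) ?_ fun b hb => hYJ b hb y y.2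
    have h1 : ofA hσ a - (ofA hσ h * (c * ofA hσ h) - (ofA hσ h * p * ofA hσ h - ofA hσ a)) =
        -(ofA hσ h * (c - p) * ofA hσ h) := by
      rw [mul_sub, sub_mul, ← mul_assoc]
      abel
    rw [h1, norm_neg]
    exact (hcomp _).trans hcp.le
  have hpa : orbitHom hσ hY z p (basisVec y) y = a y := by
    have h1 := orbitHom_eq_zero_of_mem_redundancyIdeal hY z ha
    rw [map_sub, sub_eq_zero] at h1
    rw [← hev, h1, orbitHom_ofA, basisVec_self, mul_one]
  have h2 : orbitHom hσ hY z c (basisVec y) y =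
      orbitHom hσ hY z (c - p) (basisVec y) y + a y := by
    rw [← hpa, map_sub]
    change _ = orbitHom hσ hY z c (basisVec y) y - orbitHom hσ hY z p (basisVec y) y + _
    ring
  rw [zero_add, h2]
  calc _ ≤ ε / 2 + ε / 2 := (norm_add_le _ _).trans
        (add_le_add ((hle _).trans hcp.le) ha0)
    _ = ε := by ring

include hJ hRJ in
/-- An ideal is killed by the orbit representation over a set of free points on which its
elements in `C(X)` vanish. -/
theorem orbitHom_eq_zero_of_mem {Y : Set X} (hY : IsInvariant σ Y)
    (hYJ : ∀ a, ofA hσ a ∈ J → ∀ y ∈ Y, a y = 0)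
    (hfree : ∀ y ∈ Y, ∀ n k : ℕ, n ≠ k → ¬ ∃ z, IterEq σ n y z ∧ IterEq σ k y z)
    (z : Circle) {b : Toeplitz hσ} (hb : b ∈ J) : orbitHom hσ hY z b = 0 := by
  refine ext_basisVec fun y => ?_
  -- The diagonal entry of b⋆b at y is the squared norm of the image of δ_y under b.
  have h1 := orbitHom_basisVec_apply_eq_zero hJ hRJ hY hYJ hfree z
    (J.mul_mem_left (star b) _ hb) y
  rw [← inner_basisVec, map_mul, map_star, mul_apply_eq_comp, ContinuousLinearMap.star_eq_adjoint,
    ContinuousLinearMap.adjoint_inner_right, inner_self_eq_zero] at h1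
  rw [h1]; rfl

end Evaluation

/-! ### The degree zero part. -/

section Core

variable {X : Type u} [TopologicalSpace X] [CompactSpace X] [T2Space X]
  {U : Opens X} {σ : U → X} {hσ : IsLocalHomeomorph σ}

open PreModule Toeplitz

/-- The representation on ℓ²(X) detects every value of a. As a consequence C(X) is closed in the
Toeplitz algebra. -/
theorem norm_ofA (a : C(X, ℂ)) : ‖ofA hσ a‖ = ‖a‖ := by
  refine le_antisymm (norm_ofA_le a) ((ContinuousMap.norm_le _ (norm_nonneg _)).2 fun x => ?_)
  have hY : IsInvariant σ univ := ⟨subset_univ _, subset_univ _⟩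
  have h1 := orbitHom_ofA (hσ := hσ) hY 1 a (basisVec ⟨x, mem_univ x⟩) ⟨x, mem_univ x⟩
  rw [basisVec_self, mul_one] at h1
  rw [← h1]
  refine (lp.norm_apply_le_norm (by norm_num) _ _).trans
    ((ContinuousLinearMap.le_opNorm _ _).trans ?_)
  rw [norm_basisVec, mul_one]
  exact NonUnitalStarAlgHom.norm_apply_le _ _

theorem isClosed_range_ofA : IsClosed (range (ofA hσ)) :=
  (AddMonoidHomClass.isometry_of_norm (ofAHom hσ) norm_ofA).isClosedEmbedding.isClosed_range

theorem span_subset_range_ofA {s : Set (Toeplitz hσ)} (hs : s ⊆ range (ofA hσ)) :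
    (Submodule.span ℂ s : Set (Toeplitz hσ)) ⊆ range (ofA hσ) := by
  intro b hb
  rw [SetLike.mem_coe] at hb
  induction hb using Submodule.span_induction with
  | mem b hb => exact hs hb
  | zero => exact ⟨0, ofA_zero⟩
  | add b c _ _ hb hc =>
    obtain ⟨a, rfl⟩ := hb
    obtain ⟨a', rfl⟩ := hc
    exact ⟨_, ofA_add a a'⟩
  | smul c b _ hb =>
    obtain ⟨a, rfl⟩ := hb
    exact ⟨_, ofA_smul c a⟩

/-- Words of length `N` on both sides cancel every monomial of level at most `N`, leaving a
function. -/
theorem star_mul_mul_mem_range_ofA {N : ℕ} {v w : Toeplitz hσ} (hv : v ∈ words hσ N)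
    (hw : w ∈ words hσ N) {c : Toeplitz hσ}
    (hc : c ∈ closure (coreLevel hσ N : Set (Toeplitz hσ))) :
    star v * c * w ∈ range (ofA hσ) := by
  have h1 : ∀ c ∈ coreLevel hσ N, star v * c * w ∈ range (ofA hσ) := by
    intro c hc
    change c ∈ Submodule.span ℂ _ at hc
    have h2 : star v * c * w ∈ Submodule.span ℂ (range (ofA hσ)) := by
      induction hc using Submodule.span_induction with
      | mem b hb =>
        obtain ⟨n, hn, v', hv', w', hw', rfl⟩ := hb
        obtain ⟨j, rfl⟩ := Nat.exists_eq_add_of_le hn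
        have h3 := star_mul_mem_words hv' hv
        have h4 := star_mul_mem_words hw' hw
        have h5 := star_mul_mem_words h3 (j := 0) h4
        refine Submodule.subset_span ?_
        rw [star_mul, star_star] at h5
        simpa only [mul_assoc] using! h5
      | zero => rw [mul_zero, zero_mul]; exact zero_mem _
      | add b c _ _ hb hc => rw [mul_add, add_mul]; exact add_mem hb hc
      | smul c b _ hb => rw [mul_smul_comm, smul_mul_assoc]; exact Submodule.smul_mem _ _ hb
    exact span_subset_range_ofA subset_rfl h2
  exact closure_minimal (t := {c | star v * c * w ∈ range (ofA hσ)}) h1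
    (isClosed_range_ofA.preimage (by fun_prop)) hc

variable {Y : Set X} (hY : IsInvariant σ Y) {J : TwoSidedIdeal (Toeplitz hσ)}
  (hJ : IsClosed (J : Set (Toeplitz hσ))) (hRJ : (redundancyIdeal hσ).1 ≤ J)
  (hYJ : ∀ a : C(X, ℂ), (∀ y ∈ Y, a y = 0) → ofA hσ a ∈ J)

include hYJ in
theorem mem_of_mem_range_ofA {c : Toeplitz hσ} (hc : c ∈ range (ofA hσ))
    (hc0 : orbitHom hσ hY 1 c = 0) : c ∈ J := by
  obtain ⟨a, rfl⟩ := hc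
  exact hYJ a ((orbitHom_ofA_eq_zero_iff hY 1 a).1 hc0)

include hJ hYJ in
-- The element w⋆cc⋆w is a function killed by the representation, hence in `J`. The C⋆-property then
-- puts c⋆w and its adjoint in `J`.
theorem star_word_mul_mem {N : ℕ} {c : Toeplitz hσ}
    (hc : c ∈ closure (coreLevel hσ N : Set (Toeplitz hσ))) (hc0 : orbitHom hσ hY 1 c = 0)
    {w : Toeplitz hσ} (hw : w ∈ words hσ N) : star w * c ∈ J := by
  have h1 : c * star c ∈ (coreLevel hσ N).topologicalClosure := mul_mem hc (star_mem hc)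
  have h2 := mem_of_mem_range_ofA hY hYJ (star_mul_mul_mem_range_ofA hw hw h1) (by
    rw [map_mul, map_mul, map_mul, hc0, zero_mul, mul_zero, zero_mul])
  have h3 : star c * w ∈ J := TwoSidedIdeal.mem_of_star_mul_self_mem hJ (by
    rw [star_mul, star_star]
    simpa only [mul_assoc] using h2)
  have h4 := TwoSidedIdeal.star_mem_of_isClosed hJ h3
  rwa [star_mul, star_star] at h4

include hJ hRJ hYJ in
theorem ofA_mul_mem_of_mem_spannedByWords {N : ℕ} {c : Toeplitz hσ}
    (hc : c ∈ closure (coreLevel hσ N : Set (Toeplitz hσ))) (hc0 : orbitHom hσ hY 1 c = 0)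
    {h : C(X, ℂ)} (hh : h ∈ spannedByWords hσ N) : ofA hσ h * c ∈ J := by
  obtain ⟨k, hk, hhk⟩ := hh
  have h1 : k * c ∈ J := by
    clear hhk
    induction hk using Submodule.span_induction with
    | mem b hb =>
      obtain ⟨v, hv, w, hw, rfl⟩ := hb
      rw [mul_assoc]
      exact J.mul_mem_left _ _ (star_word_mul_mem hY hJ hYJ hc hc0 hw)
    | zero => rw [zero_mul]; exact J.zero_mem
    | add b c _ _ hb hc => rw [add_mul]; exact J.add_mem hb hc
    | smul c b _ hb => rw [smul_mul_assoc]; exact TwoSidedIdeal.smul_mem_of_isClosed hJ _ hb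
  have h2 := J.add_mem (J.mul_mem_right _ c (hRJ hhk)) h1
  rwa [sub_mul, sub_add_cancel] at h2

theorem exists_add_of_mem_coreLevel_succ {N : ℕ} {c : Toeplitz hσ}
    (hc : c ∈ coreLevel hσ (N + 1)) : ∃ c₀ ∈ coreLevel hσ N,
      ∃ k ∈ Submodule.span ℂ (monomials hσ (N + 1) (N + 1)), c = c₀ + k := by
  change c ∈ Submodule.span ℂ _ at hc
  have h : {b | ∃ n ≤ N + 1, b ∈ monomials hσ n n} ⊆
      {b | ∃ n ≤ N, b ∈ monomials hσ n n} ∪ monomials hσ (N + 1) (N + 1) := by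
    rintro b ⟨n, hn, hb⟩
    rcases hn.lt_or_eq with hn | rfl
    · exact Or.inl ⟨n, by omega, hb⟩
    · exact Or.inr hb
  have h1 := Submodule.span_mono h hc
  rw [Submodule.span_union, Submodule.mem_sup] at h1
  obtain ⟨x, hx, y, hy, rfl⟩ := h1
  exact ⟨x, hx, y, hy, rfl⟩

include hJ hRJ hYJ in
/-- The elements of a level of the core which are killed by the orbit representations over `Y`
belong to every closed ideal which contains the redundancies and the functions vanishing on `Y`. -/
theorem mem_of_mem_closure_coreLevel (N : ℕ) {c : Toeplitz hσ}
    (hc : c ∈ closure (coreLevel hσ N : Set (Toeplitz hσ)))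
    (hc0 : ∀ z, orbitHom hσ hY z c = 0) : c ∈ J := by
  induction N generalizing c with
  | zero =>
    refine mem_of_mem_range_ofA hY hYJ ?_ (hc0 1)
    refine closure_minimal (span_subset_range_ofA ?_) isClosed_range_ofA hc
    rintro _ ⟨n, hn, v, hv, w, hw, rfl⟩
    obtain rfl : n = 0 := Nat.le_zero.1 hn
    obtain ⟨a, rfl⟩ := hv
    obtain ⟨b, rfl⟩ := hw
    exact ⟨a * star b, by rw [ofA_mul, ofA_star]⟩
  | succ N ih =>
    refine mem_of_forall_exists_norm_sub_le hJ fun ε hε => ?_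
    obtain ⟨c', hc', hcc'⟩ := Metric.mem_closure_iff.1 hc (ε / 2) (by positivity)
    rw [dist_eq_norm] at hcc'
    obtain ⟨c₀, hc₀, k, hk, rfl⟩ := exists_add_of_mem_coreLevel_succ hc'
    -- With g = 1 - h we have g k = 0. As h c and c h lie in `J`, c is congruent to g c g, which is
    -- within ε/2 of g c₀ g, an element of level `N`. The latter is nearly killed by the
    -- representations, so by induction it is within ε/2 of `J`.
    obtain ⟨h, hh, hu, hhk⟩ := exists_unit_of_mem_span hk
    have hcs : star c ∈ (coreLevel hσ (N + 1)).topologicalClosure :=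
      star_mem (S := NonUnitalStarSubalgebra ℂ (Toeplitz hσ)) hc
    have h1 : ofA hσ h * c ∈ J :=
      ofA_mul_mem_of_mem_spannedByWords hY hJ hRJ hYJ hc (hc0 1) hh
    have h2 : c * ofA hσ h ∈ J := by
      have h3 := TwoSidedIdeal.star_mem_of_isClosed hJ
        (ofA_mul_mem_of_mem_spannedByWords hY hJ hRJ hYJ hcs (by rw [map_star, hc0, star_zero]) hh)
      rwa [star_mul, star_star, ← ofA_star, hu.star_eq] at h3
    set g := ofA hσ (1 - h) with hg
    have hgn : ‖g‖ ≤ 1 := (norm_ofA_le _).trans hu.one_sub.norm_le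
    have h3 : c - g * c * g ∈ J := by
      have h4 : c - g * c * g = ofA hσ h * c + g * (c * ofA hσ h) := by
        simp only [hg, ofA_sub, sub_mul, mul_sub, mul_assoc, (ofA_one_mul _).1, (ofA_one_mul _).2]
        abel
      rw [h4]
      exact J.add_mem h1 (J.mul_mem_left _ _ h2)
    have h5 : g * c * g - g * c₀ * g = g * (c - (c₀ + k)) * g := by
      simp only [mul_sub, mul_add, sub_mul, add_mul, hhk, zero_mul]
      abel
    have h6 : ‖g * c * g - g * c₀ * g‖ ≤ ε / 2 := by
      rw [h5]
      calc _ ≤ ‖g‖ * ‖c - (c₀ + k)‖ * ‖g‖ :=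
            (norm_mul_le _ _).trans (by gcongr; exact norm_mul_le _ _)
        _ ≤ 1 * (ε / 2) * 1 := by gcongr
        _ = ε / 2 := by ring
    have h7 : g * c₀ * g ∈ (coreLevel hσ N).topologicalClosure :=
      subset_closure (mul_mem (mul_mem (ofA_mem_coreLevel _ N) hc₀) (ofA_mem_coreLevel _ N))
    obtain ⟨j, hj, hj'⟩ := exists_mem_norm_sub_le_of_forall_norm_le
      (coreLevel hσ N).topologicalClosure (NonUnitalStarSubalgebra.isClosed_topologicalClosure _)
      (fun z => orbitHom hσ hY z) (fun s hs hs0 => ih hs hs0) h7 (ε := ε / 2) (by positivity)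
      fun z => by
        have h8 : orbitHom hσ hY z (g * c₀ * g) =
            -orbitHom hσ hY z (g * c * g - g * c₀ * g) := by
          have h9 : orbitHom hσ hY z (g * c * g) = 0 := by
            rw [map_mul, map_mul, hc0, mul_zero, zero_mul]
          rw [map_sub, h9, zero_sub, neg_neg]
        rw [h8, norm_neg]
        exact (NonUnitalStarAlgHom.norm_apply_le _ _).trans h6
    refine ⟨_, J.add_mem h3 hj, ?_⟩
    have h9 : c - (c - g * c * g + j) = (g * c * g - g * c₀ * g) + (g * c₀ * g - j) := by abel
    rw [h9]
    calc _ ≤ ε / 2 + ε / 2 := (norm_add_le _ _).trans (add_le_add h6 hj')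
      _ = ε := by ring

include hJ hRJ hYJ in
theorem mem_of_mem_closure_iUnion_coreLevel {c : Toeplitz hσ}
    (hc : c ∈ closure (⋃ N, (coreLevel hσ N : Set (Toeplitz hσ))))
    (hc0 : ∀ z, orbitHom hσ hY z c = 0) : c ∈ J := by
  refine mem_of_forall_exists_norm_sub_le hJ fun ε hε => ?_
  obtain ⟨c', hc', hcc'⟩ := Metric.mem_closure_iff.1 hc (ε / 2) (by positivity)
  rw [dist_eq_norm] at hcc'
  obtain ⟨N, hN⟩ := mem_iUnion.1 hc'
  obtain ⟨j, hj, hj'⟩ := exists_mem_norm_sub_le_of_forall_norm_le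
    (coreLevel hσ N).topologicalClosure (NonUnitalStarSubalgebra.isClosed_topologicalClosure _)
    (fun z => orbitHom hσ hY z)
    (fun s hs hs0 => mem_of_mem_closure_coreLevel hY hJ hRJ hYJ N hs hs0)
    (subset_closure hN) (ε := ε / 2) (by positivity) fun z => by
      have h8 : orbitHom hσ hY z c' = -orbitHom hσ hY z (c - c') := by
        rw [map_sub, hc0, zero_sub, neg_neg]
      rw [h8, norm_neg]
      exact (NonUnitalStarAlgHom.norm_apply_le _ _).trans hcc'.le
  refine ⟨j, hj, ?_⟩
  calc _ = ‖(c - c') + (c' - j)‖ := by rw [sub_add_sub_cancel]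
    _ ≤ ε / 2 + ε / 2 := (norm_add_le _ _).trans (add_le_add hcc'.le hj')
    _ = ε := by ring

end Core

/-! ### Fourier decomposition for the gauge action. -/

section SpectralSubspaces

variable {X : Type u} [TopologicalSpace X] [CompactSpace X] [T2Space X]
  {U : Opens X} {σ : U → X} {hσ : IsLocalHomeomorph σ}

open PreModule Toeplitz MeasureTheory

theorem continuous_gauge_toCircle (b : Toeplitz hσ) :
    Continuous fun t : UnitAddCircle => gauge hσ t.toCircle b :=
  (continuous_gauge b).comp AddCircle.continuous_toCircle

theorem integrable_fourier_smul_gauge (b : Toeplitz hσ) (d : ℤ) :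
    Integrable (fun t : UnitAddCircle => fourier d t • gauge hσ t.toCircle b)
      AddCircle.haarAddCircle :=
  ((fourier d).continuous.smul (continuous_gauge_toCircle b)).integrable_of_hasCompactSupport
    (HasCompactSupport.of_compactSpace _)

/-- The component of degree `d` of an element of the Toeplitz algebra, for the gauge action. -/
def gaugeCoeff (d : ℤ) (b : Toeplitz hσ) : Toeplitz hσ :=
  fourierCoeff (fun t : UnitAddCircle => gauge hσ t.toCircle b) d

theorem gaugeCoeff_add (d : ℤ) (b c : Toeplitz hσ) :
    gaugeCoeff d (b + c) = gaugeCoeff d b + gaugeCoeff d c := by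
  simp only [gaugeCoeff, fourierCoeff, map_add, smul_add]
  exact integral_add (integrable_fourier_smul_gauge b _) (integrable_fourier_smul_gauge c _)

theorem gaugeCoeff_smul (d : ℤ) (z : ℂ) (b : Toeplitz hσ) :
    gaugeCoeff d (z • b) = z • gaugeCoeff d b := by
  simp only [gaugeCoeff, map_smul]
  exact fourierCoeff.const_smul _ z d

theorem norm_gaugeCoeff_le (d : ℤ) (b : Toeplitz hσ) : ‖gaugeCoeff d b‖ ≤ ‖b‖ := by
  refine (norm_integral_le_of_norm_le_const (C := ‖b‖) (.of_forall fun t => ?_)).trans ?_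
  · rw [norm_smul, fourier_apply, Circle.norm_coe, one_mul]
    exact norm_gauge_le _ b
  · simp

theorem gaugeCoeff_of_mem_monomials (d : ℤ) {n k : ℕ} {b : Toeplitz hσ}
    (hb : b ∈ monomials hσ n k) :
    gaugeCoeff d b = (Pi.single ((n : ℤ) - k) (1 : ℂ) : ℤ → ℂ) d • b := by
  have h1 : ∀ t : UnitAddCircle, gauge hσ t.toCircle b = fourier ((n : ℤ) - k) t • b := fun t => by
    rw [gauge_of_mem_monomials _ hb, fourier_apply, AddCircle.toCircle_zsmul]
  rw [← fourierCoeff_fourier (T := 1), gaugeCoeff, fourierCoeff, fourierCoeff,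
    ← integral_smul_const]
  congr 1
  funext t
  rw [h1, smul_assoc]

variable (hσ) in
/-- The span of the monomials of degree `d`. -/
def degreeSpan (d : ℤ) : Submodule ℂ (Toeplitz hσ) :=
  Submodule.span ℂ {b | ∃ n k : ℕ, (n : ℤ) - k = d ∧ b ∈ monomials hσ n k}

theorem gaugeCoeff_mem_degreeSpan (d : ℤ) {b : Toeplitz hσ} (hb : b ∈ polynomials hσ) :
    gaugeCoeff d b ∈ degreeSpan hσ d := by
  change b ∈ Submodule.span ℂ _ at hb
  induction hb using Submodule.span_induction with
  | mem b hb =>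
    obtain ⟨n, k, hb⟩ := hb
    rw [gaugeCoeff_of_mem_monomials d hb]
    by_cases h : (n : ℤ) - k = d
    · exact Submodule.smul_mem _ _ (Submodule.subset_span ⟨n, k, h, hb⟩)
    · rw [Pi.single_eq_of_ne (Ne.symm h), zero_smul]
      exact zero_mem _
  | zero =>
    have : gaugeCoeff d (0 : Toeplitz hσ) = 0 := by
      simpa using gaugeCoeff_smul d 0 (0 : Toeplitz hσ)
    rw [this]
    exact zero_mem _
  | add b c _ _ hb hc => rw [gaugeCoeff_add]; exact add_mem hb hc
  | smul z b _ hb => rw [gaugeCoeff_smul]; exact Submodule.smul_mem _ _ hb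

theorem gaugeCoeff_mem_closure_degreeSpan (d : ℤ) (b : Toeplitz hσ) :
    gaugeCoeff d b ∈ closure (degreeSpan hσ d : Set (Toeplitz hσ)) := by
  refine Metric.mem_closure_iff.2 fun ε hε => ?_
  obtain ⟨p, hp, hbp⟩ := Metric.mem_closure_iff.1 (mem_closure_polynomials b) ε hε
  refine ⟨_, gaugeCoeff_mem_degreeSpan d hp, ?_⟩
  have h : gaugeCoeff d b - gaugeCoeff d p = gaugeCoeff d (b - p) := by
    rw [sub_eq_iff_eq_add, ← gaugeCoeff_add, sub_add_cancel]
  rw [dist_eq_norm] at hbp ⊢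
  rw [h]
  exact (norm_gaugeCoeff_le d _).trans_lt hbp

/-- Equal degrees cancel in b⋆c, so the products of monomials have words of equal length on both
sides. -/
theorem star_mul_mem_iUnion_coreLevel {d : ℤ} {b c : Toeplitz hσ} (hb : b ∈ degreeSpan hσ d)
    (hc : c ∈ degreeSpan hσ d) : ∃ N, star b * c ∈ coreLevel hσ N := by
  induction hb using Submodule.span_induction with
  | mem b hb =>
    obtain ⟨n, k, hnk, hb⟩ := hb
    induction hc using Submodule.span_induction with
    | mem c hc =>
      obtain ⟨m, l, hml, hc⟩ := hc
      have h := mul_mem_monomials (star_mem_monomials hb) hc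
      rw [show l + (n - m) = k + (m - n) by omega] at h
      exact ⟨_, monomials_subset_coreLevel le_rfl h⟩
    | zero => exact ⟨0, by rw [mul_zero]; exact zero_mem _⟩
    | add c c' _ _ hc hc' =>
      obtain ⟨N, hN⟩ := hc
      obtain ⟨M, hM⟩ := hc'
      refine ⟨max N M, ?_⟩
      rw [mul_add]
      exact add_mem (coreLevel_mono (le_max_left N M) hN) (coreLevel_mono (le_max_right N M) hM)
    | smul z c _ hc =>
      obtain ⟨N, hN⟩ := hc
      exact ⟨N, by rw [mul_smul_comm]; exact SMulMemClass.smul_mem z hN⟩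
  | zero => exact ⟨0, by rw [star_zero, zero_mul]; exact zero_mem _⟩
  | add b b' _ _ hb hb' =>
    obtain ⟨N, hN⟩ := hb
    obtain ⟨M, hM⟩ := hb'
    refine ⟨max N M, ?_⟩
    rw [star_add, add_mul]
    exact add_mem (coreLevel_mono (le_max_left N M) hN) (coreLevel_mono (le_max_right N M) hM)
  | smul z b _ hb =>
    obtain ⟨N, hN⟩ := hb
    exact ⟨N, by rw [star_smul, smul_mul_assoc]; exact SMulMemClass.smul_mem _ hN⟩

theorem star_gaugeCoeff_mul_gaugeCoeff_mem (d : ℤ) (b : Toeplitz hσ) :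
    star (gaugeCoeff d b) * gaugeCoeff d b ∈
      closure (⋃ N, (coreLevel hσ N : Set (Toeplitz hσ))) :=
  map_mem_closure₂ (f := fun x y : Toeplitz hσ => star x * y) (by fun_prop)
    (gaugeCoeff_mem_closure_degreeSpan d b) (gaugeCoeff_mem_closure_degreeSpan d b)
    fun _ hx _ hy => mem_iUnion.2 (star_mul_mem_iUnion_coreLevel hx hy)

/-- An element all of whose components for the gauge action belong to a closed ideal belongs to
this ideal. -/
theorem mem_of_forall_gaugeCoeff_mem {J : TwoSidedIdeal (Toeplitz hσ)}
    (hJ : IsClosed (J : Set (Toeplitz hσ))) {b : Toeplitz hσ} (hb : ∀ d, gaugeCoeff d b ∈ J) :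
    b ∈ J := by
  by_contra hbJ
  let S : Submodule ℂ (Toeplitz hσ) := TwoSidedIdeal.toClosedSubmodule J hJ
  have hS : IsClosed (S : Set (Toeplitz hσ)) := hJ
  have hne : S.mkQ b ≠ 0 := fun h => hbJ ((Submodule.Quotient.mk_eq_zero S).1 h)
  -- Hahn–Banach gives a functional φ which vanishes on `J` but not at b. The continuous function t
  -- ↦ φ(γ_t b) has Fourier coefficients φ(b_d) = 0, so it is the sum of its zero Fourier series; at
  -- t = 0 this gives φ(b) = 0.
  obtain ⟨g, hg⟩ := SeparatingDual.exists_ne_zero (R := ℂ) hne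
  let φ : Toeplitz hσ →L[ℂ] ℂ := g.comp (S.mkQL)
  have hφJ : ∀ c ∈ J, φ c = 0 := fun c hc => by
    have : S.mkQL c = 0 := (Submodule.Quotient.mk_eq_zero S).2 hc
    change g (S.mkQL c) = 0
    rw [this, map_zero]
  let F : C(UnitAddCircle, ℂ) :=
    ⟨fun t => φ (gauge hσ t.toCircle b), φ.continuous.comp (continuous_gauge_toCircle b)⟩
  have hF : fourierCoeff F = 0 := by
    funext d
    have h1 : fourierCoeff F d = φ (gaugeCoeff d b) := by
      rw [gaugeCoeff, fourierCoeff, fourierCoeff,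
        ← φ.integral_comp_comm (integrable_fourier_smul_gauge b (-d))]
      congr 1
      funext t
      rw [map_smul]
      rfl
    rw [h1, hφJ _ (hb d), Pi.zero_apply]
  have h2 := has_pointwise_sum_fourier_series_of_summable (f := F)
    (by rw [hF]; exact summable_zero) 0
  have h3 : F 0 = φ b := by
    change φ (gauge hσ (AddCircle.toCircle 0) b) = _
    rw [AddCircle.toCircle_zero, gauge_one]
  rw [hF, h3] at h2
  simp only [Pi.zero_apply, zero_smul] at h2
  exact hg (h2.unique hasSum_zero)

/-- The gauge action only moves the parameter `z`, so the common kernel over all `z` is gauge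
invariant and the integrand vanishes. -/
theorem orbitHom_gaugeCoeff {Y : Set X} (hY : IsInvariant σ Y) (d : ℤ) {b : Toeplitz hσ}
    (hb : ∀ z, orbitHom hσ hY z b = 0) (z : Circle) : orbitHom hσ hY z (gaugeCoeff d b) = 0 := by
  let ρ : Toeplitz hσ →L[ℂ] (Ell2 Y →L[ℂ] Ell2 Y) :=
    { toLinearMap := (orbitHom hσ hY z : Toeplitz hσ →ₗ[ℂ] (Ell2 Y →L[ℂ] Ell2 Y))
      cont := continuous_starHom (orbitHom hσ hY z) }
  change ρ (gaugeCoeff d b) = 0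
  rw [gaugeCoeff, fourierCoeff, ← ρ.integral_comp_comm (integrable_fourier_smul_gauge b (-d))]
  refine (integral_congr_ae (.of_forall fun t => ?_)).trans (integral_zero _ _)
  change ρ (fourier (-d) t • gauge hσ t.toCircle b) = 0
  rw [map_smul]
  change fourier (-d) t • orbitHom hσ hY z (gauge hσ t.toCircle b) = 0
  rw [orbitHom_gauge, hb, smul_zero]

/-- The gauge-invariant uniqueness theorem: an element killed by all the orbit representations
over `Y` belongs to every closed ideal which contains the redundancies and the functions vanishing
on `Y`. -/
theorem mem_of_forall_orbitHom_eq_zero {Y : Set X} (hY : IsInvariant σ Y)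
    {J : TwoSidedIdeal (Toeplitz hσ)} (hJ : IsClosed (J : Set (Toeplitz hσ)))
    (hRJ : (redundancyIdeal hσ).1 ≤ J)
    (hYJ : ∀ a : C(X, ℂ), (∀ y ∈ Y, a y = 0) → ofA hσ a ∈ J) {b : Toeplitz hσ}
    (hb : ∀ z, orbitHom hσ hY z b = 0) : b ∈ J :=
  mem_of_forall_gaugeCoeff_mem hJ fun d => TwoSidedIdeal.mem_of_star_mul_self_mem hJ <|
    mem_of_mem_closure_iUnion_coreLevel hY hJ hRJ hYJ (star_gaugeCoeff_mul_gaugeCoeff_mem d b)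
      fun z => by rw [map_mul, orbitHom_gaugeCoeff hY d hb, mul_zero]

end SpectralSubspaces

/-! ### The zero set of an ideal. -/

section InvariantSets

variable {X : Type u}

theorem IsInvariant.compl {W : Set X} {σ : W → X} {V : Set X} (hV : IsInvariant σ V) :
    IsInvariant σ Vᶜ := by
  constructor
  · rintro _ ⟨x, hx, rfl⟩ h
    exact hx (hV.2 ⟨x, h, rfl⟩)
  · rintro _ ⟨x, hx, rfl⟩ h
    exact hx (hV.1 ⟨x, h, rfl⟩)

variable [TopologicalSpace X] [CompactSpace X] [T2Space X]
  {U : Opens X} {σ : U → X} {hσ : IsLocalHomeomorph σ}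

open PreModule Toeplitz

/-- The common zeros of the elements of `C(X)` in an ideal of the Toeplitz algebra. -/
def zeroSet (J : TwoSidedIdeal (Toeplitz hσ)) : Set X := {x | ∀ a, ofA hσ a ∈ J → a x = 0}

/-- Conjugate a ∈ J by a bump f at x. Modulo redundancies t(f) a t(f)⋆ is a function with value
a(σ(x)) at x, which gives the forward direction; t(f)⋆ a t(f) = ⟨f, a f⟩ has value a(x) at σ(x),
which gives the backward one. -/
theorem isInvariant_zeroSet {J : TwoSidedIdeal (Toeplitz hσ)}
    (hRJ : (redundancyIdeal hσ).1 ≤ J) : IsInvariant σ (zeroSet J) := by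
  constructor
  · rintro _ ⟨x, hx, rfl⟩ a ha
    obtain ⟨f, -, h1, -, h3⟩ := exists_bump hσ x Filter.univ_mem
    have h4 : JointlyInjective σ (a • f).fn f.fn := fun y z hyz hy hz => by
      rw [fn_right_smul] at hy
      exact h3 y z hyz (left_ne_zero_of_mul hy) hz
    have h5 := hRJ (ofA_sub_mem_redundancyIdeal h4)
    rw [← ofF_mul_ofA] at h5
    have h6 := J.add_mem h5 (J.mul_mem_right _ (star (ofF hσ f)) (J.mul_mem_left (ofF hσ f) _ ha))
    rw [sub_add_cancel] at h6
    have h7 := hx _ h6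
    rwa [ContinuousMap.mul_apply, fn_right_smul, ContinuousMap.star_apply, h1, star_one, mul_one,
      one_mul] at h7
  · rintro _ ⟨x, hx, rfl⟩ a ha
    obtain ⟨f, hf⟩ := exists_isBumpAt hσ x
    have h1 := J.mul_mem_left (star (ofF hσ f)) _ (J.mul_mem_right _ (ofF hσ f) ha)
    rw [ofA_mul_ofF, star_ofF_mul_ofF] at h1
    have h2 := hx _ h1
    rwa [hf.inner_eq, fn_leftMul, ContinuousMap.mul_apply, hf.apply_eq, mul_one] at h2

theorem isClosed_zeroSet (J : TwoSidedIdeal (Toeplitz hσ)) : IsClosed (zeroSet J) := by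
  have : zeroSet J = ⋂ (a) (_ : ofA hσ a ∈ J), {x | a x = 0} := by
    ext x
    simp [zeroSet]
  rw [this]
  exact isClosed_biInter fun a _ => isClosed_eq a.continuous continuous_const

/-- A closed ideal is determined by its intersection with `C(X)`, if the dynamical system on the
corresponding closed invariant set is topologically free. -/
theorem le_of_forall_ofA_mem {J J₀ : TwoSidedIdeal (Toeplitz hσ)}
    (hJ : IsClosed (J : Set (Toeplitz hσ))) (hJ₀ : IsClosed (J₀ : Set (Toeplitz hσ)))
    (hRJ : (redundancyIdeal hσ).1 ≤ J) (hRJ₀ : (redundancyIdeal hσ).1 ≤ J₀)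
    (hA : ∀ a : C(X, ℂ), (∀ x ∈ zeroSet J, a x = 0) → ofA hσ a ∈ J₀)
    (hfree : TopologicallyFree (restrict σ (isInvariant_zeroSet hRJ))) : J ≤ J₀ := by
  intro b hb
  have hY := isInvariant_freePoints (isInvariant_zeroSet hRJ)
  refine mem_of_forall_orbitHom_eq_zero hY hJ₀ hRJ₀ (fun a ha => hA a fun x hx => ?_) fun z =>
    orbitHom_eq_zero_of_mem hJ hRJ hY (fun a ha y hy => hy.1 a ha) (fun y hy => hy.2) z hb
  -- A function vanishing on the free points vanishes on `zeroSet J`, by density.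
  exact closure_minimal (t := {x | a x = 0}) ha (isClosed_eq a.continuous continuous_const)
    (subset_closure_freePoints (isInvariant_zeroSet hRJ) (isClosed_zeroSet J) hfree hx)

end InvariantSets

/-! ### Passage to the crossed product. -/

section CrossedProductIdeals

variable {X : Type u} [TopologicalSpace X] [CompactSpace X] [T2Space X]
  {U : Opens X} {σ : U → X} {hσ : IsLocalHomeomorph σ}

open PreModule Toeplitz

theorem CrossedProduct.mk_eq_mk_iff {b c : Toeplitz hσ} :
    CrossedProduct.mk hσ b = CrossedProduct.mk hσ c ↔ b - c ∈ (redundancyIdeal hσ).1 :=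
  (RingCon.eq _).trans (TwoSidedIdeal.rel_iff _ _ _)

theorem CrossedProduct.mk_surjective : Function.Surjective (CrossedProduct.mk hσ) :=
  Quotient.mk_surjective

theorem CrossedProduct.continuous_mk : Continuous (CrossedProduct.mk hσ) :=
  continuous_coinduced_rng

/-- The preimage in the Toeplitz algebra of an ideal of the crossed product. -/
def toeplitzPreimage (I : TwoSidedIdeal (CrossedProduct hσ)) : TwoSidedIdeal (Toeplitz hσ) :=
  TwoSidedIdeal.mk' (CrossedProduct.mk hσ ⁻¹' I) I.zero_mem (fun hx hy => I.add_mem hx hy)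
    (fun hx => I.neg_mem hx) (fun {x _} hy => I.mul_mem_left (CrossedProduct.mk hσ x) _ hy)
    (fun {_ y} hx => I.mul_mem_right _ (CrossedProduct.mk hσ y) hx)

theorem mem_toeplitzPreimage {I : TwoSidedIdeal (CrossedProduct hσ)} {b : Toeplitz hσ} :
    b ∈ toeplitzPreimage I ↔ CrossedProduct.mk hσ b ∈ I :=
  TwoSidedIdeal.mem_mk' _ _ _ _ _ _ b

theorem isClosed_toeplitzPreimage {I : TwoSidedIdeal (CrossedProduct hσ)}
    (hI : IsClosed (I : Set (CrossedProduct hσ))) :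
    IsClosed (toeplitzPreimage I : Set (Toeplitz hσ)) := by
  have : (toeplitzPreimage I : Set (Toeplitz hσ)) = CrossedProduct.mk hσ ⁻¹' I :=
    Set.ext fun _ => mem_toeplitzPreimage
  rw [this]
  exact hI.preimage CrossedProduct.continuous_mk

theorem redundancyIdeal_le_toeplitzPreimage (I : TwoSidedIdeal (CrossedProduct hσ)) :
    (redundancyIdeal hσ).1 ≤ toeplitzPreimage I := by
  intro b hb
  have h : CrossedProduct.mk hσ b = CrossedProduct.mk hσ 0 :=
    CrossedProduct.mk_eq_mk_iff.2 (by rwa [sub_zero])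
  rw [mem_toeplitzPreimage, h]
  exact I.zero_mem

/-- The image in the crossed product of an ideal of the Toeplitz algebra. -/
def crossedProductImage (J : TwoSidedIdeal (Toeplitz hσ)) : TwoSidedIdeal (CrossedProduct hσ) :=
  TwoSidedIdeal.mk' (CrossedProduct.mk hσ '' J) ⟨0, J.zero_mem, rfl⟩
    (by rintro _ _ ⟨x, hx, rfl⟩ ⟨y, hy, rfl⟩; exact ⟨x + y, J.add_mem hx hy, rfl⟩)
    (by rintro _ ⟨x, hx, rfl⟩; exact ⟨-x, J.neg_mem hx, rfl⟩)
    (by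
      rintro x _ ⟨y, hy, rfl⟩
      obtain ⟨x, rfl⟩ := CrossedProduct.mk_surjective x
      exact ⟨x * y, J.mul_mem_left _ _ hy, rfl⟩)
    (by
      rintro _ y ⟨x, hx, rfl⟩
      obtain ⟨y, rfl⟩ := CrossedProduct.mk_surjective y
      exact ⟨x * y, J.mul_mem_right _ _ hx, rfl⟩)

theorem mk_mem_crossedProductImage {J : TwoSidedIdeal (Toeplitz hσ)}
    (hRJ : (redundancyIdeal hσ).1 ≤ J) {b : Toeplitz hσ} :
    CrossedProduct.mk hσ b ∈ crossedProductImage J ↔ b ∈ J := by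
  refine (TwoSidedIdeal.mem_mk' _ _ _ _ _ _ _).trans ⟨?_, fun h => ⟨b, h, rfl⟩⟩
  rintro ⟨c, hc, hcb⟩
  have h := J.sub_mem hc (hRJ (CrossedProduct.mk_eq_mk_iff.1 hcb))
  rwa [sub_sub_cancel] at h

/-- In the quotient topology closedness is tested on the preimage, which is `J` itself as `J`
contains the kernel. -/
theorem isClosed_crossedProductImage {J : TwoSidedIdeal (Toeplitz hσ)}
    (hRJ : (redundancyIdeal hσ).1 ≤ J) (hJ : IsClosed (J : Set (Toeplitz hσ))) :
    IsClosed (crossedProductImage J : Set (CrossedProduct hσ)) := by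
  refine isClosed_coinduced.2 ?_
  have : CrossedProduct.mk hσ ⁻¹' (crossedProductImage J : Set (CrossedProduct hσ)) = J :=
    Set.ext fun _ => mk_mem_crossedProductImage hRJ
  rwa [this]

theorem mk_ofA_mem_idealOfOpen {V : Opens X} {a : C(X, ℂ)} (ha : ∀ x ∉ V, a x = 0) :
    CrossedProduct.mk hσ (ofA hσ a) ∈ (idealOfOpen hσ V).1 :=
  subset_closedIdealGen _ ⟨a, ContinuousMap.mem_idealOfSet.2 fun x hx => ha x hx, rfl⟩

/-- The orbit representation over the complement of `V` factors through the crossed product and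
kills C₀(V), hence the ideal generated by it. It kills a function only if that function vanishes off
`V`. -/
theorem apply_eq_zero_of_mk_ofA_mem_idealOfOpen {V : Opens X} (hV : IsInvariant σ (V : Set X))
    {a : C(X, ℂ)} (ha : CrossedProduct.mk hσ (ofA hσ a) ∈ (idealOfOpen hσ V).1) {x : X}
    (hx : x ∉ V) : a x = 0 := by
  let J : TwoSidedIdeal (Toeplitz hσ) := TwoSidedIdeal.ker (orbitHom hσ hV.compl 1)
  have hmem : ∀ b, b ∈ J ↔ orbitHom hσ hV.compl 1 b = 0 := fun b => TwoSidedIdeal.mem_ker _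
  have hJ : IsClosed (J : Set (Toeplitz hσ)) := by
    have : (J : Set (Toeplitz hσ)) = orbitHom hσ hV.compl 1 ⁻¹' {0} := Set.ext hmem
    rw [this]
    exact isClosed_singleton.preimage (continuous_starHom _)
  have hRJ : (redundancyIdeal hσ).1 ≤ J := fun b hb =>
    (hmem b).2 (orbitHom_eq_zero_of_mem_redundancyIdeal hV.compl 1 hb)
  have h1 : (idealOfOpen hσ V).1 ≤ crossedProductImage J := by
    refine closedIdealGen_le (isClosed_crossedProductImage hRJ hJ) ?_
    rintro _ ⟨c, hc, rfl⟩
    refine (mk_mem_crossedProductImage hRJ).2 ((hmem _).2 ?_)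
    exact (orbitHom_ofA_eq_zero_iff hV.compl 1 c).2 fun y hy =>
      ContinuousMap.mem_idealOfSet.1 hc hy
  exact (orbitHom_ofA_eq_zero_iff hV.compl 1 a).1
    ((hmem _).1 ((mk_mem_crossedProductImage hRJ).1 (h1 ha))) x hx

theorem le_of_idealOfOpen_le {V V' : Opens X} (hV' : IsInvariant σ (V' : Set X))
    (h : (idealOfOpen hσ V).1 ≤ (idealOfOpen hσ V').1) : V ≤ V' := by
  intro x hx
  by_contra hx'
  obtain ⟨a, ha, haV⟩ := exists_peaksAt V.isOpen hx
  have h1 := apply_eq_zero_of_mk_ofA_mem_idealOfOpen hV' (h (mk_ofA_mem_idealOfOpen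
    fun y hy => eq_zero_of_notMem_of_tsupport_subset haV hy)) hx'
  rw [ha.apply_eq] at h1
  exact one_ne_zero h1

/-- The functions in `J` form a closed ideal of C(X), and such an ideal is determined by its zeros.
-/
theorem ofA_mem_of_forall_zeroSet {J : TwoSidedIdeal (Toeplitz hσ)}
    (hJ : IsClosed (J : Set (Toeplitz hσ))) {a : C(X, ℂ)} (ha : ∀ x ∈ zeroSet J, a x = 0) :
    ofA hσ a ∈ J := by
  let K : Ideal C(X, ℂ) :=
    { carrier := ofA hσ ⁻¹' J
      add_mem' := fun {a b} ha hb => by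
        rw [mem_preimage, ofA_add]; exact J.add_mem ha hb
      zero_mem' := by rw [mem_preimage, ofA_zero]; exact J.zero_mem
      smul_mem' := fun c a ha => by
        rw [smul_eq_mul, mem_preimage, ofA_mul]; exact J.mul_mem_left _ _ ha }
  have hK : IsClosed (K : Set C(X, ℂ)) := hJ.preimage continuous_ofA
  have h1 : a ∈ ContinuousMap.idealOfSet ℂ (ContinuousMap.setOfIdeal K) :=
    ContinuousMap.mem_idealOfSet.2 fun x hx => ha x fun b hb =>
      ContinuousMap.notMem_setOfIdeal.1 hx hb
  rw [ContinuousMap.idealOfSet_ofIdeal_isClosed hK] at h1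
  exact h1

/-- The open set complementary to the zeros of an ideal of the crossed product. -/
def openOfIdeal (I : TwoSidedIdeal (CrossedProduct hσ)) : Opens X :=
  ⟨(zeroSet (toeplitzPreimage I))ᶜ, (isClosed_zeroSet _).isOpen_compl⟩

theorem isInvariant_openOfIdeal (I : TwoSidedIdeal (CrossedProduct hσ)) :
    IsInvariant σ (openOfIdeal I : Set X) :=
  (isInvariant_zeroSet (redundancyIdeal_le_toeplitzPreimage I)).compl

/-- The functions vanishing on the zero set of `I` are exactly those of C₀(V) for `V = openOfIdeal
I`. They lie in both ideals; freeness is needed only to bound `I` from above. -/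
theorem eq_idealOfOpen_openOfIdeal
    (hfree : ∀ (X' : Set X) (hX' : IsInvariant σ X'), IsClosed X' →
      TopologicallyFree (restrict σ hX')) (I : ClosedIdeal (CrossedProduct hσ)) :
    I = idealOfOpen hσ (openOfIdeal I.1) := by
  have hJ := isClosed_toeplitzPreimage I.2
  have hRJ := redundancyIdeal_le_toeplitzPreimage I.1
  refine Subtype.ext (le_antisymm ?_ (closedIdealGen_le I.2 ?_))
  · intro q hq
    obtain ⟨b, rfl⟩ := CrossedProduct.mk_surjective q
    refine mem_toeplitzPreimage.1 (le_of_forall_ofA_mem hJ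
      (isClosed_toeplitzPreimage (idealOfOpen hσ _).2) hRJ
      (redundancyIdeal_le_toeplitzPreimage _) (fun a ha => mem_toeplitzPreimage.2
        (mk_ofA_mem_idealOfOpen fun x hx => ha x (not_not.1 hx)))
      (hfree _ _ (isClosed_zeroSet _)) (mem_toeplitzPreimage.2 hq))
  · rintro _ ⟨a, ha, rfl⟩
    exact mem_toeplitzPreimage.1 (ofA_mem_of_forall_zeroSet hJ fun x hx =>
      ContinuousMap.mem_idealOfSet.1 ha (not_not.2 hx))

end CrossedProductIdeals

end PartialEndo

end

open TopologicalSpace PartialEndo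

theorem theorem4p8 {X : Type*} [TopologicalSpace X] [CompactSpace X] [T2Space X]
    {U : Opens X} {σ : U → X} (hσ : IsLocalHomeomorph σ)
    (hfree : ∀ (X' : Set X) (hX' : IsInvariant σ X'), IsClosed X' →
      TopologicallyFree (restrict σ hX')) :
    (∀ I : ClosedIdeal (CrossedProduct hσ), ∃ V : Opens X, I = idealOfOpen hσ V) ∧
    Function.Bijective (fun V : {V : Opens X // IsInvariant σ (V : Set X)} =>
      idealOfOpen hσ V.1) := by
  refine ⟨fun I => ⟨_, eq_idealOfOpen_openOfIdeal hfree I⟩, ?_, fun I =>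
    ⟨⟨openOfIdeal I.1, isInvariant_openOfIdeal I.1⟩, (eq_idealOfOpen_openOfIdeal hfree I).symm⟩⟩
  rintro ⟨V, hV⟩ ⟨V', hV'⟩ h
  have h' : idealOfOpen hσ V = idealOfOpen hσ V' := h
  exact Subtype.ext (le_antisymm (le_of_idealOfOpen_le hV' (by rw [h']))
    (le_of_idealOfOpen_le hV (by rw [h'])))
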